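/- Let $\mathbb F$ be an algebraically closed field of characteristic $p>3$, let $m=2r$ with $r\ge 1$, let $n\ge 1$ be odd, $n=2s+1$, and let $t_1,\dots,t_m$ be positive integers. Put $I_0=\{1,\dots,m\}$, $I_1=\{m+1,\dots,m+n\}$, $I=I_0\cup I_1$, $\mu(i)=0$ for $i\in I_0$, $\mu(i)=1$ for $i\in I_1$, $\pi_i=p^{t_i}-1$, $\pi=(\pi_1,\dots,\pi_m)$. Let $\mathcal O(m,n)$ be the tensor product of the divided power algebra in $m$ even variables and the exterior algebra in $n$ odd variables, with basis $x^{(\alpha)}x^u$, $\alpha\in\mathbb N^m$, $u\subseteq I_1$ (where $x^u$ is the ordered product of the $x_k$, $k\in u$), and partial superderivations $\partial_i$, $i\in I$; let $x^\omega$ be the product of all odd variables $x_{m+1}\cdots x_{m+n}$. Let $i'=i+r$ for $1\le i\le r$, $i'=i-r$ for $r<i\le m$, $i'=i+s$ for $m<i\le m+s$, $i'=i-s$ for $m+s<i\le m+2s$, $(m+n)'=m+n$; let $\tau(i)=-1$ for $r<i\le m$ and $\tau(i)=1$ otherwise; and let $$D_H(f)=\sum_{i\in I}\tau(i)(-1)^{\mu(i)p(f)}\partial_i(f)\,\partial_{i'}$$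 for $f$ homogeneous of parity $p(f)$, extended linearly. Let $W_{\bar 1}$ be the odd part of the Witt superalgebra $W=W(m,n;\underline t)=\mathrm{span}\{x^{(\alpha)}x^u\partial_j : \alpha\le\pi,\ u\subseteq I_1,\ j\in I\}$, graded by $\deg x^{(\alpha)}x^u\partial_j=|\alpha|+|u|-1$, and let $H_{\bar 0}=\mathrm{span}\{D_H(x^{(\alpha)}x^u) : \alpha\le\pi,\ |u|\text{ even},\ (\alpha,u)\ne(\pi,I_1)\}$ be the even part of the Hamiltonian superalgebra $H(m,n;\underline t)$, with the induced grading. Define linear maps $H_{\bar 0}\to W_{\bar 1}$ as follows, for $\mu\in\mathbb F$, $i\in I_0$, $q\ge 1$: * $\Gamma_\mu$ sends $D_H(x^{(\pi)})$ to $\mu D_H(x^\omega)$ and every other $D_H(x^{(\alpha)}x^u)$ in the spanning set to $0$; * $\Phi_i^{(q)}(D_H(f))=\partial_i^{p^q}(f)\,D_H(x^\omega)$; * $\Theta_i^{(q)}(D)=x^\omega(\mathrm{ad}\,\partial_i)^{p^q}(D)$; * $\mathrm{ad}\,\mathfrak D$, $D\mapsto[\mathfrak D,D]$, where $\mathfrak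 D=\sum_{k\in I_1}x_kx_{m+n}\partial_k$. **Theorem 4.8.** Let $\varphi:H_{\bar 0}\to W_{\bar 1}$ be a $\mathbb Z$-homogeneous derivation (that is, $\varphi$ is linear, shifts degrees by a constant, and $\varphi([D,E])=[\varphi(D),E]+[D,\varphi(E)]$ for $D,E\in H_{\bar 0}$) with $\varphi\big((H_{\bar 0})_{-1}\oplus(H_{\bar 0})_0\big)=0$. Then there are scalars $\mu$, $\lambda$, $\lambda_i^{(q)}$, $\mu_i^{(q)}\in\mathbb F$, for $i\in I_0$ and $1\le q\le t_i-1$, such that $$\varphi=\Gamma_\mu+\lambda\,\mathrm{ad}\,\mathfrak D+\sum_{i\in I_0}\ \sum_{1\le q\le t_i-1}\big(\lambda_i^{(q)}\Phi_i^{(q)}+\mu_i^{(q)}\Theta_i^{(q)}\big).$$ -/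

import Mathlib

noncomputable section

namespace OddHam

/-- The set `I = I₀ ∪ I₁` of indices of the variables, with `m = 2r` even variables (`I₀`) and
`n` odd variables (`I₁`). -/
abbrev Idx (r n : ℕ) := Fin (2 * r) ⊕ Fin n

/-- The superalgebra `𝒪(m, n)`, `m = 2r`: divided power algebra tensor exterior algebra, as the
vector space with basis the monomials `x^(α) x^u`, where `α ∈ ℕ^m` and `u` is a set of odd indices
(`x^u` is the product of the `x_k`, `k ∈ u`, in increasing order). Its product is `mulL`. -/
def Alg (F : Type*) [Field F] (r n : ℕ) := ((Fin (2 * r) → ℕ) × Finset (Fin n)) →₀ F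

instance (F : Type*) [Field F] (r n : ℕ) : AddCommGroup (Alg F r n) :=
  inferInstanceAs (AddCommGroup (((Fin (2 * r) → ℕ) × Finset (Fin n)) →₀ F))

instance (F : Type*) [Field F] (r n : ℕ) : Module F (Alg F r n) :=
  inferInstanceAs (Module F (((Fin (2 * r) → ℕ) × Finset (Fin n)) →₀ F))

section Basic

variable (F : Type*) [Field F] {r n : ℕ}

/-- The basis of monomials of `𝒪(m, n)`. -/
def monBasis : Module.Basis ((Fin (2 * r) → ℕ) × Finset (Fin n)) F (Alg F r n) :=
  ⟨LinearEquiv.refl F (((Fin (2 * r) → ℕ) × Finset (Fin n)) →₀ F)⟩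

/-- The monomial `x^(α) x^u`. -/
def mon (α : Fin (2 * r) → ℕ) (u : Finset (Fin n)) : Alg F r n := monBasis F (α, u)

/-- `x^u x^v = invSign u v • x^(u ∪ v)` for disjoint `u`, `v`: the sign of the number of
inversions. -/
def invSign (u v : Finset (Fin n)) : F :=
  (-1) ^ ((u ×ˢ v).filter fun q => q.2 < q.1).card

/-- The product of two monomials:
`x^(α) x^u * x^(β) x^v = binom(α + β, α) x^(α + β) x^u x^v`. -/
def monMul (b c : (Fin (2 * r) → ℕ) × Finset (Fin n)) : Alg F r n :=
  if Disjoint b.2 c.2 then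
    ((∏ i, ((b.1 i + c.1 i).choose (b.1 i) : F)) * invSign F b.2 c.2) •
      mon F (b.1 + c.1) (b.2 ∪ c.2)
  else 0

/-- `mulL F f` is the left multiplication `g ↦ f g` of the superalgebra `𝒪(m, n)`. -/
def mulL : Alg F r n →ₗ[F] Module.End F (Alg F r n) :=
  (monBasis F).constr F fun b => (monBasis F).constr F fun c => monMul F b c

/-- The value of `∂_i` on a monomial: `∂_i (x^(α) x^u) = x^(α - ε_i) x^u` for even `i` (and `0` if
`α_i = 0`), and for odd `k` the left superderivation with `∂_k (x_l) = δ_{kl}`. -/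
def pdMon : Idx r n → (Fin (2 * r) → ℕ) × Finset (Fin n) → Alg F r n
  | .inl i, b => if 0 < b.1 i then mon F (Function.update b.1 i (b.1 i - 1)) b.2 else 0
  | .inr k, b =>
      if k ∈ b.2 then
        ((-1 : F) ^ (b.2.filter fun l => l < k).card) • mon F b.1 (b.2.erase k)
      else 0

/-- The partial superderivations `∂_i`, `i ∈ I`, of `𝒪(m, n)`. -/
def pd (i : Idx r n) : Module.End F (Alg F r n) :=
  (monBasis F).constr F (pdMon F i)

/-- The parity `μ(i)` of an index. -/
def par : Idx r n → ℕ
  | .inl _ => 0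
  | .inr _ => 1

/-- The involution `i ↦ i'` on the even indices: `i' = i + r` for the first `r` of them and
`i' = i - r` for the others. -/
def evenConj (i : Fin (2 * r)) : Fin (2 * r) :=
  if h : i.1 < r then ⟨i.1 + r, by omega⟩ else ⟨i.1 - r, by omega⟩

/-- The involution on the odd indices, where `s = ⌊n / 2⌋`: it exchanges `k` and `k + s` for
`k` among the first `s` odd indices, and fixes the last odd index if `n` is odd. -/
def oddConj (k : Fin n) : Fin n :=
  if h : k.1 < n / 2 then ⟨k.1 + n / 2, by omega⟩
  else if k.1 < 2 * (n / 2) then ⟨k.1 - n / 2, by omega⟩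
  else k

/-- The involution `i ↦ i'` of `I`. -/
def conj : Idx r n → Idx r n
  | .inl i => .inl (evenConj i)
  | .inr k => .inr (oddConj k)

/-- The sign `τ(i)`. -/
def tau : Idx r n → F
  | .inl i => if i.1 < r then 1 else -1
  | .inr _ => 1

/-- The linear map `D_H : 𝒪(m, n) → W(m, n)`,
`D_H(f) = ∑_i τ(i) (-1)^(μ(i) p(f)) ∂_i(f) ∂_{i'}`. Here and below, `W(m, n)` is realized in the
linear operators on `𝒪(m, n)`: `g ∂_j` is `h ↦ g * ∂_j(h)`. -/
def DH : Alg F r n →ₗ[F] Module.End F (Alg F r n) :=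
  (monBasis F).constr F fun b =>
    ∑ i : Idx r n, (tau F i * (-1) ^ (par i * b.2.card)) • (mulL F (pdMon F i b) * pd F (conj i))

end Basic

section Kernel

variable {F : Type*} [Field F] {r n : ℕ}

/-- The variable `x_i`, `i ∈ I`. -/
def var (F : Type*) [Field F] : Idx r n → Alg F r n
  | .inl i => mon F (Pi.single i 1) ∅
  | .inr k => mon F 0 {k}

theorem evenConj_evenConj (i : Fin (2 * r)) : evenConj (evenConj i) = i := by
  apply Fin.ext
  by_cases h : i.1 < r
  · simp [evenConj, h]
  · have h2 : i.1 - r < r := by omega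
    simp [evenConj, h, h2]; omega

theorem oddConj_oddConj (k : Fin n) : oddConj (oddConj k) = k := by
  apply Fin.ext
  by_cases h : k.1 < n / 2
  · have h2 : k.1 + n / 2 < 2 * (n / 2) := by omega
    simp [oddConj, h, h2]
  · by_cases h3 : k.1 < 2 * (n / 2)
    · have h2 : k.1 - n / 2 < n / 2 := by omega
      simp [oddConj, h, h3, h2]; omega
    · simp [oddConj, h, h3]

theorem conj_conj (i : Idx r n) : conj (conj i) = i := by
  cases i <;> simp [conj, evenConj_evenConj, oddConj_oddConj]

theorem pd_mon (i : Idx r n) (α : Fin (2 * r) → ℕ) (u : Finset (Fin n)) :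
    pd F i (mon F α u) = pdMon F i (α, u) := by
  simp [pd, mon, Module.Basis.constr_basis]

theorem repr_mon (α β : Fin (2 * r) → ℕ) (u v : Finset (Fin n)) :
    (monBasis F).repr (mon F α u) (β, v) = if α = β ∧ u = v then 1 else 0 := by
  simp [mon, Module.Basis.repr_self, Finsupp.single_apply]

theorem pd_var (i j : Idx r n) : pd F i (var F j) = if i = j then mon F 0 ∅ else 0 := by
  rcases i with i | i <;> rcases j with j | j
  · simp only [var, pd_mon, pdMon, Sum.inl.injEq]
    by_cases h : i = j
    · subst h
      simp only [Pi.single_eq_same, Nat.lt_one_iff, if_true, Nat.sub_self]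
      congr 1
      funext l
      by_cases hl : l = i
      · subst hl; simp
      · simp [hl]
    · simp [h]
  · simp [var, pd_mon, pdMon]
  · simp [var, pd_mon, pdMon]
  · simp only [var, pd_mon, pdMon, Sum.inr.injEq]
    by_cases h : i = j
    · subst h
      have : (({i} : Finset (Fin n)).filter fun l => l < i) = ∅ := by
        ext l; simp; rintro rfl; exact le_refl _
      simp [this]
    · simp [h]

theorem mulL_one (f : Alg F r n) : mulL F f (mon F 0 ∅) = f := by
  suffices h : (mulL F).flip (mon F 0 ∅) = (LinearMap.id : Alg F r n →ₗ[F] Alg F r n) from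
    LinearMap.congr_fun h f
  refine (monBasis F).ext fun b => ?_
  simp only [LinearMap.flip_apply, mulL, mon, Module.Basis.constr_basis, LinearMap.id_apply]
  simp only [monMul, Finset.disjoint_empty_right, if_true, invSign, Finset.product_empty,
    Finset.filter_empty, Finset.card_empty, pow_zero, mul_one, Pi.zero_apply, add_zero,
    Nat.choose_self, Nat.cast_one, Finset.prod_const_one, one_smul, Finset.union_empty, mon]

theorem DH_var (j : Idx r n) :
    (DH F).flip (var F (conj j)) =
      (monBasis F).constr F
        (fun b => (tau F j * (-1) ^ (par j * b.2.card)) • pdMon F j b) := by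
  refine (monBasis F).ext fun b => ?_
  simp only [LinearMap.flip_apply, DH, Module.Basis.constr_basis, LinearMap.smul_apply,
    LinearMap.sum_apply, Module.End.mul_apply]
  rw [Finset.sum_eq_single j]
  · rw [pd_var, if_pos rfl, mulL_one]
  · intro i _ hi
    rw [pd_var, if_neg, map_zero, smul_zero]
    intro h
    exact hi (by rw [← conj_conj i, h, conj_conj])
  · simp

theorem tau_ne_zero (j : Idx r n) : tau F j ≠ 0 := by
  rcases j with i | k
  · simp only [tau]; split_ifs <;> simp
  · simp [tau]

theorem coeff_eq_zero_of_DH_eq_zero (f : Alg F r n) (hf : DH F f = 0)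
    (b : (Fin (2 * r) → ℕ) × Finset (Fin n)) (hb : b ≠ (0, ∅)) : (monBasis F).repr f b = 0 := by
  have key : ∀ j : Idx r n, ∀ c : (Fin (2 * r) → ℕ) × Finset (Fin n), ∀ e : F, e ≠ 0 →
      (∀ a, (tau F j * (-1) ^ (par j * a.2.card)) * (monBasis F).repr (pdMon F j a) c =
        if a = b then e else 0) → (monBasis F).repr f b = 0 := by
    intro j c e he h
    have h2 : (monBasis F).coord c ∘ₗ (DH F).flip (var F (conj j)) =
        e • (monBasis F).coord b := by
      rw [DH_var]
      refine (monBasis F).ext fun a => ?_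
      simp only [LinearMap.comp_apply, Module.Basis.constr_basis, Module.Basis.coord_apply,
        map_smul, smul_eq_mul, h, LinearMap.smul_apply,
        Module.Basis.repr_self, Finsupp.single_apply]
      split_ifs <;> simp
    have h3 := LinearMap.congr_fun h2 f
    simp only [LinearMap.comp_apply, LinearMap.flip_apply, hf, LinearMap.zero_apply, map_zero,
      LinearMap.smul_apply, Module.Basis.coord_apply, smul_eq_mul] at h3
    exact (mul_eq_zero.mp h3.symm).resolve_left he
  obtain ⟨α, u⟩ := b
  by_cases hα : α = 0
  · have hu : u.Nonempty := by
      rw [Finset.nonempty_iff_ne_empty]; rintro rfl; exact hb (by rw [hα])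
    obtain ⟨k, hk⟩ := hu
    refine key (.inr k) (α, u.erase k)
      ((tau F (.inr k : Idx r n) * (-1) ^ (par (.inr k : Idx r n) * u.card)) *
        (-1 : F) ^ (u.filter fun l => l < k).card) ?_ ?_
    · have := tau_ne_zero (F := F) (.inr k : Idx r n)
      simp [this]
    · rintro ⟨β, v⟩
      simp only [pdMon]
      by_cases hv : k ∈ v
      · simp only [hv, if_true, map_smul, Finsupp.smul_apply, repr_mon, smul_eq_mul,
          Prod.mk.injEq]
        by_cases hvu : v = u
        · subst hvu
          by_cases hβ : β = α <;> simp [hβ]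
        · have : v.erase k ≠ u.erase k := by
            intro h
            exact hvu (by rw [← Finset.insert_erase hv, h, Finset.insert_erase hk])
          simp [hvu, this]
      · have : v ≠ u := by rintro rfl; exact hv hk
        simp [hv, this]
  · have : ∃ i, 0 < α i := by
      by_contra h
      push Not at h
      exact hα (funext fun i => Nat.le_zero.mp (h i))
    obtain ⟨i, hi⟩ := this
    refine key (.inl i) (Function.update α i (α i - 1), u)
      (tau F (.inl i : Idx r n)) (tau_ne_zero _) ?_
    rintro ⟨β, v⟩
    simp only [pdMon, par, zero_mul, pow_zero, mul_one]
    by_cases hβ : 0 < β i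
    · simp only [hβ, if_true, repr_mon, Prod.mk.injEq]
      have : Function.update β i (β i - 1) = Function.update α i (α i - 1) ↔ β = α := by
        constructor
        · intro h
          funext l
          have hl := congrFun h l
          by_cases hli : l = i
          · subst hli; simp at hl; omega
          · simpa [hli] using hl
        · rintro rfl; rfl
      simp only [this, mul_ite, mul_one, mul_zero]
    · have : β ≠ α := by rintro rfl; exact hβ hi
      simp [hβ, this]

end Kernel

section Factor

variable {F V W M : Type*} [Field F] [AddCommGroup V] [Module F V] [AddCommGroup W] [Module F W]
  [AddCommGroup M] [Module F M]

/-- The linear map `g(v) ↦ L(v)` on a subspace `S` of the range of `g`, if `ker g ≤ ker L`. -/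
def factorOn (g : V →ₗ[F] W) (L : V →ₗ[F] M) (h : LinearMap.ker g ≤ LinearMap.ker L)
    (S : Submodule F W) (hS : S ≤ LinearMap.range g) : S →ₗ[F] M :=
  ((LinearMap.ker g).liftQ L h ∘ₗ g.quotKerEquivRange.symm.toLinearMap) ∘ₗ
    Submodule.inclusion hS

theorem factorOn_apply (g : V →ₗ[F] W) (L : V →ₗ[F] M) (h : LinearMap.ker g ≤ LinearMap.ker L)
    (S : Submodule F W) (hS : S ≤ LinearMap.range g) (v : V) (hv : g v ∈ S) :
    factorOn g L h S hS ⟨g v, hv⟩ = L v := by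
  have h1 : Submodule.inclusion hS ⟨g v, hv⟩ =
      g.quotKerEquivRange (Submodule.Quotient.mk v) := by
    apply Subtype.ext
    simp
  simp only [factorOn, LinearMap.comp_apply, h1, LinearEquiv.coe_coe,
    LinearEquiv.symm_apply_apply, Submodule.liftQ_apply]

end Factor

section Parts

variable (F : Type*) [Field F] (p : ℕ) {r : ℕ} (n : ℕ) (t : Fin (2 * r) → ℕ+)

/-- The tuple `π`, `π_i = p^(t_i) - 1`. -/
def piTop : Fin (2 * r) → ℕ := fun i => p ^ (t i : ℕ) - 1

/-- `W_1̄`, the odd part of `W = W(m, n; t)`, spanned by the `x^(α) x^u ∂_j`, `α ≤ π`, of odd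
parity `|u| + μ(j)`. -/
def Wodd : Submodule F (Module.End F (Alg F r n)) :=
  Submodule.span F {D | ∃ α u, ∃ j : Idx r n,
    α ≤ piTop p t ∧ Odd (u.card + par j) ∧ D = mulL F (mon F α u) * pd F j}

/-- The homogeneous component of degree `k` of `W = W(m, n; t)`, spanned by the `x^(α) x^u ∂_j`,
`α ≤ π`, with `|α| + |u| = k + 1`. -/
def Wdeg (k : ℤ) : Submodule F (Module.End F (Alg F r n)) :=
  Submodule.span F {D | ∃ α u, ∃ j : Idx r n,
    α ≤ piTop p t ∧ (((∑ i, α i) + u.card : ℕ) : ℤ) = k + 1 ∧ D = mulL F (mon F α u) * pd F j}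

/-- `H_0̄`, the even part of the Hamiltonian superalgebra `H = H(m, n; t)`, spanned by the
`D_H(x^(α) x^u)` with `α ≤ π`, `|u|` even and `(α, u) ≠ (π, ω)`. -/
def Heven : Submodule F (Module.End F (Alg F r n)) :=
  Submodule.span F {D | ∃ α, ∃ u : Finset (Fin n),
    α ≤ piTop p t ∧ Even u.card ∧ (α, u) ≠ (piTop p t, Finset.univ) ∧ D = DH F (mon F α u)}

variable {F n} in
/-- `ad D : E ↦ [D, E] = D E - E D`. This is the superbracket of operators whenever `D` or `E` is
even, which is the only case needed here. -/
def ad (D : Module.End F (Alg F r n)) :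
    Module.End F (Alg F r n) →ₗ[F] Module.End F (Alg F r n) :=
  LinearMap.mulLeft F D - LinearMap.mulRight F D

/-- `φ : H_0̄ → W_1̄` is a derivation: `φ([D, E]) = [φ(D), E] + [D, φ(E)]` (note that `H_0̄` is
closed under the bracket). -/
def IsDer (φ : Heven F p n t →ₗ[F] Wodd F p n t) : Prop :=
  ∀ D E G : Heven F p n t, G.1 = ad D.1 E.1 →
    (φ G).1 = ad (φ D).1 E.1 + ad D.1 (φ E).1

/-- `φ : H_0̄ → W_1̄` is homogeneous for the `ℤ`-gradings. -/
def IsHomog (φ : Heven F p n t →ₗ[F] Wodd F p n t) : Prop :=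
  ∃ d : ℤ, ∀ k : ℤ, ∀ D : Heven F p n t, D.1 ∈ Wdeg F p n t k → (φ D).1 ∈ Wdeg F p n t (k + d)

/-- `φ` vanishes on the top `(H_0̄)_{-1} ⊕ (H_0̄)_0` of `H_0̄`. -/
def VanishesOnTop (φ : Heven F p n t →ₗ[F] Wodd F p n t) : Prop :=
  ∀ D : Heven F p n t, D.1 ∈ Wdeg F p n t (-1) ⊔ Wdeg F p n t 0 → φ D = 0

theorem Heven_le_range : Heven F p n t ≤ LinearMap.range (DH F (r := r) (n := n)) := by
  refine Submodule.span_le.mpr ?_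
  rintro D ⟨α, u, -, -, -, rfl⟩
  exact ⟨_, rfl⟩

variable {F n} in
theorem ker_DH_le {M : Type*} [AddCommGroup M] [Module F M] (L : Alg F r n →ₗ[F] M)
    (hL : L (mon F 0 ∅) = 0) : LinearMap.ker (DH F (r := r) (n := n)) ≤ LinearMap.ker L := by
  intro f hf
  have hf' : f = (monBasis F).repr f (0, ∅) • mon F 0 ∅ := by
    refine (monBasis F).ext_elem fun b => ?_
    rw [map_smul, Finsupp.smul_apply, mon, Module.Basis.repr_self]
    by_cases hb : b = (0, ∅)
    · subst hb; simp
    · rw [coeff_eq_zero_of_DH_eq_zero f hf b hb]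
      simp [Ne.symm hb]
  rw [LinearMap.mem_ker, hf', map_smul, hL, smul_zero]

variable {F n} in
/-- The linear map `D_H(f) ↦ L(f)` on `H_0̄`, for a linear map `L` on `𝒪(m, n)` with `L(1) = 0`;
it is well defined because `ker D_H = F 1`. -/
def descend {M : Type*} [AddCommGroup M] [Module F M] (L : Alg F r n →ₗ[F] M)
    (hL : L (mon F 0 ∅) = 0) : Heven F p n t →ₗ[F] M :=
  factorOn (DH F) L (ker_DH_le L hL) (Heven F p n t) (Heven_le_range F p n t)

variable {F n} in
theorem descend_DH {M : Type*} [AddCommGroup M] [Module F M] (L : Alg F r n →ₗ[F] M)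
    (hL : L (mon F 0 ∅) = 0) (f : Alg F r n) (hf : DH F f ∈ Heven F p n t) :
    descend p t L hL ⟨DH F f, hf⟩ = L f :=
  factorOn_apply _ _ _ _ _ f hf

theorem piTop_ne_zero [NeZero r] [Fact p.Prime] : piTop p t ≠ 0 := by
  intro h
  have hr : 0 < r := Nat.pos_of_ne_zero (NeZero.ne r)
  have h0 := congrFun h ⟨0, by omega⟩
  have h1 : 1 < p ^ (t ⟨0, by omega⟩ : ℕ) :=
    Nat.one_lt_pow (PNat.ne_zero _) (Fact.out : p.Prime).one_lt
  simp only [piTop, Pi.zero_apply] at h0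
  omega

theorem pd_pow_one [Fact p.Prime] (i : Fin (2 * r)) (q : ℕ) :
    (pd F (.inl i : Idx r n) ^ (p ^ q)) (mon F 0 ∅) = 0 := by
  obtain ⟨k, hk⟩ := Nat.exists_eq_succ_of_ne_zero
    (pow_ne_zero q (Fact.out : p.Prime).ne_zero)
  rw [hk, pow_succ, Module.End.mul_apply]
  have : pd F (.inl i : Idx r n) (mon F 0 ∅) = 0 := by simp [pd_mon, pdMon]
  rw [this, map_zero]

/-- `Γ_μ : H_0̄ → W_1̄`, the linear map that sends `D_H(x^(π))` to `μ D_H(x^ω)` and all other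
`D_H(x^(α) x^u)` to `0`; here `x^ω` is the product of all odd variables. -/
def Gam [NeZero r] [Fact p.Prime] (μ : F) : Heven F p n t →ₗ[F] Module.End F (Alg F r n) :=
  descend p t
    ((μ • (monBasis F).coord (piTop p t, (∅ : Finset (Fin n)))).smulRight
      (DH F (mon F 0 Finset.univ)))
    (by
      have := piTop_ne_zero p t
      simp [repr_mon, Ne.symm this])

/-- `Φ_i^(q) : H_0̄ → W_1̄`, `D_H(f) ↦ ∂_i^(p^q)(f) D_H(x^ω)`. -/
def Phi [Fact p.Prime] (i : Fin (2 * r)) (q : ℕ) :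
    Heven F p n t →ₗ[F] Module.End F (Alg F r n) :=
  descend p t
    (LinearMap.mulRight F (DH F (mon F 0 Finset.univ)) ∘ₗ mulL F ∘ₗ
      (pd F (.inl i : Idx r n) ^ (p ^ q)))
    (by simp only [LinearMap.comp_apply, pd_pow_one F p n i q, map_zero])

/-- `Θ_i^(q) : H_0̄ → W_1̄`, `D ↦ x^ω (ad ∂_i)^(p^q)(D)`. -/
def Theta (i : Fin (2 * r)) (q : ℕ) : Heven F p n t →ₗ[F] Module.End F (Alg F r n) :=
  LinearMap.mulLeft F (mulL F (mon F 0 Finset.univ)) ∘ₗ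
    (ad (pd F (.inl i)) ^ (p ^ q) : Module.End F (Module.End F (Alg F r n))) ∘ₗ
      (Heven F p n t).subtype

variable (r) in
/-- The element `𝔇 = ∑_{k ∈ I₁} x_k x_{m+n} ∂_k` of `W_1̄`, where `x_{m+n}` is the last odd
variable. -/
def calD (hn : 0 < n) : Module.End F (Alg F r n) :=
  ∑ k : Fin n, mulL F (mulL F (var F (.inr k)) (var F (.inr ⟨n - 1, by omega⟩))) * pd F (.inr k)

/-- `ad 𝔇 : H_0̄ → W_1̄`, `D ↦ [𝔇, D]`. -/
def adCalD (hn : 0 < n) : Heven F p n t →ₗ[F] Module.End F (Alg F r n) :=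
  ad (calD F r n hn) ∘ₗ (Heven F p n t).subtype

end Parts

end OddHam

end

noncomputable section

namespace OddHam

/-! ### The supercommutative ring structure of 𝒪(m, n) -/

section Ring

variable {F : Type*} [Field F] {r n : ℕ}

/-! For even f, the operator D_H(f) is the Hamiltonian field of f: its value at g is the Poisson
bracket {f, g}, and [D_H(f), D_H(g)] = D_H({f, g}) (`ad_DH_DH`). Hence φ becomes a linear map ψ from
even functions to odd vector fields with ψ({f, g}) = [ψ(f), D_H(g)] + [D_H(f), ψ(g)]; this is the
structure `OddDer`.

The maps Γ, Φ, Θ are derivations of this kind because D_H(f) annihilates x^ω (`DH_apply_top`), so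
that it commutes with D_H(x^ω) and with multiplication by x^ω, while ∂_i^(p^q) is a derivation of
the bracket in characteristic p, and x^(π) never occurs in a bracket. Like φ, they vanish on
functions of degree at most 2. Subtracting suitable multiples makes one coefficient of ψ vanish at
each of x^(π), x^(p^q ε_i) and x^(p^q ε_i + ε_{i'}). The claim is that such a ψ is zero
(`OddDer.kills`); in particular the coefficient of ad 𝔇 can be taken to be 0.

The claim is an induction on the degree of functions. Brackets of killed functions are killed, and
bracketing with the killed functions of degree 1 and 2 constrains the remaining values: they have
coefficients constant in the even variables and ψ is equivariant under sp(2r) ⊕ so(n). The cubics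
are settled directly (`map_mixed_cubic`, `map_pure_cubic`) and then serve as partners in brackets. A
monomial containing odd variables is reached from a mixed cubic x_i x_k x_l and a lower monomial
(`map_mon_of_nonempty`).

For x^(α), invariance under so(n) leaves only multiples of x^ω along each even ∂_j, and a single
scalar along the odd ∂_k (`eq_zero_of_so_invariant_odd`, `eq_zero_of_so_invariant_even`). Brackets
with x_i² x_{i'} and x_i³ kill x^(α) unless, modulo p, every pair (α_i, α_{i'}) is (-1, -1), (0, 0),
(1, 0) or (0, 1). One occurrence of -1 forces α = π. Otherwise the torus of sp(2r) allows at most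
one residue 1, so α is a multiple of p plus at most one ε_j; it then splits as a bracket of smaller
monomials (`map_pure_of_split`) unless the multiple of p is p^q ε_i. What remains are the three
normalized families. -/

theorem mon_induction {P : Alg F r n → Prop} (hmon : ∀ α u, P (mon F α u))
    (hadd : ∀ f g, P f → P g → P (f + g)) (hsmul : ∀ (a : F) f, P f → P (a • f))
    (f : Alg F r n) : P f := by
  have hf : f ∈ Submodule.span F (Set.range (monBasis F (r := r) (n := n))) := by
    rw [Module.Basis.span_eq]; trivial
  induction hf using Submodule.span_induction with
  | mem x hx => obtain ⟨⟨α, u⟩, rfl⟩ := hx; exact hmon α u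
  | zero => simpa using hsmul 0 _ (hmon 0 ∅)
  | add x y _ _ hx hy => exact hadd x y hx hy
  | smul a x _ hx => exact hsmul a x hx

theorem mulL_mon_mon (α β : Fin (2 * r) → ℕ) (u v : Finset (Fin n)) :
    mulL F (mon F α u) (mon F β v) = monMul F (α, u) (β, v) := by
  simp [mulL, mon, Module.Basis.constr_basis]

theorem invSign_union_left {u v : Finset (Fin n)} (h : Disjoint u v) (w : Finset (Fin n)) :
    invSign F (u ∪ v) w = invSign F u w * invSign F v w := by
  unfold invSign
  rw [← pow_add, Finset.union_product, Finset.filter_union, Finset.card_union_of_disjoint]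
  exact Finset.disjoint_filter_filter (Finset.disjoint_product.2 (Or.inl h))

theorem invSign_union_right {u v : Finset (Fin n)} (h : Disjoint u v) (w : Finset (Fin n)) :
    invSign F w (u ∪ v) = invSign F w u * invSign F w v := by
  unfold invSign
  rw [← pow_add, Finset.product_union, Finset.filter_union, Finset.card_union_of_disjoint]
  exact Finset.disjoint_filter_filter (Finset.disjoint_product.2 (Or.inr h))

theorem invSign_mul_invSign_swap {u v : Finset (Fin n)} (h : Disjoint u v) :
    invSign F u v * invSign F v u = (-1) ^ (u.card * v.card) := by
  unfold invSign
  rw [← pow_add, ← Finset.card_product]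
  congr 1
  have h1 : ((v ×ˢ u).filter fun q => q.2 < q.1).card =
      ((u ×ˢ v).filter fun q => ¬ q.2 < q.1).card := by
    refine Finset.card_bij (fun q _ => (q.2, q.1)) ?_ ?_ ?_
    · rintro ⟨a, b⟩ hq
      simp only [Finset.mem_filter, Finset.mem_product] at hq ⊢
      exact ⟨⟨hq.1.2, hq.1.1⟩, by simpa using hq.2.le⟩
    · rintro ⟨a, b⟩ _ ⟨c, d⟩ _ hq
      simp only [Prod.mk.injEq] at hq ⊢
      exact ⟨hq.2, hq.1⟩
    · rintro ⟨a, b⟩ hq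
      simp only [Finset.mem_filter, Finset.mem_product, not_lt] at hq
      refine ⟨(b, a), ?_, rfl⟩
      simp only [Finset.mem_filter, Finset.mem_product]
      refine ⟨⟨hq.1.2, hq.1.1⟩, lt_of_le_of_ne hq.2 ?_⟩
      rintro rfl
      exact Finset.disjoint_left.1 h hq.1.1 hq.1.2
  rw [h1, Finset.card_filter_add_card_filter_not]

theorem invSign_empty_left (u : Finset (Fin n)) : invSign F ∅ u = 1 := by simp [invSign]

theorem invSign_mul_self (u v : Finset (Fin n)) : invSign F u v * invSign F u v = 1 := by
  unfold invSign
  rw [← mul_pow]; simp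

theorem invSign_singleton (k : Fin n) (u : Finset (Fin n)) :
    invSign F {k} u = (-1) ^ (u.filter fun l => l < k).card := by
  unfold invSign
  congr 1
  refine Finset.card_bij (fun q _ => q.2) ?_ ?_ ?_
  · rintro ⟨a, b⟩ hq
    simp only [Finset.mem_filter, Finset.mem_product, Finset.mem_singleton] at hq ⊢
    exact ⟨hq.1.2, hq.1.1 ▸ hq.2⟩
  · rintro ⟨a, b⟩ h1 ⟨c, d⟩ h2 hq
    simp only [Finset.mem_filter, Finset.mem_product, Finset.mem_singleton] at h1 h2
    simp only [Prod.mk.injEq]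
    exact ⟨h1.1.1.trans h2.1.1.symm, hq⟩
  · intro b hb
    simp only [Finset.mem_filter] at hb
    exact ⟨(k, b), by simp [hb], rfl⟩

theorem multinomial_assoc (a b c : ℕ) :
    (a + b).choose a * (a + b + c).choose (a + b) =
      (b + c).choose b * (a + (b + c)).choose a := by
  have h := Nat.choose_mul (n := a + b + c) (k := a + b) (s := a) (by omega)
  have e1 : a + b + c - a = b + c := by omega
  have e2 : a + b - a = b := by omega
  rw [e1, e2] at h
  rw [← add_assoc, mul_comm, h, mul_comm]

/-- For pairwise disjoint sets the sign of inversions is multiplicative in unions and the binomials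
satisfy `multinomial_assoc`; in every other case both sides vanish. -/
theorem mulL_assoc (f g h : Alg F r n) :
    mulL F (mulL F f g) h = mulL F f (mulL F g h) := by
  induction f using mon_induction with
  | hadd f f' h1 h2 => simp only [map_add, LinearMap.add_apply, h1, h2]
  | hsmul a f h1 => simp only [map_smul, LinearMap.smul_apply, h1]
  | hmon α u =>
  induction g using mon_induction with
  | hadd f f' h1 h2 => simp only [map_add, LinearMap.add_apply, h1, h2]
  | hsmul a f h1 => simp only [map_smul, LinearMap.smul_apply, h1]
  | hmon β v =>
  induction h using mon_induction with
  | hadd f f' h1 h2 => simp only [map_add, h1, h2]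
  | hsmul a f h1 => simp only [map_smul, h1]
  | hmon γ w =>
  rw [mulL_mon_mon, mulL_mon_mon]
  unfold monMul
  simp only
  by_cases h1 : Disjoint u v <;> by_cases h2 : Disjoint v w <;> by_cases h3 : Disjoint u w
  · rw [if_pos h1, if_pos h2, map_smul, LinearMap.smul_apply, map_smul, mulL_mon_mon,
      mulL_mon_mon]
    unfold monMul
    simp only
    rw [if_pos (Finset.disjoint_union_left.2 ⟨h3, h2⟩),
      if_pos (Finset.disjoint_union_right.2 ⟨h1, h3⟩), smul_smul, smul_smul, add_assoc,
      Finset.union_assoc, invSign_union_left h1, invSign_union_right h2]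
    congr 1
    have : (∏ i, ((α i + β i).choose (α i) : F)) *
        ∏ i, (((α + β) i + γ i).choose ((α + β) i) : F) =
        (∏ i, ((β i + γ i).choose (β i) : F)) *
        ∏ i, ((α i + (β + γ) i).choose (α i) : F) := by
      rw [← Finset.prod_mul_distrib, ← Finset.prod_mul_distrib]
      refine Finset.prod_congr rfl fun i _ => ?_
      simp only [Pi.add_apply]
      exact_mod_cast congrArg (Nat.cast (R := F)) (multinomial_assoc (α i) (β i) (γ i))
    linear_combination (invSign F u v * (invSign F u w * invSign F v w)) * this
  all_goals
    simp [h1, h2, h3, mulL_mon_mon, monMul, Finset.disjoint_union_left,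
      Finset.disjoint_union_right]

theorem one_mulL (f : Alg F r n) : mulL F (mon F 0 ∅) f = f := by
  induction f using mon_induction with
  | hadd f f' h1 h2 => simp only [map_add, h1, h2]
  | hsmul a f h1 => simp only [map_smul, h1]
  | hmon β v => simp [mulL_mon_mon, monMul, invSign_empty_left]

-- The product is `mulL` by definition, so the two notations are interchangeable by `rfl`.
scoped instance : Ring (Alg F r n) :=
  { (inferInstance : AddCommGroup (Alg F r n)) with
    mul := fun f g => mulL F f g
    one := mon F 0 ∅
    mul_assoc := mulL_assoc
    one_mul := one_mulL
    mul_one := mulL_one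
    left_distrib := fun f g h => (mulL F f).map_add g h
    right_distrib := fun f g h => by
      change mulL F (f + g) h = mulL F f h + mulL F g h
      rw [map_add, LinearMap.add_apply]
    zero_mul := fun f => by
      change mulL F 0 f = 0
      rw [map_zero, LinearMap.zero_apply]
    mul_zero := fun f => (mulL F f).map_zero }

theorem mulL_apply (f g : Alg F r n) : mulL F f g = f * g := rfl

theorem mon_zero_empty : mon F (0 : Fin (2 * r) → ℕ) (∅ : Finset (Fin n)) = 1 := rfl

scoped instance : Algebra F (Alg F r n) :=
  Algebra.ofModule
    (fun a f g => by
      change mulL F (a • f) g = a • mulL F f g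
      rw [map_smul, LinearMap.smul_apply])
    (fun a f g => (mulL F f).map_smul a g)

theorem mon_mul_mon (α β : Fin (2 * r) → ℕ) {u v : Finset (Fin n)} (h : Disjoint u v) :
    mon F α u * mon F β v =
      ((∏ i, ((α i + β i).choose (α i) : F)) * invSign F u v) • mon F (α + β) (u ∪ v) := by
  rw [← mulL_apply, mulL_mon_mon, monMul, if_pos h]

theorem mon_mul_mon_of_not_disjoint (α β : Fin (2 * r) → ℕ) {u v : Finset (Fin n)}
    (h : ¬ Disjoint u v) : mon F α u * mon F β v = 0 := by
  rw [← mulL_apply, mulL_mon_mon, monMul, if_neg h]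

/-- The parity involution of `𝒪(m, n)`. -/
def sgn : Module.End F (Alg F r n) :=
  (monBasis F).constr F fun b => (-1 : F) ^ b.2.card • mon F b.1 b.2

theorem sgn_mon (α : Fin (2 * r) → ℕ) (u : Finset (Fin n)) :
    sgn (mon F α u) = (-1 : F) ^ u.card • mon F α u := by
  rw [sgn, mon, Module.Basis.constr_basis, mon]

theorem sgn_sgn (f : Alg F r n) : sgn (sgn f) = f := by
  induction f using mon_induction with
  | hadd f f' h1 h2 => simp only [map_add, h1, h2]
  | hsmul a f h1 => simp only [map_smul, h1]
  | hmon α u => rw [sgn_mon, map_smul, sgn_mon, smul_smul, ← mul_pow]; simp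

theorem sgn_mul (f g : Alg F r n) : sgn (f * g) = sgn f * sgn g := by
  induction f using mon_induction with
  | hadd f f' h1 h2 => simp only [map_add, add_mul, h1, h2]
  | hsmul a f h1 => simp only [map_smul, smul_mul_assoc, h1]
  | hmon α u =>
  induction g using mon_induction with
  | hadd f f' h1 h2 => simp only [map_add, mul_add, h1, h2]
  | hsmul a f h1 => simp only [map_smul, mul_smul_comm, h1]
  | hmon β v =>
  by_cases h : Disjoint u v
  · rw [sgn_mon, sgn_mon, smul_mul_assoc, mul_smul_comm, mon_mul_mon _ _ h, map_smul, sgn_mon,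
      Finset.card_union_of_disjoint h, pow_add, smul_smul, smul_smul, smul_smul]
    congr 1; ring
  · rw [sgn_mon, sgn_mon, smul_mul_assoc, mul_smul_comm, mon_mul_mon_of_not_disjoint _ _ h]
    simp

theorem mon_mul_comm (α β : Fin (2 * r) → ℕ) (u v : Finset (Fin n)) :
    mon F α u * mon F β v = (-1 : F) ^ (u.card * v.card) • (mon F β v * mon F α u) := by
  by_cases h : Disjoint u v
  · rw [mon_mul_mon _ _ h, mon_mul_mon _ _ h.symm, smul_smul, add_comm β α, Finset.union_comm v u,
      ← invSign_mul_invSign_swap h]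
    congr 1
    have : (∏ i, ((α i + β i).choose (α i) : F)) = ∏ i, ((β i + α i).choose (β i) : F) := by
      refine Finset.prod_congr rfl fun i _ => ?_
      rw [add_comm (β i), Nat.choose_symm_add]
    rw [this]
    linear_combination (- (∏ i, ((β i + α i).choose (β i) : F)) * invSign F u v) *
      invSign_mul_self (F := F) v u
  · rw [mon_mul_mon_of_not_disjoint _ _ h, mon_mul_mon_of_not_disjoint _ _ (fun h' => h h'.symm),
      smul_zero]

/-- The element `f + sgn f` is twice the even part of f; in this form centrality is linear in f and
can be checked on monomials. -/
theorem add_sgn_mul_comm (f g : Alg F r n) : (f + sgn f) * g = g * (f + sgn f) := by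
  induction f using mon_induction with
  | hadd f f' h1 h2 =>
    have : f + f' + sgn (f + f') = (f + sgn f) + (f' + sgn f') := by rw [map_add]; abel
    rw [this, add_mul, mul_add, h1, h2]
  | hsmul a f h1 =>
    rw [map_smul, ← smul_add, smul_mul_assoc, mul_smul_comm, h1]
  | hmon α u =>
  induction g using mon_induction with
  | hadd f f' h1 h2 => rw [mul_add, h1, h2, ← add_mul]
  | hsmul a f h1 => rw [smul_mul_assoc, mul_smul_comm, h1]
  | hmon β v =>
  rw [sgn_mon]
  rcases Nat.even_or_odd u.card with h | h
  · rw [h.neg_one_pow, one_smul, add_mul, mul_add, mon_mul_comm α β,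
      (h.mul_right v.card).neg_one_pow, one_smul]
  · rw [h.neg_one_pow]; simp

theorem sub_sgn_mul_comm (f g : Alg F r n) : (f - sgn f) * g = sgn g * (f - sgn f) := by
  induction f using mon_induction with
  | hadd f f' h1 h2 =>
    have : f + f' - sgn (f + f') = (f - sgn f) + (f' - sgn f') := by rw [map_add]; abel
    rw [this, add_mul, mul_add, h1, h2]
  | hsmul a f h1 =>
    rw [map_smul, ← smul_sub, smul_mul_assoc, mul_smul_comm, h1]
  | hmon α u =>
  induction g using mon_induction with
  | hadd f f' h1 h2 => rw [mul_add, map_add, add_mul, h1, h2]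
  | hsmul a f h1 => rw [map_smul, smul_mul_assoc, mul_smul_comm, h1]
  | hmon β v =>
  rw [sgn_mon, sgn_mon]
  rcases Nat.even_or_odd u.card with h | h
  · rw [h.neg_one_pow]; simp
  · rw [h.neg_one_pow, neg_one_smul, sub_neg_eq_add, add_mul, mul_add, smul_mul_assoc,
      mon_mul_comm α β, pow_mul, h.neg_one_pow]

theorem mul_comm_of_even [NeZero (2 : F)] {f : Alg F r n} (hf : sgn f = f) (g : Alg F r n) :
    f * g = g * f := by
  have h := add_sgn_mul_comm f g
  rw [hf, ← two_smul F f, smul_mul_assoc, mul_smul_comm] at h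
  exact smul_right_injective _ (two_ne_zero (α := F)) h

theorem mul_comm_of_odd [NeZero (2 : F)] {f : Alg F r n} (hf : sgn f = -f) (g : Alg F r n) :
    f * g = sgn g * f := by
  have h := sub_sgn_mul_comm f g
  rw [hf, sub_neg_eq_add, ← two_smul F f, smul_mul_assoc, mul_smul_comm] at h
  exact smul_right_injective _ (two_ne_zero (α := F)) h

end Ring

/-! ### Leibniz and commutation rules of the partial superderivations -/

section Derivations

variable {F : Type*} [Field F] {r n : ℕ}

theorem pd_inl_mon (i : Fin (2 * r)) (α : Fin (2 * r) → ℕ) (u : Finset (Fin n)) :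
    pd F (.inl i : Idx r n) (mon F α u) =
      if 0 < α i then mon F (Function.update α i (α i - 1)) u else 0 := pd_mon _ _ _

theorem pd_inr_mon (k : Fin n) (α : Fin (2 * r) → ℕ) (u : Finset (Fin n)) :
    pd F (.inr k : Idx r n) (mon F α u) =
      if k ∈ u then ((-1 : F) ^ (u.filter fun l => l < k).card) • mon F α (u.erase k) else 0 :=
  pd_mon _ _ _

theorem var_mul_mon {k : Fin n} {u : Finset (Fin n)} (hk : k ∉ u) (α : Fin (2 * r) → ℕ) :
    var F (.inr k) * mon F α u =
      ((-1 : F) ^ (u.filter fun l => l < k).card) • mon F α (insert k u) := by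
  have h : Disjoint ({k} : Finset (Fin n)) u := by simpa using hk
  rw [var, mon_mul_mon _ _ h, invSign_singleton, zero_add, Finset.insert_eq]
  simp

theorem var_mul_mon_of_mem {k : Fin n} {u : Finset (Fin n)} (hk : k ∈ u)
    (α : Fin (2 * r) → ℕ) : var F (.inr k) * mon F α u = 0 := by
  rw [var, mon_mul_mon_of_not_disjoint]
  simpa using hk

theorem mon_insert {k : Fin n} {u : Finset (Fin n)} (hk : k ∉ u) (α : Fin (2 * r) → ℕ) :
    mon F α (insert k u) =
      ((-1 : F) ^ (u.filter fun l => l < k).card) • (var F (.inr k) * mon F α u) := by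
  rw [var_mul_mon hk, smul_smul, ← mul_pow]; simp

theorem filter_insert_lt (v : Finset (Fin n)) {k l : Fin n} (hl : l ∉ v) :
    ((insert l v).filter fun j => j < k).card =
      (v.filter fun j => j < k).card + if l < k then 1 else 0 := by
  rw [Finset.filter_insert]
  split_ifs with h
  · rw [Finset.card_insert_of_notMem (by simp [hl])]
  · simp

/-- The Clifford relation between `∂_k` and the multiplication by `x_l`. -/
theorem pd_var_mul (k l : Fin n) (g : Alg F r n) :
    pd F (.inr k : Idx r n) (var F (.inr l) * g) =
      (if k = l then g else 0) - var F (.inr l) * pd F (.inr k : Idx r n) g := by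
  induction g using mon_induction with
  | hadd f f' h1 h2 =>
    rw [mul_add, map_add, map_add, h1, h2, mul_add]
    split_ifs <;> abel
  | hsmul a f h1 =>
    rw [mul_smul_comm, map_smul, map_smul, h1, mul_smul_comm, smul_sub]
    split_ifs <;> simp
  | hmon α v =>
  by_cases hkl : k = l
  · subst hkl
    rw [if_pos rfl]
    by_cases hk : k ∈ v
    · have h1 : k ∉ v.erase k := by simp
      rw [var_mul_mon_of_mem hk, map_zero, pd_inr_mon, if_pos hk, mul_smul_comm, var_mul_mon h1,
        Finset.insert_erase hk, smul_smul]
      have : (v.erase k).filter (fun l => l < k) = v.filter fun l => l < k := by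
        ext j; simp only [Finset.mem_filter, Finset.mem_erase]
        exact ⟨fun h => ⟨h.1.2, h.2⟩, fun h => ⟨⟨h.2.ne, h.1⟩, h.2⟩⟩
      rw [this, ← mul_pow]; simp
    · have h1 : k ∈ insert k v := by simp
      rw [var_mul_mon hk, map_smul, pd_inr_mon, if_pos h1, pd_inr_mon, if_neg hk,
        Finset.erase_insert hk, filter_insert_lt _ hk, smul_smul]
      simp [← mul_pow]
  · rw [if_neg hkl, zero_sub]
    by_cases hl : l ∈ v
    · rw [var_mul_mon_of_mem hl, map_zero, pd_inr_mon]
      split_ifs with hk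
      · rw [mul_smul_comm, var_mul_mon_of_mem (by simp [hl, Ne.symm hkl])]; simp
      · simp
    · rw [var_mul_mon hl, map_smul, pd_inr_mon, pd_inr_mon]
      by_cases hk : k ∈ v
      · have h1 : k ∈ insert l v := by simp [hk]
        have h2 : l ∉ v.erase k := by simp [hl]
        rw [if_pos h1, if_pos hk, mul_smul_comm, var_mul_mon h2, smul_smul, smul_smul,
          filter_insert_lt _ hl, Finset.erase_insert_of_ne (Ne.symm hkl), ← neg_smul]
        congr 1
        have h3 := filter_insert_lt (k := l) (v.erase k) (l := k) (by simp)
        rw [Finset.insert_erase hk] at h3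
        rw [h3]
        rcases lt_or_gt_of_ne hkl with h | h
        · rw [if_pos h, if_neg h.le.not_gt]; ring
        · rw [if_pos h, if_neg h.le.not_gt]; ring
      · have h1 : k ∉ insert l v := by simp [hk, hkl]
        rw [if_neg h1, if_neg hk]; simp

theorem sgn_var (i : Idx r n) : sgn (var F i) = (-1 : F) ^ par i • var F i := by
  rcases i with i | k
  · simp [var, sgn_mon, par]
  · simp [var, sgn_mon, par]

/-- Odd variables are adjoined to f one at a time, and the Clifford relation `pd_var_mul` gives each
step. -/
theorem pd_inr_mul (k : Fin n) (f g : Alg F r n) :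
    pd F (.inr k : Idx r n) (f * g) =
      pd F (.inr k : Idx r n) f * g + sgn f * pd F (.inr k : Idx r n) g := by
  induction f using mon_induction with
  | hadd f f' h1 h2 => simp only [map_add, add_mul, h1, h2]; abel
  | hsmul a f h1 => simp only [map_smul, smul_mul_assoc, h1, smul_add]
  | hmon α u =>
  induction u using Finset.induction_on with
  | empty =>
    rw [pd_inr_mon, if_neg (by simp), sgn_mon, zero_mul, zero_add, Finset.card_empty, pow_zero,
      one_smul]
    induction g using mon_induction with
    | hadd f f' h1 h2 => simp only [map_add, mul_add, h1, h2]
    | hsmul a f h1 => simp only [map_smul, mul_smul_comm, h1]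
    | hmon β v =>
    rw [mon_mul_mon _ _ (by simp), map_smul, pd_inr_mon, pd_inr_mon]
    simp only [Finset.empty_union, invSign_empty_left]
    split_ifs
    · rw [mul_smul_comm, mon_mul_mon _ _ (by simp), smul_comm]
      simp [invSign_empty_left]
    · simp
  | insert l u hl ih =>
    rw [mon_insert hl]
    simp only [smul_mul_assoc, map_smul, mul_assoc]
    rw [pd_var_mul, ih, pd_var_mul, sgn_mul, sgn_var, ← smul_add]
    congr 1
    simp only [par, pow_one, neg_one_smul, neg_mul]
    rw [mul_add, sub_mul, ← mul_assoc, ← mul_assoc]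
    split_ifs
    · abel
    · rw [zero_mul]; abel

theorem pd_inl_mul (i : Fin (2 * r)) (f g : Alg F r n) :
    pd F (.inl i : Idx r n) (f * g) =
      pd F (.inl i : Idx r n) f * g + f * pd F (.inl i : Idx r n) g := by
  induction f using mon_induction with
  | hadd f f' h1 h2 => simp only [map_add, add_mul, h1, h2]; abel
  | hsmul a f h1 => simp only [map_smul, smul_mul_assoc, h1, smul_add]
  | hmon α u =>
  induction g using mon_induction with
  | hadd f f' h1 h2 => simp only [map_add, mul_add, h1, h2]; abel
  | hsmul a f h1 => simp only [map_smul, mul_smul_comm, h1, smul_add]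
  | hmon β v =>
  by_cases hd : Disjoint u v
  · have hP : ∀ α β : Fin (2 * r) → ℕ, (∏ l, ((α l + β l).choose (α l) : F)) =
        ((α i + β i).choose (α i) : F) *
          ∏ l ∈ Finset.univ.erase i, ((α l + β l).choose (α l) : F) := fun α β =>
      (Finset.mul_prod_erase _ _ (Finset.mem_univ i)).symm
    have hL : (∏ l ∈ Finset.univ.erase i,
        ((Function.update α i (α i - 1) l + β l).choose (Function.update α i (α i - 1) l) : F)) =
        ∏ l ∈ Finset.univ.erase i, ((α l + β l).choose (α l) : F) := by
      refine Finset.prod_congr rfl fun l hl => ?_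
      rw [Function.update_of_ne (Finset.ne_of_mem_erase hl)]
    have hR : (∏ l ∈ Finset.univ.erase i,
        ((α l + Function.update β i (β i - 1) l).choose (α l) : F)) =
        ∏ l ∈ Finset.univ.erase i, ((α l + β l).choose (α l) : F) := by
      refine Finset.prod_congr rfl fun l hl => ?_
      rw [Function.update_of_ne (Finset.ne_of_mem_erase hl)]
    have eL : 0 < α i → Function.update α i (α i - 1) + β =
        Function.update (α + β) i ((α + β) i - 1) := by
      intro h; funext l
      by_cases hl : l = i
      · subst hl; simp; omega
      · simp [hl]
    have eR : 0 < β i → α + Function.update β i (β i - 1) =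
        Function.update (α + β) i ((α + β) i - 1) := by
      intro h; funext l
      by_cases hl : l = i
      · subst hl; simp; omega
      · simp [hl]
    rw [mon_mul_mon _ _ hd, map_smul, pd_inl_mon, pd_inl_mon, pd_inl_mon]
    simp only [ite_mul, mul_ite, zero_mul, mul_zero]
    rw [mon_mul_mon _ _ hd, mon_mul_mon _ _ hd, hP, hP (Function.update _ _ _), hP α, hL, hR]
    by_cases ha : 0 < α i <;> by_cases hb : 0 < β i
    -- Pascal's rule at the index i; the binomials at all other indices are common to the three
    -- terms.
    · have hc : (α i + β i).choose (α i) =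
          (α i - 1 + β i).choose (α i - 1) + (α i + (β i - 1)).choose (α i) := by
        obtain ⟨a, ha'⟩ := Nat.exists_eq_succ_of_ne_zero ha.ne'
        obtain ⟨b, hb'⟩ := Nat.exists_eq_succ_of_ne_zero hb.ne'
        rw [ha', hb']
        simp only [Nat.succ_eq_add_one, Nat.add_sub_cancel]
        rw [show a + 1 + (b + 1) = (a + (b + 1)) + 1 by ring, Nat.choose_succ_succ]
        rw [show a + 1 + b = a + (b + 1) by ring]
      rw [if_pos ha, if_pos hb, if_pos (by simp [ha]), eL ha, eR hb, ← add_smul]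
      simp only [Function.update_self]
      rw [hc]; push_cast
      congr 1; ring
    · have hb0 : β i = 0 := by omega
      rw [if_pos ha, if_neg hb, if_pos (by simp [ha]), eL ha, add_zero]
      simp [hb0]
    · have ha0 : α i = 0 := by omega
      rw [if_neg ha, if_pos hb, if_pos (by simp [hb]), eR hb, zero_add]
      simp [ha0]
    · rw [if_neg ha, if_neg hb, if_neg (by simp; omega)]; simp
  · rw [mon_mul_mon_of_not_disjoint _ _ hd, map_zero, pd_inl_mon, pd_inl_mon]
    split_ifs <;> simp [mon_mul_mon_of_not_disjoint _ _ hd]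

/-- The twist in the Leibniz rule of `∂_i`: the identity for even `i`, the parity involution for
odd `i`. -/
def twist (i : Idx r n) : Module.End F (Alg F r n) := sgn ^ par i

theorem twist_inl (i : Fin (2 * r)) (f : Alg F r n) : twist (.inl i) f = f := rfl

theorem twist_inr (k : Fin n) (f : Alg F r n) : twist (r := r) (.inr k) f = sgn f := by
  simp [twist, par]

theorem pd_mul (i : Idx r n) (f g : Alg F r n) :
    pd F i (f * g) = pd F i f * g + twist i f * pd F i g := by
  rcases i with i | k
  · exact pd_inl_mul i f g
  · rw [pd_inr_mul, twist_inr]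

theorem sgn_pd (i : Idx r n) (f : Alg F r n) :
    sgn (pd F i f) = (-1 : F) ^ par i • pd F i (sgn f) := by
  induction f using mon_induction with
  | hadd f f' h1 h2 => simp only [map_add, h1, h2, smul_add]
  | hsmul a f h1 => simp only [map_smul, h1]; rw [smul_comm]
  | hmon α u =>
  rw [sgn_mon, map_smul]
  rcases i with i | k
  · rw [pd_inl_mon]
    split_ifs <;> simp [sgn_mon, par]
  · rw [pd_inr_mon]
    split_ifs with h
    · rw [map_smul, sgn_mon, Finset.card_erase_of_mem h, smul_comm, smul_smul]
      have : 0 < u.card := Finset.card_pos.2 ⟨k, h⟩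
      obtain ⟨m, hm⟩ := Nat.exists_eq_succ_of_ne_zero this.ne'
      rw [hm]; simp [par, pow_succ, smul_smul]
    · simp

theorem pd_one (i : Idx r n) : pd F i 1 = 0 := by
  rw [← mon_zero_empty]
  rcases i with i | k
  · rw [pd_inl_mon]; simp
  · rw [pd_inr_mon]; simp

theorem pd_inl_comm (i j : Fin (2 * r)) (f : Alg F r n) :
    pd F (.inl i : Idx r n) (pd F (.inl j : Idx r n) f) =
      pd F (.inl j : Idx r n) (pd F (.inl i : Idx r n) f) := by
  induction f using mon_induction with
  | hadd f f' h1 h2 => simp only [map_add, h1, h2]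
  | hsmul a f h1 => simp only [map_smul, h1]
  | hmon α u =>
  by_cases hij : i = j
  · rw [hij]
  · rw [pd_inl_mon, pd_inl_mon]
    split_ifs with h1 h2 h2
    · rw [pd_inl_mon, pd_inl_mon, Function.update_of_ne hij, Function.update_of_ne (Ne.symm hij),
        if_pos h1, if_pos h2, Function.update_comm (Ne.symm hij)]
    · rw [pd_inl_mon, Function.update_of_ne hij, if_neg h2, map_zero]
    · rw [pd_inl_mon, Function.update_of_ne (Ne.symm hij), if_neg h1, map_zero]
    · simp

theorem pd_inl_inr_comm (i : Fin (2 * r)) (k : Fin n) (f : Alg F r n) :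
    pd F (.inl i : Idx r n) (pd F (.inr k : Idx r n) f) =
      pd F (.inr k : Idx r n) (pd F (.inl i : Idx r n) f) := by
  induction f using mon_induction with
  | hadd f f' h1 h2 => simp only [map_add, h1, h2]
  | hsmul a f h1 => simp only [map_smul, h1]
  | hmon α u =>
  rw [pd_inl_mon, pd_inr_mon]
  split_ifs with h1 h2 h2 <;> simp [pd_inl_mon, pd_inr_mon, h1, h2]

theorem pd_inr_anticomm (k l : Fin n) (f : Alg F r n) :
    pd F (.inr k : Idx r n) (pd F (.inr l : Idx r n) f) =
      - pd F (.inr l : Idx r n) (pd F (.inr k : Idx r n) f) := by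
  induction f using mon_induction with
  | hadd f f' h1 h2 => simp only [map_add, h1, h2]; abel
  | hsmul a f h1 => simp only [map_smul, h1, smul_neg]
  | hmon α u =>
  induction u using Finset.induction_on with
  | empty => simp [pd_inr_mon]
  | insert j u hj ih =>
    rw [mon_insert hj]
    simp only [map_smul, ← smul_neg]
    congr 1
    rw [pd_var_mul, pd_var_mul, map_sub, map_sub, pd_var_mul, pd_var_mul, ih]
    split_ifs <;> simp; abel

theorem pd_pd (i j : Idx r n) (f : Alg F r n) :
    pd F i (pd F j f) = (-1 : F) ^ (par i * par j) • pd F j (pd F i f) := by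
  rcases i with i | i <;> rcases j with j | j
  · simp [par, pd_inl_comm i j]
  · simp [par, pd_inl_inr_comm]
  · simp [par, pd_inl_inr_comm]
  · simp [par, pd_inr_anticomm i j]

end Derivations

/-! ### Even vector fields and the Poisson bracket -/

section VectorFields

variable {F : Type*} [Field F] {r n : ℕ}

/-- The vector field `∑_j e_j ∂_j`. -/
def vf (e : Idx r n → Alg F r n) : Module.End F (Alg F r n) := ∑ j, mulL F (e j) * pd F j

theorem vf_apply (e : Idx r n → Alg F r n) (h : Alg F r n) :
    vf e h = ∑ j, e j * pd F j h := by
  simp [vf, LinearMap.sum_apply, mulL_apply]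

theorem pd_var' (i j : Idx r n) : pd F i (var F j) = if i = j then 1 else 0 := pd_var i j

theorem vf_var (e : Idx r n → Alg F r n) (j : Idx r n) : vf e (var F j) = e j := by
  simp [vf_apply, pd_var']

theorem vf_one (e : Idx r n → Alg F r n) : vf e 1 = 0 := by
  simp [vf_apply, pd_one]

theorem vf_sub (d e : Idx r n → Alg F r n) : vf (fun j => d j - e j) = vf d - vf e := by
  refine LinearMap.ext fun h => ?_
  simp [vf_apply, sub_mul, Finset.sum_sub_distrib]

theorem vf_add (d e : Idx r n → Alg F r n) : vf (fun j => d j + e j) = vf d + vf e := by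
  refine LinearMap.ext fun h => ?_
  simp [vf_apply, add_mul, Finset.sum_add_distrib]

theorem vf_smul (a : F) (e : Idx r n → Alg F r n) : vf (fun j => a • e j) = a • vf e := by
  refine LinearMap.ext fun h => ?_
  simp [vf_apply, Finset.smul_sum]

theorem mulL_mul_vf (f : Alg F r n) (e : Idx r n → Alg F r n) :
    mulL F f * vf e = vf fun j => f * e j := by
  refine LinearMap.ext fun h => ?_
  simp only [vf_apply, mulL_apply, Finset.mul_sum, mul_assoc, Module.End.mul_apply]

theorem ad_apply (D E : Module.End F (Alg F r n)) : ad D E = D * E - E * D := rfl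

theorem neg_one_pow_par_mul_self (i : Idx r n) : (-1 : F) ^ par i * (-1 : F) ^ par i = 1 := by
  rw [← mul_pow]; simp

theorem par_conj (i : Idx r n) : par (conj i) = par i := by
  rcases i with i | i <;> rfl

theorem tau_conj (i : Idx r n) : tau F (conj i) = -(-1) ^ par i * tau F i := by
  rcases i with i | i
  · have : (evenConj i).1 < r ↔ ¬ i.1 < r := by
      unfold evenConj
      split_ifs with h
      · simp [h]
      · simp [h]; omega
    by_cases h : i.1 < r <;> simp [conj, tau, this, h, par]
  · simp [conj, tau, par]

theorem sum_conj {M : Type*} [AddCommMonoid M] (g : Idx r n → M) :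
    ∑ j, g (conj j) = ∑ j, g j :=
  Equiv.sum_comp (Function.Involutive.toPerm conj conj_conj) g

theorem twist_of_even (i : Idx r n) {f : Alg F r n} (hf : sgn f = f) : twist i f = f := by
  rcases i with i | k
  · rfl
  · rw [twist_inr, hf]

theorem DH_eq_vf (f : Alg F r n) :
    DH F f = vf fun j => tau F (conj j) • pd F (conj j) (twist j f) := by
  induction f using mon_induction with
  | hadd f f' h1 h2 => simp only [map_add, smul_add, vf_add, h1, h2]
  | hsmul a f h1 =>
    rw [map_smul, h1, ← vf_smul]
    congr 1; funext j; rw [map_smul, map_smul, smul_comm]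
  | hmon α u =>
    have : DH F (mon F α u) = ∑ i : Idx r n, (tau F i * (-1) ^ (par i * u.card)) •
        (mulL F (pdMon F i (α, u)) * pd F (conj i)) := by
      rw [DH, mon, Module.Basis.constr_basis]
    rw [this, vf, ← sum_conj]
    refine Finset.sum_congr rfl fun j _ => ?_
    rw [conj_conj, par_conj, ← pd_mon]
    rcases j with j | j
    · simp [twist_inl, par]
    · simp [twist_inr, par, sgn_mon, smul_smul]

theorem DH_apply_of_even {f : Alg F r n} (hf : sgn f = f) (h : Alg F r n) :
    DH F f h = ∑ j, tau F j • (pd F j f * pd F (conj j) h) := by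
  rw [DH_eq_vf, vf_apply, ← sum_conj]
  refine Finset.sum_congr rfl fun j _ => ?_
  rw [conj_conj, twist_of_even _ hf, smul_mul_assoc]

/-- An even vector field `∑_j d_j ∂_j`: the parity of `d_j` is that of `j`. -/
def IsEvenField (d : Idx r n → Alg F r n) : Prop := ∀ i, sgn (d i) = (-1 : F) ^ par i • d i

theorem isEvenField_DH {f : Alg F r n} (hf : sgn f = f) :
    IsEvenField fun j => tau F (conj j) • pd F (conj j) (twist j f) := by
  intro j
  simp only
  rw [twist_of_even _ hf, map_smul, sgn_pd, hf, par_conj, smul_comm]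

/-- Moving a coefficient with the parity of i past f costs exactly the twist in the Leibniz rule of
∂_i. This is why even fields are derivations without signs. -/
theorem mul_twist [NeZero (2 : F)] {i : Idx r n} {d : Alg F r n} (hd : sgn d = (-1 : F) ^ par i • d)
    (f : Alg F r n) : d * twist i f = f * d := by
  rcases i with i | k
  · rw [twist_inl]
    exact mul_comm_of_even (by simpa [par] using hd) f
  · rw [twist_inr, mul_comm_of_odd (by simpa [par] using hd), sgn_sgn]

theorem vf_mul [NeZero (2 : F)] {d : Idx r n → Alg F r n} (hd : IsEvenField d) (f g : Alg F r n) :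
    vf d (f * g) = vf d f * g + f * vf d g := by
  simp only [vf_apply, Finset.sum_mul, Finset.mul_sum]
  rw [← Finset.sum_add_distrib]
  refine Finset.sum_congr rfl fun i _ => ?_
  rw [pd_mul, mul_add, ← mul_assoc, ← mul_assoc, mul_twist (hd i), mul_assoc f]

theorem twist_evenField {d : Idx r n → Alg F r n} (hd : IsEvenField d) (i j : Idx r n) :
    twist j (d i) = (-1 : F) ^ (par i * par j) • d i := by
  rcases j with j | j
  · simp [twist_inl, par]
  · rw [twist_inr, hd i]; simp [par]

theorem pd_vf {d : Idx r n → Alg F r n} (hd : IsEvenField d) (j : Idx r n) (h : Alg F r n) :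
    pd F j (vf d h) = vf (fun i => pd F j (d i)) h + vf d (pd F j h) := by
  simp only [vf_apply, map_sum]
  rw [← Finset.sum_add_distrib]
  refine Finset.sum_congr rfl fun i _ => ?_
  rw [pd_mul, twist_evenField hd, pd_pd j i, mul_comm (par j), smul_mul_smul_comm, ← mul_pow]
  simp

theorem sgn_vf {d : Idx r n → Alg F r n} (hd : IsEvenField d) (h : Alg F r n) :
    sgn (vf d h) = vf d (sgn h) := by
  simp only [vf_apply, map_sum]
  refine Finset.sum_congr rfl fun i _ => ?_
  rw [sgn_mul, hd i, sgn_pd, smul_mul_smul_comm, neg_one_pow_par_mul_self, one_smul]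

/-- Both compositions contain the same second order part ∑_j e_j d(∂_j h), which cancels. -/
theorem ad_vf [NeZero (2 : F)] {d : Idx r n → Alg F r n} (hd : IsEvenField d) (e : Idx r n → Alg F r n) :
    ad (vf d) (vf e) = vf fun j => vf d (e j) - vf e (d j) := by
  refine LinearMap.ext fun h => ?_
  rw [ad_apply, vf_sub]
  simp only [LinearMap.sub_apply, Module.End.mul_apply]
  have h1 : vf d (vf e h) = vf (fun j => vf d (e j)) h + ∑ j, e j * vf d (pd F j h) := by
    rw [vf_apply e, map_sum, vf_apply (fun j => vf d (e j)), ← Finset.sum_add_distrib]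
    exact Finset.sum_congr rfl fun j _ => vf_mul hd _ _
  have h2 : vf e (vf d h) = vf (fun j => vf e (d j)) h + ∑ j, e j * vf d (pd F j h) := by
    rw [vf_apply e (vf d h)]
    simp only [pd_vf hd, mul_add]
    rw [Finset.sum_add_distrib]
    congr 1
    simp only [vf_apply, Finset.mul_sum, Finset.sum_mul]
    rw [Finset.sum_comm]
    simp only [mul_assoc]
  rw [h1, h2]; abel

/-- Pairing i with i' and exchanging the order of ∂_i and ∂_a produces signs that combine to -1. In
`ad_DH_DH` this identifies the second term of `ad_vf` with the missing Leibniz term of ∂_a applied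
to the bracket. -/
theorem vf_pd_DH_symm [NeZero (2 : F)] {f : Alg F r n} (hf : sgn f = f) (a : Idx r n)
    (g : Alg F r n) :
    vf (fun i => pd F a (tau F (conj i) • pd F (conj i) (twist i f))) (twist a g) =
      - vf (fun i => tau F (conj i) • pd F (conj i) (twist i g)) (pd F a f) := by
  rw [vf_apply, vf_apply, ← sum_conj, ← Finset.sum_neg_distrib]
  refine Finset.sum_congr rfl fun i _ => ?_
  rw [conj_conj, twist_of_even _ hf, map_smul, smul_mul_assoc, smul_mul_assoc, ← smul_neg,
    tau_conj, neg_mul, neg_smul, smul_neg, neg_neg, mul_comm, mul_smul]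
  congr 1
  rw [pd_pd a i, smul_mul_assoc]
  have hy : sgn (pd F i (pd F a f)) = (-1 : F) ^ (par i + par a) • pd F i (pd F a f) := by
    rw [sgn_pd, sgn_pd, map_smul, hf, smul_smul, pow_add]
  generalize pd F i (pd F a f) = y at hy ⊢
  have hc : ∀ b : Idx r n, par b = par i → ∀ z : Alg F r n,
      sgn (pd F b z) = (-1 : F) ^ par i • pd F b (sgn z) := fun b hb z => by rw [sgn_pd, hb]
  have hi := hc _ (par_conj i)
  rcases a with a | a <;> rcases i with i | i <;>
    simp only [par, twist_inl, twist_inr, pow_zero, pow_one, one_smul, neg_smul, mul_zero,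
      mul_one, add_zero, zero_add, Nat.reduceAdd] at hy hi ⊢
  · exact mul_comm_of_even hy _
  · rw [mul_comm_of_odd hy, hi, neg_mul]
  · rw [mul_comm_of_odd hy, hi, sgn_sgn]
  · rw [mul_comm_of_even (by simpa using hy)]

/-- The coefficients of each ∂_j agree by the Leibniz rule for {f, g}. No parity is imposed on g, so
that g = x^ω is allowed. -/
theorem ad_DH_DH [NeZero (2 : F)] {f : Alg F r n} (hf : sgn f = f) (g : Alg F r n) :
    ad (DH F f) (DH F g) = DH F (DH F f g) := by
  have hd := isEvenField_DH hf
  rw [DH_eq_vf (DH F f g), DH_eq_vf g, DH_eq_vf f, ad_vf hd]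
  congr 1
  funext j
  have htw : twist j (vf (fun j => tau F (conj j) • pd F (conj j) (twist j f)) g) =
      vf (fun j => tau F (conj j) • pd F (conj j) (twist j f)) (twist j g) := by
    rcases j with j | j
    · rfl
    · exact sgn_vf hd g
  have ha : ∀ h : Alg F r n, twist (conj j) h = twist j h := fun h => by
    rcases j with j | j <;> rfl
  have hs := vf_pd_DH_symm hf (conj j) g
  rw [ha] at hs
  rw [htw, map_smul, map_smul, pd_vf hd, hs, twist_of_even j hf, ← smul_sub, sub_eq_neg_add]

theorem DH_mul_of_even [NeZero (2 : F)] {f g : Alg F r n} (hf : sgn f = f) (hg : sgn g = g)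
    (h : Alg F r n) : DH F (f * g) h = f * DH F g h + g * DH F f h := by
  have hfg : sgn (f * g) = f * g := by rw [sgn_mul, hf, hg]
  rw [DH_apply_of_even hfg, DH_apply_of_even hf, DH_apply_of_even hg, Finset.mul_sum,
    Finset.mul_sum, ← Finset.sum_add_distrib]
  refine Finset.sum_congr rfl fun j _ => ?_
  rw [pd_mul, twist_of_even _ hf, mul_smul_comm, mul_smul_comm, ← smul_add, add_mul,
    add_comm, mul_assoc, ← mul_comm_of_even hg, mul_assoc]

theorem DH_mul [NeZero (2 : F)] {f : Alg F r n} (hf : sgn f = f) (g h : Alg F r n) :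
    DH F f (g * h) = DH F f g * h + g * DH F f h := by
  rw [DH_eq_vf]
  exact vf_mul (isEvenField_DH hf) g h

theorem sgn_DH_apply {f : Alg F r n} (hf : sgn f = f) (h : Alg F r n) :
    sgn (DH F f h) = DH F f (sgn h) := by
  rw [DH_eq_vf]
  exact sgn_vf (isEvenField_DH hf) h

theorem DH_apply_swap [NeZero (2 : F)] {f g : Alg F r n} (hf : sgn f = f) (hg : sgn g = g) :
    DH F f g = - DH F g f := by
  rw [DH_apply_of_even hf, DH_apply_of_even hg, ← sum_conj, ← Finset.sum_neg_distrib]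
  refine Finset.sum_congr rfl fun i _ => ?_
  rw [conj_conj, tau_conj, mul_smul, neg_smul, smul_comm]
  rw [neg_inj]
  congr 1
  rcases i with i | i
  · rw [mul_comm_of_even]
    · simp [par]
    · rw [sgn_pd, hf]; simp [conj, par]
  · rw [mul_comm_of_odd, sgn_pd, hg, smul_mul_assoc, smul_smul, neg_one_pow_par_mul_self, one_smul]
    rw [sgn_pd, hf]; simp [conj, par]

theorem DH_one_apply (h : Alg F r n) : DH F 1 h = 0 := by
  rw [DH_apply_of_even (by rw [← mon_zero_empty, sgn_mon]; simp)]
  simp [pd_one]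

theorem DH_apply_var {f : Alg F r n} (hf : sgn f = f) (j : Idx r n) :
    DH F f (var F j) = tau F (conj j) • pd F (conj j) f := by
  rw [DH_eq_vf, vf_var, twist_of_even _ hf]

theorem DH_var_inl (i : Fin (2 * r)) (h : Alg F r n) :
    DH F (var F (.inl i)) h =
      tau F (.inl i : Idx r n) • pd F (.inl (evenConj i) : Idx r n) h := by
  rw [DH_apply_of_even (by rw [sgn_var]; simp [par]), Finset.sum_eq_single (.inl i)]
  · rw [pd_var', if_pos rfl, one_mul]; rfl
  · intro j _ hj
    rw [pd_var', if_neg hj]; simp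
  · simp

theorem DH_var_mul_var (k l : Fin n) (h : Alg F r n) :
    DH F (var F (.inr k) * var F (.inr l)) h =
      var F (.inr l) * pd F (.inr (oddConj k) : Idx r n) h -
        var F (.inr k) * pd F (.inr (oddConj l) : Idx r n) h := by
  rw [DH_apply_of_even (by rw [sgn_mul, sgn_var, sgn_var]; simp [par])]
  have : ∀ j : Idx r n, tau F j • (pd F j (var F (.inr k) * var F (.inr l)) * pd F (conj j) h) =
      (if j = .inr k then var F (.inr l) * pd F (.inr (oddConj k) : Idx r n) h else 0) -
      (if j = .inr l then var F (.inr k) * pd F (.inr (oddConj l) : Idx r n) h else 0) := by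
    rintro (j | j)
    · simp [pd_inl_mul, pd_var']
    · rw [pd_var_mul, pd_var']
      simp only [Sum.inr.injEq, tau, one_smul, conj, sub_mul]
      split_ifs with h1 h2 h2
      · rw [← h1, ← h2]; simp
      all_goals simp [*]
  rw [Finset.sum_congr rfl fun j _ => this j, Finset.sum_sub_distrib]
  simp

/-- Only the part of f without odd variables survives multiplication by x^ω, and that part is even.
-/
theorem odd_mul_top [NeZero (2 : F)] {f : Alg F r n} (hf : sgn f = -f) :
    f * mon F 0 Finset.univ = 0 := by
  have h : ∀ f : Alg F r n, (f - sgn f) * mon F 0 Finset.univ = 0 := by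
    intro f
    induction f using mon_induction with
    | hadd f f' h1 h2 =>
      have : f + f' - sgn (f + f') = (f - sgn f) + (f' - sgn f') := by rw [map_add]; abel
      rw [this, add_mul, h1, h2, add_zero]
    | hsmul a f h1 => rw [map_smul, ← smul_sub, smul_mul_assoc, h1, smul_zero]
    | hmon α u =>
      rcases u.eq_empty_or_nonempty with rfl | ⟨k, hk⟩
      · rw [sgn_mon]; simp
      · rw [sgn_mon, sub_mul, smul_mul_assoc, mon_mul_mon_of_not_disjoint]
        · simp
        · exact fun hd => Finset.disjoint_left.1 hd hk (Finset.mem_univ k)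
  have h1 := h f
  rw [hf, sub_neg_eq_add, ← two_smul F f, smul_mul_assoc] at h1
  exact (smul_eq_zero.1 h1).resolve_left two_ne_zero

theorem oddConj_involutive : Function.Involutive (oddConj : Fin n → Fin n) := oddConj_oddConj

theorem sum_pd_conj_pd_odd [NeZero (2 : F)] (f : Alg F r n) :
    ∑ k : Fin n, pd F (.inr (oddConj k) : Idx r n) (pd F (.inr k : Idx r n) f) = 0 := by
  have h : ∑ k : Fin n, pd F (.inr (oddConj k) : Idx r n) (pd F (.inr k : Idx r n) f) =
      - ∑ k : Fin n, pd F (.inr (oddConj k) : Idx r n) (pd F (.inr k : Idx r n) f) := by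
    conv_lhs => rw [← Equiv.sum_comp (Function.Involutive.toPerm oddConj oddConj_involutive)]
    rw [← Finset.sum_neg_distrib]
    refine Finset.sum_congr rfl fun k _ => ?_
    rw [Function.Involutive.coe_toPerm, oddConj_oddConj, pd_inr_anticomm]
  have h1 := eq_neg_iff_add_eq_zero.1 h
  rw [← two_smul F] at h1
  exact (smul_eq_zero.1 h1).resolve_left two_ne_zero

/-- On x^ω the field D_H(f) acts through its odd divergence ∑_k ∂_{k'} ∂_k f, which vanishes because
the odd derivations anticommute. -/
theorem DH_apply_top [NeZero (2 : F)] {f : Alg F r n} (hf : sgn f = f) :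
    DH F f (mon F 0 Finset.univ) = 0 := by
  rw [DH_apply_of_even hf, Fintype.sum_sum_type]
  have h1 : ∀ i : Fin (2 * r), pd F (conj (.inl i) : Idx r n) (mon F 0 Finset.univ) = 0 :=
    fun i => by rw [conj, pd_inl_mon]; simp
  have h2 : ∀ k : Fin n, tau F (.inr k : Idx r n) • (pd F (.inr k : Idx r n) f *
      pd F (conj (.inr k) : Idx r n) (mon F 0 Finset.univ)) =
      pd F (.inr (oddConj k) : Idx r n) (pd F (.inr k : Idx r n) f) * mon F 0 Finset.univ := by
    intro k
    have hk : sgn (pd F (.inr k : Idx r n) f) = - pd F (.inr k : Idx r n) f := by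
      rw [sgn_pd, hf]; simp [par]
    -- Differentiating the zero product ∂_k(f) x^ω moves ∂_{k'} from x^ω to ∂_k(f).
    have h3 := pd_inr_mul (oddConj k) (pd F (.inr k : Idx r n) f) (mon F 0 Finset.univ)
    rw [odd_mul_top hk, map_zero, hk, neg_mul, eq_comm, add_neg_eq_zero] at h3
    rw [h3]; simp [tau, conj]
  simp only [h1, h2, mul_zero, smul_zero, Finset.sum_const_zero, zero_add]
  rw [← Finset.sum_mul, sum_pd_conj_pd_odd, zero_mul]

theorem ad_DH_DH_top [NeZero (2 : F)] {f : Alg F r n} (hf : sgn f = f) :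
    ad (DH F f) (DH F (mon F 0 Finset.univ)) = 0 := by
  rw [ad_DH_DH hf, DH_apply_top hf, map_zero]

end VectorFields

/-! ### Coefficients, weights, and invariants of so(n) -/

section Coefficients

variable {F : Type*} [Field F] {r n : ℕ}

/-- The coefficient functional of a monomial. -/
def cf (b : (Fin (2 * r) → ℕ) × Finset (Fin n)) : Alg F r n →ₗ[F] F := (monBasis F).coord b

theorem cf_mon (α β : Fin (2 * r) → ℕ) (u v : Finset (Fin n)) :
    cf (β, v) (mon F α u) = if α = β ∧ u = v then 1 else 0 := repr_mon α β u v

theorem eq_zero_of_cf {f : Alg F r n} (h : ∀ β v, cf (β, v) f = 0) : f = 0 :=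
  (monBasis F).ext_elem fun b => by simpa [cf] using h b.1 b.2

theorem cf_pd_inl (i : Fin (2 * r)) (β : Fin (2 * r) → ℕ) (v : Finset (Fin n))
    (f : Alg F r n) :
    cf (β, v) (pd F (.inl i : Idx r n) f) = cf (β + Pi.single i 1, v) f := by
  induction f using mon_induction with
  | hadd f f' h1 h2 => simp only [map_add, h1, h2]
  | hsmul a f h1 => simp only [map_smul, h1]
  | hmon α u =>
  rw [pd_inl_mon, cf_mon]
  have key : α = β + Pi.single i 1 ↔ 0 < α i ∧ Function.update α i (α i - 1) = β := by
    constructor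
    · rintro rfl
      refine ⟨by simp, ?_⟩
      funext l
      by_cases hl : l = i
      · subst hl; simp
      · simp [hl]
    · rintro ⟨h, rfl⟩
      funext l
      by_cases hl : l = i
      · subst hl; simp; omega
      · simp [hl]
  simp only [key]
  split_ifs with h1 h2 h2
  · rw [cf_mon, if_pos ⟨h2.1.2, h2.2⟩]
  · rw [cf_mon, if_neg]
    exact fun h => h2 ⟨⟨h1, h.1⟩, h.2⟩
  · exact absurd h2.1.1 h1
  · simp

theorem cf_var_mul_pd (k : Fin n) (β : Fin (2 * r) → ℕ) (v : Finset (Fin n)) (f : Alg F r n) :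
    cf (β, v) (var F (.inr k) * pd F (.inr k : Idx r n) f) =
      if k ∈ v then cf (β, v) f else 0 := by
  induction f using mon_induction with
  | hadd f f' h1 h2 => simp only [map_add, mul_add, h1, h2]; split_ifs <;> simp
  | hsmul a f h1 => simp only [map_smul, mul_smul_comm, h1]; split_ifs <;> simp
  | hmon α u =>
  have h : var F (.inr k) * pd F (.inr k : Idx r n) (mon F α u) =
      if k ∈ u then mon F α u else 0 := by
    split_ifs with hk
    · have := pd_var_mul k k (mon F α u)
      rw [var_mul_mon_of_mem hk, map_zero, if_pos rfl, eq_comm, sub_eq_zero] at this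
      exact this.symm
    · rw [pd_inr_mon, if_neg hk, mul_zero]
  rw [h]
  split_ifs with h1 h2 h2
  · rfl
  · rw [cf_mon, if_neg]
    rintro ⟨-, rfl⟩; exact h2 h1
  · rw [cf_mon, if_neg, map_zero]
    rintro ⟨-, rfl⟩; exact h1 h2
  · simp

theorem cf_sgn (β : Fin (2 * r) → ℕ) (v : Finset (Fin n)) (f : Alg F r n) :
    cf (β, v) (sgn f) = (-1) ^ v.card * cf (β, v) f := by
  induction f using mon_induction with
  | hadd f f' h1 h2 => simp only [map_add, mul_add, h1, h2]
  | hsmul a f h1 => simp only [map_smul, h1, smul_eq_mul]; ring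
  | hmon α u =>
  rw [sgn_mon, map_smul, cf_mon]
  split_ifs with h
  · rw [h.2, smul_eq_mul]
  · simp

theorem cf_eq_zero_of_pd {f : Alg F r n} (h : ∀ i, pd F (.inl i : Idx r n) f = 0)
    {β : Fin (2 * r) → ℕ} (hβ : β ≠ 0) (v : Finset (Fin n)) : cf (β, v) f = 0 := by
  obtain ⟨i, hi⟩ := Function.ne_iff.1 hβ
  have h1 : β = (β - Pi.single i 1) + Pi.single i 1 := by
    funext l
    by_cases hl : l = i
    · subst hl; simp at hi ⊢; omega
    · simp [hl]
  rw [h1, ← cf_pd_inl, h, map_zero]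

theorem eq_var_mul_pd {k : Fin n} {f : Alg F r n} (h : var F (.inr k) * f = 0) :
    f = var F (.inr k) * pd F (.inr k : Idx r n) f := by
  have := pd_var_mul k k f
  rw [h, map_zero, if_pos rfl, eq_comm, sub_eq_zero] at this
  exact this

theorem cf_eq_zero_of_var_mul {k : Fin n} {f : Alg F r n} (h : var F (.inr k) * f = 0)
    (β : Fin (2 * r) → ℕ) {v : Finset (Fin n)} (hk : k ∉ v) : cf (β, v) f = 0 := by
  rw [eq_var_mul_pd h, cf_var_mul_pd, if_neg hk]

/-- The quadratics x_k x_{k'} span a torus of so(n) that acts diagonally on monomials, since each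
x_k ∂_k projects to the monomials containing x_k. -/
theorem cf_DH_torus {k : Fin n} (β : Fin (2 * r) → ℕ) (v : Finset (Fin n)) (f : Alg F r n) :
    cf (β, v) (DH F (var F (.inr k) * var F (.inr (oddConj k))) f) =
      ((if oddConj k ∈ v then 1 else 0) - (if k ∈ v then 1 else 0)) * cf (β, v) f := by
  rw [DH_var_mul_var, oddConj_oddConj, map_sub, cf_var_mul_pd, cf_var_mul_pd, sub_mul, ite_mul,
    ite_mul]
  simp

theorem odd_card_of_cf_ne [NeZero (2 : F)] {f : Alg F r n} (hf : sgn f = -f)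
    {β : Fin (2 * r) → ℕ} {v : Finset (Fin n)} (h : cf (β, v) f ≠ 0) : Odd v.card := by
  by_contra hv
  have h1 := cf_sgn β v f
  rw [hf, (Nat.not_odd_iff_even.1 hv).neg_one_pow, one_mul, map_neg, neg_eq_iff_add_eq_zero,
    ← two_mul] at h1
  exact h ((mul_eq_zero.1 h1).resolve_left two_ne_zero)

theorem even_card_of_cf_ne [NeZero (2 : F)] {f : Alg F r n} (hf : sgn f = f)
    {β : Fin (2 * r) → ℕ} {v : Finset (Fin n)} (h : cf (β, v) f ≠ 0) : Even v.card := by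
  by_contra hv
  have h1 := cf_sgn β v f
  rw [hf, (Nat.not_even_iff_odd.1 hv).neg_one_pow, neg_one_mul, eq_neg_iff_add_eq_zero,
    ← two_mul] at h1
  exact h ((mul_eq_zero.1 h1).resolve_left two_ne_zero)

/-- The last odd index. -/
def last (hn : Odd n) : Fin n := ⟨n - 1, Nat.sub_lt hn.pos one_pos⟩

theorem oddConj_eq_self_iff (hn : Odd n) (k : Fin n) : oddConj k = k ↔ k = last hn := by
  obtain ⟨s, hs⟩ := hn
  have : n / 2 = s := by omega
  unfold oddConj last
  rw [Fin.ext_iff, Fin.ext_iff]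
  split_ifs with h1 h2
  · simp; omega
  · simp; omega
  · simp; omega

theorem oddConj_last (hn : Odd n) : oddConj (last hn) = last hn :=
  (oddConj_eq_self_iff hn _).2 rfl

theorem oddConj_ne_last (hn : Odd n) {k : Fin n} (hk : k ≠ last hn) : oddConj k ≠ last hn := by
  intro h
  apply hk
  rw [← oddConj_oddConj k, h, oddConj_last]

/-- The involution k ↦ k' fixes only the last index, so it has no fixed point on v; the count is
made modulo 2. -/
theorem even_card_of_conj_mem (hn : Odd n) {v : Finset (Fin n)}
    (h : ∀ k ∈ v, oddConj k ∈ v) (hl : last hn ∉ v) : Even v.card := by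
  have h1 : ∑ _k ∈ v, (1 : ZMod 2) = 0 := by
    refine Finset.sum_involution (fun k _ => oddConj k) ?_ ?_ ?_ ?_
    · intro k _; decide
    · intro k hk _ h2
      rw [oddConj_eq_self_iff hn] at h2
      exact hl (h2 ▸ hk)
    · exact h
    · intro k _; exact oddConj_oddConj k
  simpa [ZMod.natCast_eq_zero_iff_even] using h1

theorem conj_mem_iff_of_torus {k : Fin n} {f : Alg F r n}
    (h : DH F (var F (.inr k) * var F (.inr (oddConj k))) f = 0)
    {β : Fin (2 * r) → ℕ} {v : Finset (Fin n)} (hv : cf (β, v) f ≠ 0) :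
    oddConj k ∈ v ↔ k ∈ v := by
  have h1 := cf_DH_torus (k := k) β v f
  rw [h, map_zero, eq_comm, mul_eq_zero, or_iff_left hv] at h1
  split_ifs at h1 with h2 h3 h3 <;> simp_all

/-- An odd element of the exterior algebra that is killed by `so(n)` and has no component in top
degree vanishes. -/
theorem eq_zero_of_so_invariant_odd [NeZero (2 : F)] (hn : Odd n) {f : Alg F r n}
    (hpd : ∀ i, pd F (.inl i : Idx r n) f = 0) (hodd : sgn f = -f)
    (hso : ∀ k l : Fin n, DH F (var F (.inr k) * var F (.inr l)) f = 0)
    (htop : cf (0, Finset.univ) f = 0) : f = 0 := by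
  -- Weight zero makes v stable under k ↦ k'; as |v| is odd, v contains the fixed index.
  have hlast : ∀ β v, cf (β, v) f ≠ 0 → last hn ∈ v := by
    intro β v hv
    by_contra hl
    have := even_card_of_conj_mem hn
      (fun k hk => (conj_mem_iff_of_torus (hso k _) hv).2 hk) hl
    exact Nat.not_even_iff_odd.2 (odd_card_of_cf_ne hodd hv) this
  have hN : f = var F (.inr (last hn)) * pd F (.inr (last hn) : Idx r n) f := by
    rw [← sub_eq_zero]
    refine eq_zero_of_cf fun β v => ?_
    rw [map_sub, cf_var_mul_pd]
    split_ifs with h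
    · simp
    · by_contra h1
      exact h (hlast β v (by simpa using h1))
  have hxl : var F (.inr (last hn)) * f = 0 := by
    rw [hN, ← mul_assoc]
    have : (var F (.inr (last hn)) : Alg F r n) * var F (.inr (last hn)) = 0 :=
      var_mul_mon_of_mem (by simp) _
    rw [this, zero_mul]
  have hx : ∀ k, var F (.inr k) * f = 0 := by
    intro k
    by_cases hk : k = last hn
    · rw [hk, hxl]
    -- Invariance reads x_last ∂_{k'} f = x_k ∂_last f. Applying ∂_{k'} to x_last f = 0 makes the
    -- left side vanish, and then x_k f = 0 because f = x_last ∂_last f.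
    have h1 := hso k (last hn)
    rw [DH_var_mul_var, oddConj_last] at h1
    have h2 := pd_var_mul (oddConj k) (last hn) f
    rw [hxl, map_zero, if_neg (oddConj_ne_last hn hk), zero_sub, eq_comm, neg_eq_zero] at h2
    rw [h2, zero_sub, neg_eq_zero] at h1
    have h3 : (var F (.inr k) : Alg F r n) * var F (.inr (last hn)) =
        - (var F (.inr (last hn)) * var F (.inr k)) := by
      rw [mul_comm_of_odd (f := var F (.inr k)) (by rw [sgn_var]; simp [par]), sgn_var]
      simp [par]
    rw [hN, ← mul_assoc, h3, neg_mul, mul_assoc, h1, mul_zero, neg_zero]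
  refine eq_zero_of_cf fun β v => ?_
  by_cases hβ : β = 0
  · by_cases hv : v = Finset.univ
    · rw [hβ, hv, htop]
    · obtain ⟨k, hk⟩ : ∃ k, k ∉ v := by
        by_contra h; push Not at h; exact hv (Finset.eq_univ_iff_forall.2 h)
      exact cf_eq_zero_of_var_mul (hx k) β hk
  · exact cf_eq_zero_of_pd hpd hβ v

theorem DH_odd_pair_var (k l : Fin n) (j : Fin n) :
    DH F (var F (.inr k) * var F (.inr l)) (var F (.inr j : Idx r n)) =
      (if oddConj k = j then var F (.inr l) else 0) -
        (if oddConj l = j then var F (.inr k) else 0) := by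
  rw [DH_var_mul_var, pd_var', pd_var']
  simp only [Sum.inr.injEq]
  split_ifs <;> simp

/-- The components `e_k` along the odd `∂_k` of an odd vector field on the exterior algebra that
is invariant under `so(n)` vanish if a single coefficient does. -/
theorem eq_zero_of_so_invariant_even [NeZero (2 : F)] (hn : Odd n) {e : Idx r n → Alg F r n}
    (hpd : ∀ i j, pd F (.inl i : Idx r n) (e (.inr j)) = 0)
    (heven : ∀ j, sgn (e (.inr j)) = e (.inr j))
    (hso : ∀ k l j : Fin n, DH F (var F (.inr k) * var F (.inr l)) (e (.inr j)) =
      vf e (DH F (var F (.inr k) * var F (.inr l)) (var F (.inr j))))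
    (htop : cf (0, Finset.univ.erase (last hn)) (e (.inr (last hn))) = 0) (j : Fin n) :
    e (.inr j) = 0 := by
  -- The component along the last ∂ has weight zero and even degree, so now the fixed index is
  -- excluded from v.
  have hlast : ∀ β v, cf (β, v) (e (.inr (last hn))) ≠ 0 → last hn ∉ v := by
    intro β v hv hl
    have hc : ∀ k ∈ v, oddConj k ∈ v := by
      intro k hk
      by_cases hkl : k = last hn
      · rw [hkl, oddConj_last, ← hkl]; exact hk
      · refine (conj_mem_iff_of_torus (f := e (.inr (last hn))) ?_ hv).2 hk
        rw [hso, DH_odd_pair_var, if_neg (oddConj_ne_last hn hkl), oddConj_oddConj, if_neg hkl]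
        simp
    have h1 : Even (v.erase (last hn)).card := by
      refine even_card_of_conj_mem hn (fun k hk => ?_) (by simp)
      rw [Finset.mem_erase] at hk ⊢
      exact ⟨oddConj_ne_last hn hk.1, hc k hk.2⟩
    have h2 := even_card_of_cf_ne (heven _) hv
    rw [← Finset.insert_erase hl, Finset.card_insert_of_notMem (by simp)] at h2
    exact absurd h1 (by simpa [Nat.even_add_one] using h2)
  have hpl : pd F (.inr (last hn) : Idx r n) (e (.inr (last hn))) = 0 := by
    have h1 : var F (.inr (last hn)) * pd F (.inr (last hn) : Idx r n) (e (.inr (last hn))) =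
        0 := by
      refine eq_zero_of_cf fun β v => ?_
      rw [cf_var_mul_pd]
      split_ifs with h
      · by_contra h1; exact hlast β v h1 h
      · rfl
    have h2 := eq_var_mul_pd h1
    have h3 : pd F (.inr (last hn) : Idx r n)
        (pd F (.inr (last hn) : Idx r n) (e (.inr (last hn)))) = 0 := by
      have := pd_inr_anticomm (last hn) (last hn) (e (.inr (last hn)))
      rw [eq_neg_iff_add_eq_zero, ← two_smul F] at this
      exact (smul_eq_zero.1 this).resolve_left two_ne_zero
    rw [h3, mul_zero] at h2
    exact h2
  -- Rotating the last variable into x_k expresses every other component through the last one.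
  have hek : ∀ k, k ≠ last hn → e (.inr k) =
      - (var F (.inr (last hn)) * pd F (.inr (oddConj k) : Idx r n) (e (.inr (last hn)))) := by
    intro k hk
    have h := hso k (last hn) (last hn)
    rw [DH_odd_pair_var, if_neg (oddConj_ne_last hn hk), oddConj_last, if_pos rfl, zero_sub,
      map_neg, vf_var, DH_var_mul_var, oddConj_last, hpl, mul_zero, sub_zero] at h
    rw [h, neg_neg]
  have hll : (var F (.inr (last hn)) : Alg F r n) * var F (.inr (last hn)) = 0 :=
    var_mul_mon_of_mem (by simp) _
  -- Equivariance in the opposite direction writes e_last as a multiple of x_k. Together with the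
  -- absence of x_last, this leaves only the monomial x^(ω ∖ last), whose coefficient is zero by
  -- `htop`.
  have hx : ∀ k, k ≠ last hn → var F (.inr k) * e (.inr (last hn)) = 0 := by
    intro k hk
    have hk' := oddConj_ne_last hn hk
    have h := hso k (last hn) (oddConj k)
    rw [DH_odd_pair_var, if_pos rfl, oddConj_last, if_neg (Ne.symm hk'), sub_zero, vf_var,
      DH_var_mul_var, oddConj_last] at h
    have h1 : var F (.inr (last hn)) * e (.inr (oddConj k)) = 0 := by
      rw [hek _ hk', mul_neg, ← mul_assoc, hll, zero_mul, neg_zero]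
    have h2 := pd_var_mul (oddConj k) (last hn) (e (.inr (oddConj k)))
    rw [h1, map_zero, if_neg hk', zero_sub, eq_comm, neg_eq_zero] at h2
    rw [h2, zero_sub] at h
    have hkk : (var F (.inr k) : Alg F r n) * var F (.inr k) = 0 :=
      var_mul_mon_of_mem (by simp) _
    rw [← h, mul_neg, ← mul_assoc, hkk, zero_mul, neg_zero]
  have h0 : e (.inr (last hn)) = 0 := by
    refine eq_zero_of_cf fun β v => ?_
    by_cases hβ : β = 0
    · by_contra hv
      have : v = Finset.univ.erase (last hn) := by
        ext k
        simp only [Finset.mem_erase, Finset.mem_univ, and_true]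
        constructor
        · rintro hk rfl; exact hlast β v hv hk
        · intro hk
          by_contra hkv
          exact hv (cf_eq_zero_of_var_mul (hx k hk) β hkv)
      rw [this, hβ] at hv
      exact hv htop
    · exact cf_eq_zero_of_pd (fun i => hpd i _) hβ v
  by_cases hj : j = last hn
  · rw [hj, h0]
  · rw [hek j hj, h0]; simp

end Coefficients

/-! ### Products and brackets with variables and low-degree monomials -/

section Monomials

variable {F : Type*} [Field F] {r n : ℕ}

theorem single_mul_mon (i : Fin (2 * r)) (a : ℕ) (β : Fin (2 * r) → ℕ) (u : Finset (Fin n)) :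
    mon F (Pi.single i a) ∅ * mon F β u =
      ((β i + a).choose a : F) • mon F (β + Pi.single i a) u := by
  rw [mon_mul_mon _ _ (by simp), invSign_empty_left, mul_one, Finset.empty_union,
    Finset.prod_eq_single i]
  · rw [Pi.single_eq_same, add_comm a, add_comm _ β]
  · intro l _ hl
    rw [Pi.single_eq_of_ne hl]; simp
  · simp

theorem var_inl_mul_mon (i : Fin (2 * r)) (β : Fin (2 * r) → ℕ) (u : Finset (Fin n)) :
    var F (.inl i) * mon F β u = ((β i : F) + 1) • mon F (β + Pi.single i 1) u := by
  rw [var, single_mul_mon]; simp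

theorem pd_inl_add_single (i : Fin (2 * r)) (β : Fin (2 * r) → ℕ) (u : Finset (Fin n)) :
    pd F (.inl i : Idx r n) (mon F (β + Pi.single i 1) u) = mon F β u := by
  rw [pd_inl_mon, if_pos (by simp)]
  congr 1
  funext l
  by_cases hl : l = i
  · subst hl; simp
  · simp [hl]

theorem pd_inl_of_eq_zero {i : Fin (2 * r)} {β : Fin (2 * r) → ℕ} (h : β i = 0)
    (u : Finset (Fin n)) : pd F (.inl i : Idx r n) (mon F β u) = 0 := by
  rw [pd_inl_mon, if_neg (by omega)]

theorem exists_eq_add_single {i : Fin (2 * r)} {β : Fin (2 * r) → ℕ} (h : β i ≠ 0) :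
    ∃ γ : Fin (2 * r) → ℕ, β = γ + Pi.single i 1 :=
  ⟨β - Pi.single i 1, by
    funext l
    by_cases hl : l = i
    · subst hl; simp; omega
    · simp [hl]⟩

theorem single_mul_pd (i : Fin (2 * r)) (a : ℕ) (β : Fin (2 * r) → ℕ) (u : Finset (Fin n)) :
    mon F (Pi.single i (a + 1)) ∅ * pd F (.inl i : Idx r n) (mon F β u) =
      ((β i + a).choose (a + 1) : F) • mon F (β + Pi.single i a) u := by
  by_cases h : β i = 0
  · rw [pd_inl_of_eq_zero h, h, mul_zero, zero_add, Nat.choose_succ_self]; simp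
  · obtain ⟨γ, rfl⟩ := exists_eq_add_single h
    rw [pd_inl_add_single, single_mul_mon, add_assoc γ, ← Pi.single_add, add_comm 1 a]
    congr 3
    simp; ring

theorem var_mul_pd_inl (i : Fin (2 * r)) (β : Fin (2 * r) → ℕ) (u : Finset (Fin n)) :
    var F (.inl i) * pd F (.inl i : Idx r n) (mon F β u) = (β i : F) • mon F β u := by
  have := single_mul_pd (F := F) i 0 β u
  simpa [var] using this

theorem sgn_mon_of_even {u : Finset (Fin n)} (hu : Even u.card) (α : Fin (2 * r) → ℕ) :
    sgn (mon F α u) = mon F α u := by rw [sgn_mon, hu.neg_one_pow, one_smul]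

theorem sgn_mon_of_odd {u : Finset (Fin n)} (hu : Odd u.card) (α : Fin (2 * r) → ℕ) :
    sgn (mon F α u) = -mon F α u := by rw [sgn_mon, hu.neg_one_pow, neg_one_smul]

theorem sgn_var_inl (i : Fin (2 * r)) : sgn (var F (.inl i : Idx r n)) = var F (.inl i) := by
  rw [sgn_var]; simp [par]

theorem sgn_var_inr (k : Fin n) : sgn (var F (.inr k : Idx r n)) = -var F (.inr k) := by
  rw [sgn_var]; simp [par]

theorem sgn_mul_of_even {f g : Alg F r n} (hf : sgn f = f) (hg : sgn g = g) :
    sgn (f * g) = f * g := by rw [sgn_mul, hf, hg]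

theorem sgn_var_mul_var (k l : Fin n) :
    sgn (var F (.inr k : Idx r n) * var F (.inr l)) = var F (.inr k) * var F (.inr l) := by
  rw [sgn_mul, sgn_var_inr, sgn_var_inr, neg_mul_neg]

theorem var_mul_self (k : Fin n) : (var F (.inr k) : Alg F r n) * var F (.inr k) = 0 :=
  var_mul_mon_of_mem (by simp) _

theorem var_mul_var_swap [NeZero (2 : F)] (k l : Fin n) :
    (var F (.inr k) : Alg F r n) * var F (.inr l) = - (var F (.inr l) * var F (.inr k)) := by
  rw [mul_comm_of_odd (sgn_var_inr k), sgn_var_inr, neg_mul]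

theorem DH_even_pair [NeZero (2 : F)] (i j : Fin (2 * r)) (h : Alg F r n) :
    DH F (var F (.inl i) * var F (.inl j)) h =
      tau F (.inl j : Idx r n) • (var F (.inl i) * pd F (.inl (evenConj j) : Idx r n) h) +
      tau F (.inl i : Idx r n) • (var F (.inl j) * pd F (.inl (evenConj i) : Idx r n) h) := by
  rw [DH_mul_of_even (sgn_var_inl i) (sgn_var_inl j), DH_var_inl, DH_var_inl, mul_smul_comm,
    mul_smul_comm]

theorem DH_mixed_cubic [NeZero (2 : F)] (i : Fin (2 * r)) (k l : Fin n) (h : Alg F r n) :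
    DH F (var F (.inl i) * (var F (.inr k) * var F (.inr l))) h =
      var F (.inl i) * DH F (var F (.inr k) * var F (.inr l)) h +
      tau F (.inl i : Idx r n) •
        (var F (.inr k) * var F (.inr l) * pd F (.inl (evenConj i) : Idx r n) h) := by
  rw [DH_mul_of_even (sgn_var_inl i) (sgn_var_mul_var k l), DH_var_inl, mul_smul_comm]

theorem evenConj_ne (i : Fin (2 * r)) : evenConj i ≠ i := by
  intro h
  have := congrArg Fin.val h
  unfold evenConj at this
  split_ifs at this with h1
  · simp at this; omega
  · simp at this; omega

theorem tau_inl_ne_zero (i : Fin (2 * r)) : tau F (.inl i : Idx r n) ≠ 0 := tau_ne_zero _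

theorem tau_evenConj (i : Fin (2 * r)) :
    tau F (.inl (evenConj i) : Idx r n) = - tau F (.inl i : Idx r n) := by
  have := tau_conj (F := F) (.inl i : Idx r n)
  simpa [conj, par] using this

end Monomials

/-! ### The truncated algebra and its degree filtration -/

section Filtration

variable (F : Type*) [Field F] (p : ℕ) {r : ℕ} (n : ℕ) (t : Fin (2 * r) → ℕ+)

/-- The span of the monomials `x^(α) x^u` with `α ≤ π`. -/
def bd : Submodule F (Alg F r n) :=
  Submodule.span F {f | ∃ α u, α ≤ piTop p t ∧ f = mon F α u}

/-- The span of the monomials `x^(α) x^u` with `α ≤ π` of degree at most `k`. -/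
def fil (k : ℕ) : Submodule F (Alg F r n) :=
  Submodule.span F {f | ∃ α u, α ≤ piTop p t ∧ (∑ i, α i) + u.card ≤ k ∧ f = mon F α u}

variable {F p n t}

theorem mon_mem_bd {α : Fin (2 * r) → ℕ} (hα : α ≤ piTop p t) (u : Finset (Fin n)) :
    mon F α u ∈ bd F p n t := Submodule.subset_span ⟨α, u, hα, rfl⟩

theorem mon_mem_fil {α : Fin (2 * r) → ℕ} (hα : α ≤ piTop p t) {u : Finset (Fin n)} {k : ℕ}
    (hk : (∑ i, α i) + u.card ≤ k) : mon F α u ∈ fil F p n t k :=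
  Submodule.subset_span ⟨α, u, hα, hk, rfl⟩

theorem fil_le_bd (k : ℕ) : fil F p n t k ≤ bd F p n t := by
  refine Submodule.span_le.2 ?_
  rintro _ ⟨α, u, hα, -, rfl⟩
  exact mon_mem_bd hα u

theorem fil_mono {k l : ℕ} (h : k ≤ l) : fil F p n t k ≤ fil F p n t l := by
  refine Submodule.span_le.2 ?_
  rintro _ ⟨α, u, hα, hk, rfl⟩
  exact mon_mem_fil hα (hk.trans h)

theorem pd_mem_bd {f : Alg F r n} (hf : f ∈ bd F p n t) (i : Idx r n) :
    pd F i f ∈ bd F p n t := by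
  have : bd F p n t ≤ (bd F p n t).comap (pd F i) := by
    refine Submodule.span_le.2 ?_
    rintro _ ⟨α, u, hα, rfl⟩
    rw [SetLike.mem_coe, Submodule.mem_comap]
    rcases i with i | k
    · rw [pd_inl_mon]
      split_ifs
      · refine mon_mem_bd (fun l => ?_) u
        by_cases hl : l = i
        · subst hl
          have h1 : α l ≤ piTop p t l := hα l
          simp only [Function.update_self]; omega
        · simpa [hl] using hα l
      · exact zero_mem _
    · rw [pd_inr_mon]
      split_ifs
      · exact Submodule.smul_mem _ _ (mon_mem_bd hα _)
      · exact zero_mem _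
  exact this hf

variable [Fact p.Prime]

theorem piTop_add_one (i : Fin (2 * r)) : piTop p t i + 1 = p ^ (t i : ℕ) :=
  Nat.sub_add_cancel (Nat.one_le_pow _ _ (Fact.out : p.Prime).pos)

theorem one_le_piTop (i : Fin (2 * r)) : p ≤ piTop p t i + 1 := by
  rw [piTop_add_one]
  exact Nat.le_self_pow (PNat.ne_zero _) p

theorem var_mem_fil (i : Idx r n) : var F i ∈ fil F p n t 1 := by
  rcases i with i | k
  · refine mon_mem_fil (fun l => ?_) ?_
    · by_cases hl : l = i
      · subst hl
        have h1 := one_le_piTop (p := p) (t := t) l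
        have h2 := (Fact.out : p.Prime).two_le
        simp; omega
      · simp [hl]
    · simp
  · refine mon_mem_fil (fun l => by simp) ?_
    simp

variable [CharP F p]

/-- Write a + b = p^N + c with c < a and expand by Vandermonde: the term C(p^N, 0) C(c, a) is zero,
and in the others p divides C(p^N, j) since 0 < j < p^N. Consequently the span of the monomials with
α ≤ π is closed under products. -/
theorem cast_choose_eq_zero {a b N : ℕ} (ha : a < p ^ N) (hb : b < p ^ N) (h : p ^ N ≤ a + b) :
    ((a + b).choose a : F) = 0 := by
  obtain ⟨c, hc⟩ := Nat.exists_eq_add_of_le h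
  rw [CharP.cast_eq_zero_iff F p, hc, Nat.add_choose_eq]
  refine Finset.dvd_sum fun ij hij => ?_
  have hij := Finset.HasAntidiagonal.mem_antidiagonal.1 hij
  by_cases h0 : ij.1 = 0
  · rw [Nat.choose_eq_zero_of_lt (n := c) (by omega), mul_zero]
    exact dvd_zero _
  · exact Dvd.dvd.mul_right ((Fact.out : p.Prime).dvd_choose_pow h0 (by omega)) _

theorem mon_mul_mon_eq_zero {α β : Fin (2 * r) → ℕ} (hα : α ≤ piTop p t) (hβ : β ≤ piTop p t)
    (h : ¬ α + β ≤ piTop p t) (u v : Finset (Fin n)) : mon F α u * mon F β v = 0 := by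
  by_cases hd : Disjoint u v
  · rw [mon_mul_mon _ _ hd]
    obtain ⟨i, hi⟩ : ∃ i, ¬ (α + β) i ≤ piTop p t i := by
      by_contra hc; push Not at hc; exact h hc
    have h1 := piTop_add_one (p := p) (t := t) i
    have h2 : α i ≤ piTop p t i := hα i
    have h3 : β i ≤ piTop p t i := hβ i
    simp only [Pi.add_apply] at hi h2 h3
    rw [Finset.prod_eq_zero (Finset.mem_univ i)
      (cast_choose_eq_zero (p := p) (N := (t i : ℕ)) (by omega) (by omega) (by omega)),
      zero_mul, zero_smul]
  · exact mon_mul_mon_of_not_disjoint _ _ hd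

theorem mul_mem_bd {f g : Alg F r n} (hf : f ∈ bd F p n t) (hg : g ∈ bd F p n t) :
    f * g ∈ bd F p n t := by
  induction hf using Submodule.span_induction with
  | zero => rw [zero_mul]; exact zero_mem _
  | add x y _ _ hx hy => rw [add_mul]; exact add_mem hx hy
  | smul a x _ hx => rw [smul_mul_assoc]; exact Submodule.smul_mem _ _ hx
  | mem x hx =>
  obtain ⟨α, u, hα, rfl⟩ := hx
  induction hg using Submodule.span_induction with
  | zero => rw [mul_zero]; exact zero_mem _
  | add x y _ _ hx hy => rw [mul_add]; exact add_mem hx hy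
  | smul a x _ hx => rw [mul_smul_comm]; exact Submodule.smul_mem _ _ hx
  | mem x hx =>
  obtain ⟨β, v, hβ, rfl⟩ := hx
  by_cases h : α + β ≤ piTop p t
  · by_cases hd : Disjoint u v
    · rw [mon_mul_mon _ _ hd]
      exact Submodule.smul_mem _ _ (mon_mem_bd h _)
    · rw [mon_mul_mon_of_not_disjoint _ _ hd]; exact zero_mem _
  · rw [mon_mul_mon_eq_zero hα hβ h]; exact zero_mem _

theorem mul_mem_fil {f g : Alg F r n} {k l : ℕ} (hf : f ∈ fil F p n t k)
    (hg : g ∈ fil F p n t l) : f * g ∈ fil F p n t (k + l) := by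
  induction hf using Submodule.span_induction with
  | zero => rw [zero_mul]; exact zero_mem _
  | add x y _ _ hx hy => rw [add_mul]; exact add_mem hx hy
  | smul a x _ hx => rw [smul_mul_assoc]; exact Submodule.smul_mem _ _ hx
  | mem x hx =>
  obtain ⟨α, u, hα, hk, rfl⟩ := hx
  induction hg using Submodule.span_induction with
  | zero => rw [mul_zero]; exact zero_mem _
  | add x y _ _ hx hy => rw [mul_add]; exact add_mem hx hy
  | smul a x _ hx => rw [mul_smul_comm]; exact Submodule.smul_mem _ _ hx
  | mem x hx =>
  obtain ⟨β, v, hβ, hl, rfl⟩ := hx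
  by_cases h : α + β ≤ piTop p t
  · by_cases hd : Disjoint u v
    · rw [mon_mul_mon _ _ hd]
      refine Submodule.smul_mem _ _ (mon_mem_fil h ?_)
      rw [Finset.card_union_of_disjoint hd]
      simp only [Pi.add_apply, Finset.sum_add_distrib]
      omega
    · rw [mon_mul_mon_of_not_disjoint _ _ hd]; exact zero_mem _
  · rw [mon_mul_mon_eq_zero hα hβ h]; exact zero_mem _

theorem DH_apply_mem_bd {f g : Alg F r n} (hs : sgn f = f) (hf : f ∈ bd F p n t)
    (hg : g ∈ bd F p n t) : DH F f g ∈ bd F p n t := by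
  rw [DH_apply_of_even hs]
  exact Submodule.sum_mem _ fun j _ =>
    Submodule.smul_mem _ _ (mul_mem_bd (pd_mem_bd hf _) (pd_mem_bd hg _))

end Filtration

/-! ### Odd-valued derivations and the mixed cubics -/

section OddDerivations

variable {F : Type*} [Field F] (p : ℕ) {r n : ℕ} (t : Fin (2 * r) → ℕ+)

/-- `f ↦ ψ(f)` is, on the even elements of the truncated algebra, of the form `f ↦ φ(D_H(f))` for
a derivation `φ` with values in the odd vector fields. -/
structure OddDer (ψ : Alg F r n →ₗ[F] Module.End F (Alg F r n)) : Prop where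
  field : ∀ f, ψ f = vf fun j => ψ f (var F j)
  odd : ∀ f j, sgn (ψ f (var F j)) = -((-1 : F) ^ par j • ψ f (var F j))
  der : ∀ f g, f ∈ bd F p n t → g ∈ bd F p n t → sgn f = f → sgn g = g →
    ψ (DH F f g) = ad (ψ f) (DH F g) + ad (DH F f) (ψ g)

/-- `ψ` vanishes on the even elements of degree at most `k`. -/
def Kills (ψ : Alg F r n →ₗ[F] Module.End F (Alg F r n)) (k : ℕ) : Prop :=
  ∀ f ∈ fil F p n t k, sgn f = f → ψ f = 0

variable {p t} {ψ : Alg F r n →ₗ[F] Module.End F (Alg F r n)}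

theorem Kills.mono {k l : ℕ} (h : Kills p t ψ l) (hkl : k ≤ l) : Kills p t ψ k :=
  fun f hf => h f (fil_mono hkl hf)

/-- An even f is half of f + sgn f, and this symmetrization sends each spanning monomial to twice an
even monomial or to zero. -/
theorem kills_of_mon [NeZero (2 : F)] {k : ℕ}
    (h : ∀ (α : Fin (2 * r) → ℕ) (u : Finset (Fin n)), α ≤ piTop p t → Even u.card →
      (∑ i, α i) + u.card ≤ k → ψ (mon F α u) = 0) : Kills p t ψ k := by
  intro f hf hs
  have h1 : ψ (f + sgn f) = 0 := by
    clear hs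
    induction hf using Submodule.span_induction with
    | zero => simp
    | add x y _ _ hx hy =>
      have : x + y + sgn (x + y) = (x + sgn x) + (y + sgn y) := by rw [map_add]; abel
      rw [this, map_add, hx, hy, add_zero]
    | smul a x _ hx => rw [map_smul, ← smul_add, map_smul, hx, smul_zero]
    | mem x hx =>
      obtain ⟨α, u, hα, hk, rfl⟩ := hx
      rcases Nat.even_or_odd u.card with hu | hu
      · rw [sgn_mon_of_even hu, map_add, h α u hα hu hk, add_zero]
      · rw [sgn_mon_of_odd hu, add_neg_cancel, map_zero]
  rw [hs, ← two_smul F, map_smul] at h1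
  exact (smul_eq_zero.1 h1).resolve_left two_ne_zero

theorem Kills.mon {k : ℕ} (h : Kills p t ψ k) {α : Fin (2 * r) → ℕ} {u : Finset (Fin n)}
    (hα : α ≤ piTop p t) (hu : Even u.card) (hk : (∑ i, α i) + u.card ≤ k) :
    ψ (mon F α u) = 0 := h _ (mon_mem_fil hα hk) (sgn_mon_of_even hu α)

theorem var_mul_var_mem_fil [Fact p.Prime] [CharP F p] (i j : Idx r n) :
    var F i * var F j ∈ fil F p n t 2 := by
  have h := mul_mem_fil (var_mem_fil (F := F) (p := p) (t := t) i) (var_mem_fil (t := t) j)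
  rwa [one_add_one_eq_two] at h

theorem mixed_cubic_mem_fil [Fact p.Prime] [CharP F p] (i : Fin (2 * r)) (k l : Fin n) :
    var F (.inl i) * (var F (.inr k) * var F (.inr l)) ∈ fil F p n t 3 := by
  have h := mul_mem_fil (var_mem_fil (F := F) (p := p) (t := t) (.inl i))
    (var_mul_var_mem_fil (.inr k) (.inr l))
  rwa [show 1 + 2 = 3 from rfl] at h

theorem sgn_mixed_cubic (i : Fin (2 * r)) (k l : Fin n) :
    sgn (var F (.inl i) * (var F (.inr k) * var F (.inr l)) : Alg F r n) =
      var F (.inl i) * (var F (.inr k) * var F (.inr l)) :=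
  sgn_mul_of_even (sgn_var_inl i) (sgn_var_mul_var k l)

theorem pd_inl_mixed_cubic (a i : Fin (2 * r)) (k l : Fin n) :
    pd F (.inl a : Idx r n) (var F (.inl i) * (var F (.inr k) * var F (.inr l))) =
      if a = i then var F (.inr k) * var F (.inr l) else 0 := by
  rw [pd_inl_mul, pd_inl_mul, pd_var', pd_var', pd_var']
  split_ifs <;> simp_all

namespace OddDer

variable (H : OddDer p t ψ)
include H

theorem map_DH_of_left {f g : Alg F r n} (hf : f ∈ bd F p n t) (hg : g ∈ bd F p n t)
    (hsf : sgn f = f) (hsg : sgn g = g) (h : ψ f = 0) :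
    ψ (DH F f g) = ad (DH F f) (ψ g) := by
  rw [H.der f g hf hg hsf hsg, h, ad_apply]; simp

theorem map_DH_apply_of_left {f g : Alg F r n} (hf : f ∈ bd F p n t) (hg : g ∈ bd F p n t)
    (hsf : sgn f = f) (hsg : sgn g = g) (h : ψ f = 0) (x : Alg F r n) :
    ψ (DH F f g) x = DH F f (ψ g x) - ψ g (DH F f x) := by
  rw [H.map_DH_of_left hf hg hsf hsg h]; rfl

theorem map_DH_eq_zero {f g : Alg F r n} (hf : f ∈ bd F p n t) (hg : g ∈ bd F p n t)
    (hsf : sgn f = f) (hsg : sgn g = g) (h : ψ f = 0) (h' : ψ g = 0) :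
    ψ (DH F f g) = 0 := by
  rw [H.map_DH_of_left hf hg hsf hsg h, h', map_zero]

theorem apply_one (f : Alg F r n) : ψ f 1 = 0 := by rw [H.field, vf_one]

theorem eq_zero_of_var {f : Alg F r n} (h : ∀ j, ψ f (var F j) = 0) : ψ f = 0 := by
  rw [H.field]
  refine LinearMap.ext fun x => ?_
  simp [vf_apply, h]

theorem odd_inl (f : Alg F r n) (i : Fin (2 * r)) :
    sgn (ψ f (var F (.inl i))) = -ψ f (var F (.inl i)) := by
  rw [H.odd]; simp [par]

theorem odd_inr (f : Alg F r n) (k : Fin n) :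
    sgn (ψ f (var F (.inr k))) = ψ f (var F (.inr k)) := by
  rw [H.odd]; simp [par]

variable [Fact p.Prime]

/-- Up to a scalar, ∂_i is bracketing with the killed variable x_{i'}. So [∂_i, ψ(f)] is a multiple
of ψ(∂_i f) = 0, and the coefficients of ψ(f) do not involve x_i. -/
theorem pd_apply_var (h2 : Kills p t ψ 2) {f : Alg F r n} (hf : f ∈ bd F p n t)
    (hs : sgn f = f) {i : Fin (2 * r)} (h : ψ (pd F (.inl i : Idx r n) f) = 0) (j : Idx r n) :
    pd F (.inl i : Idx r n) (ψ f (var F j)) = 0 := by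
  have hv : var F (.inl (evenConj i)) ∈ fil F p n t 1 := var_mem_fil _
  have h1 := H.map_DH_apply_of_left (fil_le_bd _ hv) hf (sgn_var_inl _) hs
    (h2 _ (fil_mono (by omega) hv) (sgn_var_inl _)) (var F j)
  rw [DH_var_inl, DH_var_inl, DH_var_inl, evenConj_evenConj, pd_var', map_smul, h, smul_zero,
    LinearMap.zero_apply, map_smul, eq_comm, ← smul_sub, smul_eq_zero,
    or_iff_right (tau_inl_ne_zero _)] at h1
  rw [sub_eq_zero] at h1
  rw [h1]
  split_ifs
  · exact H.apply_one f
  · simp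

variable [CharP F p]

theorem pd_map_mixed_cubic (h2 : Kills p t ψ 2) (a i : Fin (2 * r)) (k l : Fin n) (j : Idx r n) :
    pd F (.inl a : Idx r n)
      (ψ (var F (.inl i) * (var F (.inr k) * var F (.inr l))) (var F j)) = 0 := by
  refine H.pd_apply_var h2 (fil_le_bd _ (mixed_cubic_mem_fil i k l)) (sgn_mixed_cubic i k l) ?_ j
  rw [pd_inl_mixed_cubic]
  split_ifs
  · exact h2 _ (var_mul_var_mem_fil _ _) (sgn_var_mul_var k l)
  · exact map_zero _

variable [NeZero (2 : F)]

/-- The coefficients are constant in the even variables, so under the torus element x_i x_{i'} the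
weight is carried by ∂_j alone, and only ∂_{i'} has the weight of x_i. The prime 2 enters in
excluding ∂_i, which has the opposite weight. -/
theorem map_mixed_cubic_var (h2 : Kills p t ψ 2) (i : Fin (2 * r)) (k l : Fin n) {j : Idx r n}
    (hj : j ≠ .inl (evenConj i)) :
    ψ (var F (.inl i) * (var F (.inr k) * var F (.inr l))) (var F j) = 0 := by
  have hq : (var F (.inl i) * var F (.inl (evenConj i)) : Alg F r n) ∈ fil F p n t 2 :=
    var_mul_var_mem_fil _ _
  have hsq := sgn_mul_of_even (sgn_var_inl (F := F) (n := n) i) (sgn_var_inl (evenConj i))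
  have hf := mixed_cubic_mem_fil (F := F) (p := p) (t := t) i k l
  have h1 := H.map_DH_apply_of_left (fil_le_bd _ hq) (fil_le_bd _ hf) hsq
    (sgn_mixed_cubic i k l) (h2 _ hq hsq) (var F j)
  simp only [DH_even_pair, evenConj_evenConj, pd_inl_mixed_cubic, if_neg (evenConj_ne i),
    if_true, H.pd_map_mixed_cubic h2, mul_zero, smul_zero, add_zero, map_smul, map_add, zero_sub,
    tau_evenConj, LinearMap.smul_apply, pd_var'] at h1
  rcases j with j | j
  · simp only [Sum.inl.injEq] at h1
    have hj' : evenConj i ≠ j := fun h => hj (by rw [h])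
    by_cases hij : i = j
    · subst hij
      rw [if_pos rfl, if_neg hj', mul_one, mul_zero, map_zero, smul_zero, add_zero, neg_smul,
        neg_neg, neg_eq_iff_add_eq_zero, ← two_smul F, smul_smul, smul_eq_zero] at h1
      exact h1.resolve_left (mul_ne_zero two_ne_zero (tau_inl_ne_zero _))
    · simpa [if_neg hij, if_neg hj', tau_inl_ne_zero] using h1
  · simpa [tau_inl_ne_zero] using h1

theorem map_mixed_cubic_apply (h2 : Kills p t ψ 2) (i : Fin (2 * r)) (k l : Fin n)
    (x : Alg F r n) :
    ψ (var F (.inl i) * (var F (.inr k) * var F (.inr l))) x =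
      ψ (var F (.inl i) * (var F (.inr k) * var F (.inr l))) (var F (.inl (evenConj i))) *
        pd F (.inl (evenConj i) : Idx r n) x := by
  conv_lhs => rw [H.field, vf_apply]
  refine Finset.sum_eq_single _ (fun j _ hj => ?_) (by simp)
  rw [H.map_mixed_cubic_var h2 i k l hj, zero_mul]

/-- The killed quadratic x_{i'}² carries x_i to a multiple of x_{i'}, so the images for i and i'
share one coefficient up to sign. -/
theorem map_mixed_cubic_conj_apply (h2 : Kills p t ψ 2) (i : Fin (2 * r)) (k l : Fin n)
    (x : Alg F r n) :
    ψ (var F (.inl (evenConj i)) * (var F (.inr k) * var F (.inr l))) x =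
      - (ψ (var F (.inl i) * (var F (.inr k) * var F (.inr l))) (var F (.inl (evenConj i))) *
        pd F (.inl i : Idx r n) x) := by
  have hq : (var F (.inl (evenConj i)) * var F (.inl (evenConj i)) : Alg F r n) ∈
      fil F p n t 2 := var_mul_var_mem_fil _ _
  have hsq := sgn_mul_of_even (sgn_var_inl (F := F) (n := n) (evenConj i))
    (sgn_var_inl (evenConj i))
  have hf := mixed_cubic_mem_fil (F := F) (p := p) (t := t) i k l
  have h1 := H.map_DH_apply_of_left (fil_le_bd _ hq) (fil_le_bd _ hf) hsq
    (sgn_mixed_cubic i k l) (h2 _ hq hsq) (var F (.inl i))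
  simp only [DH_even_pair, evenConj_evenConj, pd_inl_mixed_cubic, if_true, pd_var', mul_one,
    H.pd_map_mixed_cubic h2, mul_zero, smul_zero, add_zero, zero_sub, ← add_smul, map_smul,
    LinearMap.smul_apply] at h1
  rw [← smul_neg] at h1
  have h3 : tau F (.inl (evenConj i) : Idx r n) + tau F (.inl (evenConj i) : Idx r n) ≠ 0 := by
    rw [← two_mul]
    exact mul_ne_zero two_ne_zero (tau_inl_ne_zero _)
  have h4 := H.map_mixed_cubic_apply h2 (evenConj i) k l x
  rw [evenConj_evenConj, smul_right_injective _ h3 h1, neg_mul] at h4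
  exact h4

/-- The cubics x_i x_k x_l and x_{i'} x_k x_l Poisson-commute; applying ψ to this relation
constrains their common coefficient. -/
theorem map_mixed_cubic_mul_var (h2 : Kills p t ψ 2) (i : Fin (2 * r)) {k l : Fin n}
    (hkl : k ≠ l) :
    var F (.inr l) *
      ψ (var F (.inl i) * (var F (.inr k) * var F (.inr l))) (var F (.inl (evenConj i))) = 0 := by
  have hf := mixed_cubic_mem_fil (F := F) (p := p) (t := t) i k l
  have hg := mixed_cubic_mem_fil (F := F) (p := p) (t := t) (evenConj i) k l
  have hD : DH F (var F (.inl i) * (var F (.inr k) * var F (.inr l)))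
      (var F (.inl (evenConj i)) * (var F (.inr k) * var F (.inr l)) : Alg F r n) = 0 := by
    have h1 : DH F (var F (.inr k) * var F (.inr l)) (var F (.inr k) * var F (.inr l)) =
        (0 : Alg F r n) := by
      have := DH_apply_swap (sgn_var_mul_var (F := F) (r := r) k l) (sgn_var_mul_var k l)
      rw [eq_neg_iff_add_eq_zero, ← two_smul F] at this
      exact (smul_eq_zero.1 this).resolve_left two_ne_zero
    have h3 : DH F (var F (.inr k) * var F (.inr l)) (var F (.inl (evenConj i))) =
        (0 : Alg F r n) := by
      rw [DH_var_mul_var, pd_var', pd_var']; simp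
    have h4 : (var F (.inr k) * var F (.inr l)) * (var F (.inr k) * var F (.inr l)) =
        (0 : Alg F r n) := by
      rw [mul_comm_of_even (sgn_var_mul_var k l), mul_assoc, ← mul_assoc (var F (.inr l)),
        var_mul_var_swap l k, neg_mul, mul_assoc, var_mul_self]
      simp
    rw [DH_mixed_cubic, DH_mul (sgn_var_mul_var k l), h1, h3, pd_inl_mixed_cubic, if_pos rfl, h4]
    simp
  have h1 := H.der _ _ (fil_le_bd _ hf) (fil_le_bd _ hg) (sgn_mixed_cubic i k l)
    (sgn_mixed_cubic _ k l)
  have hD' : ∀ (a : Fin (2 * r)) (b : Fin n),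
      DH F (var F (.inl a) * (var F (.inr k) * var F (.inr l))) (var F (.inr b) : Alg F r n) =
      var F (.inl a) * DH F (var F (.inr k) * var F (.inr l)) (var F (.inr b)) := by
    intro a b
    rw [DH_mixed_cubic, pd_var']; simp
  have hpd : ∀ (a : Fin (2 * r)) (b : Fin n), pd F (.inl a : Idx r n)
      (var F (.inl a) * DH F (var F (.inr k) * var F (.inr l)) (var F (.inr b))) =
      DH F (var F (.inr k) * var F (.inr l)) (var F (.inr b)) := by
    intro a b
    rw [pd_inl_mul, pd_var', DH_odd_pair_var, map_sub]
    simp only [apply_ite (pd F (.inl a : Idx r n)), pd_var']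
    simp
  rw [hD, map_zero] at h1
  -- At x_{k'} the two Hamiltonian fields take the values x_i x_l and x_{i'} x_l. With c the common
  -- coefficient, both surviving terms equal c x_l, so 2 c x_l = 0.
  have h5 := LinearMap.congr_fun h1 (var F (.inr (oddConj k)))
  simp only [ad_apply, LinearMap.add_apply, LinearMap.sub_apply, Module.End.mul_apply, hD',
    LinearMap.zero_apply] at h5
  rw [H.map_mixed_cubic_apply h2 i k l (var F (.inl (evenConj i)) * _),
    H.map_mixed_cubic_conj_apply h2 i k l (var F (.inl i) * _), hpd, hpd,
    H.map_mixed_cubic_var h2 i k l (j := .inr (oddConj k)) (by simp),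
    H.map_mixed_cubic_var h2 (evenConj i) k l (j := .inr (oddConj k)) (by simp),
    map_zero, map_zero, sub_zero, zero_sub, neg_neg, ← two_smul F, eq_comm, smul_eq_zero,
    or_iff_right two_ne_zero, DH_odd_pair_var, if_pos rfl,
    if_neg (fun h => hkl (oddConj_involutive.injective h).symm), sub_zero,
    mul_comm_of_odd (H.odd_inl _ _), sgn_var_inr, neg_mul, neg_eq_zero] at h5
  exact h5

/-- A parity contradiction: a monomial x^v in the coefficient would contain x_last by
`map_mixed_cubic_mul_var`, and its so(n)-weight, that of x_k, makes v the union of {k, last} and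
conjugate pairs. Then |v| is even, but the coefficient is odd. -/
theorem map_mixed_cubic_last (h2 : Kills p t ψ 2) (hn : Odd n) (i : Fin (2 * r)) {k : Fin n}
    (hk : k ≠ last hn) :
    ψ (var F (.inl i) * (var F (.inr k) * var F (.inr (last hn)))) = 0 := by
  have hf := mixed_cubic_mem_fil (F := F) (p := p) (t := t) i k (last hn)
  have hsf := sgn_mixed_cubic (F := F) (r := r) i k (last hn)
  set f := (var F (.inl i) * (var F (.inr k) * var F (.inr (last hn))) : Alg F r n) with hfdef
  suffices hs : ψ f (var F (.inl (evenConj i))) = 0 by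
    refine H.eq_zero_of_var fun j => ?_
    by_cases hj : j = .inl (evenConj i)
    · rw [hj, hs]
    · exact H.map_mixed_cubic_var h2 i k (last hn) hj
  refine eq_zero_of_cf fun β v => ?_
  by_contra hv
  have hlv : last hn ∈ v := by
    by_contra h
    exact hv (cf_eq_zero_of_var_mul (H.map_mixed_cubic_mul_var h2 i hk) β h)
  -- Comparison of the weights of x^v and of the cubic under the torus element x_j x_{j'}.
  have hw : ∀ j, j ≠ last hn →
      ((if oddConj j ∈ v then 1 else 0) - (if j ∈ v then 1 else 0) : F) =
      (if oddConj j = k then 1 else 0) - (if j = k then 1 else 0) := by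
    intro j hj
    have hq : (var F (.inr j) * var F (.inr (oddConj j)) : Alg F r n) ∈ fil F p n t 2 :=
      var_mul_var_mem_fil _ _
    have h1 := H.map_DH_apply_of_left (fil_le_bd _ hq) (fil_le_bd _ hf)
      (sgn_var_mul_var j (oddConj j)) hsf (h2 _ hq (sgn_var_mul_var _ _))
      (var F (.inl (evenConj i)))
    have h3 : ∀ a : Fin (2 * r), DH F (var F (.inr j) * var F (.inr (oddConj j)))
        (var F (.inl a) : Alg F r n) = 0 := by
      intro a
      rw [DH_var_mul_var, pd_var', pd_var']; simp
    have h4 : DH F (var F (.inr j) * var F (.inr (oddConj j))) f =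
        ((if oddConj j = k then 1 else 0) - (if j = k then 1 else 0) : F) • f := by
      rw [hfdef, DH_mul (sgn_var_mul_var _ _), DH_mul (sgn_var_mul_var _ _), h3,
        DH_odd_pair_var, DH_odd_pair_var, oddConj_oddConj, if_neg (oddConj_ne_last hn hj),
        if_neg hj, sub_zero, mul_zero, add_zero, zero_mul, zero_add, sub_smul, sub_mul, mul_sub]
      congr 1
      · split_ifs with h <;> simp [h]
      · split_ifs with h <;> simp [h]
    rw [h4, h3, map_zero, sub_zero, map_smul, LinearMap.smul_apply] at h1
    have h5 := congrArg (cf (β, v)) h1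
    rw [cf_DH_torus, map_smul, smul_eq_mul] at h5
    exact (mul_right_cancel₀ hv h5).symm
  have hkv : k ∈ v := by
    by_contra h
    have h1 := hw k hk
    have h3 : oddConj k ≠ k := fun h => hk ((oddConj_eq_self_iff hn k).1 h)
    rw [if_neg h, if_neg h3, if_pos rfl] at h1
    split_ifs at h1
    · apply two_ne_zero (α := F); linear_combination h1
    · simp at h1
  have hwc : Even ((v.erase (last hn)).erase k).card := by
    refine even_card_of_conj_mem hn (fun j hj => ?_) (by simp)
    simp only [Finset.mem_erase] at hj ⊢
    obtain ⟨hjk, hjl, hjv⟩ := hj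
    have h1 := hw j hjl
    rw [if_pos hjv, if_neg hjk, sub_zero] at h1
    have h3 : oddConj j ≠ k := by
      intro h
      rw [if_pos h] at h1
      split_ifs at h1
      · simp at h1
      · apply two_ne_zero (α := F); linear_combination -h1
    rw [if_neg h3] at h1
    refine ⟨h3, oddConj_ne_last hn hjl, ?_⟩
    by_contra h
    rw [if_neg h] at h1
    simp at h1
  have ho := odd_card_of_cf_ne (H.odd_inl f _) hv
  rw [← Finset.insert_erase hlv, Finset.card_insert_of_notMem (by simp),
    ← Finset.insert_erase (a := k) (s := v.erase (last hn)) (by simp [hk, hkv]),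
    Finset.card_insert_of_notMem (by simp)] at ho
  rw [Nat.odd_add_one, Nat.odd_add_one] at ho
  exact absurd hwc (by simpa using ho)

/-- The rotation x_k x_last of so(n) carries x_i x_last x_l to -x_i x_k x_l. -/
theorem map_mixed_cubic (h2 : Kills p t ψ 2) (hn : Odd n) (i : Fin (2 * r)) (k l : Fin n) :
    ψ (var F (.inl i) * (var F (.inr k) * var F (.inr l))) = 0 := by
  by_cases hk : k = last hn
  · by_cases hl : l = last hn
    · rw [hk, hl, var_mul_self, mul_zero, map_zero]
    · rw [hk, var_mul_var_swap, mul_neg, map_neg, H.map_mixed_cubic_last h2 hn i hl, neg_zero]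
  by_cases hl : l = last hn
  · rw [hl, H.map_mixed_cubic_last h2 hn i hk]
  have hq : (var F (.inr k) * var F (.inr (last hn)) : Alg F r n) ∈ fil F p n t 2 :=
    var_mul_var_mem_fil _ _
  have hf := mixed_cubic_mem_fil (F := F) (p := p) (t := t) i (last hn) l
  have h1 := H.map_DH_eq_zero (fil_le_bd _ hq) (fil_le_bd _ hf) (sgn_var_mul_var _ _)
    (sgn_mixed_cubic i _ l) (h2 _ hq (sgn_var_mul_var _ _))
    (by rw [var_mul_var_swap, mul_neg, map_neg, H.map_mixed_cubic_last h2 hn i hl, neg_zero])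
  have h3 : DH F (var F (.inr k) * var F (.inr (last hn)))
      (var F (.inl i) * (var F (.inr (last hn)) * var F (.inr l)) : Alg F r n) =
      -(var F (.inl i) * (var F (.inr k) * var F (.inr l))) := by
    have h4 : DH F (var F (.inr k) * var F (.inr (last hn))) (var F (.inl i) : Alg F r n) = 0 := by
      rw [DH_var_mul_var, pd_var', pd_var']; simp
    rw [DH_mul (sgn_var_mul_var _ _), h4, zero_mul, zero_add, DH_var_mul_var, oddConj_last,
      pd_var_mul, pd_var_mul, pd_var', pd_var', if_neg (oddConj_ne_last hn hk), if_pos rfl,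
      zero_sub, mul_neg, ← mul_assoc, var_mul_self]
    simp [Ne.symm hl]
  rw [h3, map_neg, neg_eq_zero] at h1
  exact h1

end OddDer

end OddDerivations

/-! ### Induction step for monomials containing odd variables -/

section OddDegree

variable {F : Type*} [Field F] {p r n : ℕ} {t : Fin (2 * r) → ℕ+}
  {ψ : Alg F r n →ₗ[F] Module.End F (Alg F r n)}

theorem exists_var_mul_pd_mon (k l : Fin n) (β : Fin (2 * r) → ℕ) (v : Finset (Fin n)) :
    ∃ (c : F) (w : Finset (Fin n)), w.card = v.card ∧
      var F (.inr l) * pd F (.inr k : Idx r n) (mon F β v) = c • mon F β w := by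
  rw [pd_inr_mon]
  by_cases hk : k ∈ v
  · rw [if_pos hk, mul_smul_comm]
    by_cases hl : l ∈ v.erase k
    · exact ⟨0, v, rfl, by rw [var_mul_mon_of_mem hl]; simp⟩
    · refine ⟨_, insert l (v.erase k), ?_, by rw [var_mul_mon hl, smul_smul]⟩
      rw [Finset.card_insert_of_notMem hl, Finset.card_erase_add_one hk]
  · exact ⟨0, v, rfl, by rw [if_neg hk]; simp⟩

namespace OddDer

variable (H : OddDer p t ψ) [Fact p.Prime] [CharP F p]
include H

/-- As |u| is even and n is odd, some index a is missing from u. A rotation in so(n) replaces x_a by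
x_last, so x^u comes from a set of the same size avoiding the last index. -/
theorem map_mon_of_last_mem (hn : Odd n) (h2 : Kills p t ψ 2)
    {α : Fin (2 * r) → ℕ} {u : Finset (Fin n)} (hα : α ≤ piTop p t) (hu : Even u.card)
    (hl : last hn ∈ u)
    (h : ∀ w : Finset (Fin n), last hn ∉ w → w.card = u.card → ψ (mon F α w) = 0) :
    ψ (mon F α u) = 0 := by
  have hc : (u.erase (last hn)).card + 1 = u.card := Finset.card_erase_add_one hl
  obtain ⟨a, hal, hau⟩ : ∃ a, a ≠ last hn ∧ a ∉ u := by
    by_contra hcon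
    push Not at hcon
    have : u = Finset.univ := by
      refine Finset.eq_univ_iff_forall.2 fun a => ?_
      by_cases ha : a = last hn
      · rw [ha]; exact hl
      · exact hcon a ha
    rw [this, Finset.card_univ, Fintype.card_fin] at hu
    exact Nat.not_even_iff_odd.2 hn hu
  have haw : a ∉ u.erase (last hn) := fun h => hau (Finset.mem_of_mem_erase h)
  have hq : (var F (.inr (oddConj a)) * var F (.inr (last hn)) : Alg F r n) ∈ fil F p n t 2 :=
    var_mul_var_mem_fil _ _
  have hcw : (insert a (u.erase (last hn))).card = u.card := by
    rw [Finset.card_insert_of_notMem haw, hc]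
  have h1 := H.map_DH_eq_zero (fil_le_bd _ hq) (mon_mem_bd hα (insert a (u.erase (last hn))))
    (sgn_var_mul_var _ _) (sgn_mon_of_even (by rwa [hcw]) _) (h2 _ hq (sgn_var_mul_var _ _))
    (h _ (by simp [Ne.symm hal]) hcw)
  have hpl : pd F (.inr (last hn) : Idx r n) (mon F α (insert a (u.erase (last hn)))) = 0 := by
    rw [pd_inr_mon, if_neg (by simp [Ne.symm hal])]
  have hpa : pd F (.inr a : Idx r n) (mon F α (u.erase (last hn))) = 0 := by
    rw [pd_inr_mon, if_neg haw]
  rw [DH_var_mul_var, oddConj_oddConj, oddConj_last, hpl, mul_zero, sub_zero, mon_insert haw,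
    map_smul, pd_var_mul, if_pos rfl, hpa, mul_zero, sub_zero, mul_smul_comm,
    var_mul_mon (by simp), Finset.insert_erase hl, map_smul, map_smul, smul_eq_zero,
    smul_eq_zero] at h1
  exact (h1.resolve_left (by simp)).resolve_left (by simp)

variable [NeZero (2 : F)]

/-- The bracket of x_i x_a x_last with x_last x^(α - ε_i) x^(u ∖ a) is the monomial up to sign and
the factor α_i: the self-conjugate variable x_last is contracted with itself, and all other terms
contain its square. -/
theorem map_mon_of_last_notMem (hn : Odd n) {k : ℕ} (hk : Kills p t ψ k) (h3 : 3 ≤ k)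
    {α : Fin (2 * r) → ℕ} {u : Finset (Fin n)} (hα : α ≤ piTop p t) (hu : Even u.card)
    (hne : u.Nonempty) (hl : last hn ∉ u) (hd : (∑ i, α i) + u.card ≤ k + 1)
    {i : Fin (2 * r)} (hi : (α i : F) ≠ 0) : ψ (mon F α u) = 0 := by
  obtain ⟨a, ha⟩ := hne
  obtain ⟨γ, rfl⟩ := exists_eq_add_single (i := i) (β := α) (by rintro h; simp [h] at hi)
  have hγ : γ ≤ piTop p t := le_trans (by simp) hα
  have hal : a ≠ last hn := by rintro rfl; exact hl ha
  have hc : (u.erase a).card + 1 = u.card := Finset.card_erase_add_one ha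
  have ho : Odd (u.erase a).card := by
    rw [← hc, Nat.even_add_one, Nat.not_even_iff_odd] at hu; exact hu
  have hsum : ∑ l, (γ + Pi.single i 1 : Fin (2 * r) → ℕ) l = (∑ l, γ l) + 1 := by
    simp [Finset.sum_add_distrib]
  have hg : var F (.inr (last hn)) * mon F γ (u.erase a) ∈ fil F p n t k :=
    fil_mono (by omega) (mul_mem_fil (var_mem_fil _) (mon_mem_fil hγ le_rfl))
  have hsg : sgn (var F (.inr (last hn)) * mon F γ (u.erase a)) =
      var F (.inr (last hn)) * mon F γ (u.erase a) := by
    rw [sgn_mul, sgn_var_inr, sgn_mon_of_odd ho, neg_mul_neg]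
  have h1 := H.map_DH_eq_zero (fil_le_bd _ (mixed_cubic_mem_fil i a (last hn)))
    (fil_le_bd _ hg) (sgn_mixed_cubic i a _) hsg
    (hk _ (fil_mono h3 (mixed_cubic_mem_fil i a _)) (sgn_mixed_cubic i a _)) (hk _ hg hsg)
  have hpl : pd F (.inr (last hn) : Idx r n) (mon F γ (u.erase a)) = 0 := by
    rw [pd_inr_mon, if_neg (fun h => hl (Finset.mem_of_mem_erase h))]
  have hD : DH F (var F (.inl i) * (var F (.inr a) * var F (.inr (last hn))))
      (var F (.inr (last hn)) * mon F γ (u.erase a)) =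
      -(var F (.inl i) * (var F (.inr a) * mon F γ (u.erase a))) := by
    rw [DH_mixed_cubic, DH_var_mul_var, oddConj_last, pd_var_mul, pd_var_mul, hpl, if_pos rfl,
      if_neg (oddConj_ne_last hn hal), mul_zero, sub_zero, zero_sub, mul_neg, ← mul_assoc
      (var F (.inr (last hn))), var_mul_self, pd_inl_mul]
    have : pd F (.inl (evenConj i) : Idx r n) (var F (.inr (last hn))) = 0 := by
      rw [pd_var']; simp
    rw [this, zero_mul, zero_mul, zero_add, mul_assoc (var F (.inr a)), ← mul_assoc (var F (.inr (last hn))),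
      var_mul_self]
    simp
  rw [hD, map_neg, neg_eq_zero, var_mul_mon (by simp), Finset.insert_erase ha, mul_smul_comm,
    var_inl_mul_mon, map_smul, map_smul, smul_eq_zero, smul_eq_zero] at h1
  refine (h1.resolve_left (by simp)).resolve_left ?_
  simpa using hi

theorem map_mon_of_cast_ne_zero (hn : Odd n) {k : ℕ} (hk : Kills p t ψ k) (h3 : 3 ≤ k)
    {α : Fin (2 * r) → ℕ} {u : Finset (Fin n)} (hα : α ≤ piTop p t) (hu : Even u.card)
    (hne : u.Nonempty) (hd : (∑ i, α i) + u.card ≤ k + 1)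
    {i : Fin (2 * r)} (hi : (α i : F) ≠ 0) : ψ (mon F α u) = 0 := by
  by_cases hl : last hn ∈ u
  · refine H.map_mon_of_last_mem hn (hk.mono (by omega)) hα hu hl fun w hw hwc => ?_
    refine H.map_mon_of_last_notMem hn hk h3 hα (by rwa [hwc]) ?_ hw (by omega) hi
    rw [← Finset.card_pos, hwc]
    exact hne.card_pos
  · exact H.map_mon_of_last_notMem hn hk h3 hα hu hne hl hd hi

theorem map_mon_of_nonempty [NeZero r] (hn : Odd n) {k : ℕ} (hk : Kills p t ψ k) (h3 : 3 ≤ k)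
    {α : Fin (2 * r) → ℕ} {u : Finset (Fin n)} (hα : α ≤ piTop p t) (hu : Even u.card)
    (hne : u.Nonempty) (hd : (∑ i, α i) + u.card ≤ k + 1) : ψ (mon F α u) = 0 := by
  by_cases h0 : ∃ i, (α i : F) ≠ 0
  · obtain ⟨i, hi⟩ := h0
    exact H.map_mon_of_cast_ne_zero hn hk h3 hα hu hne hd hi
  push Not at h0
  let i : Fin (2 * r) := ⟨0, by have := Nat.pos_of_ne_zero (NeZero.ne r); omega⟩
  -- An exponent divisible by p cannot be π_l, which is -1 modulo p, so there is room to raise it.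
  have hlt : ∀ l, α l + 1 ≤ piTop p t l := by
    intro l
    have h1 : α l ≤ piTop p t l := hα l
    rcases h1.lt_or_eq with h | h
    · exact h
    · exfalso
      have h2 := piTop_add_one (p := p) (t := t) l
      have h4 := congrArg (Nat.cast (R := F)) h2
      rw [Nat.cast_add, ← h, h0 l] at h4
      push_cast at h4
      rw [CharP.cast_eq_zero F p, zero_pow (PNat.ne_zero _)] at h4
      simp at h4
  obtain ⟨a, ha⟩ := hne
  have hca : (u.erase a).card + 1 = u.card := Finset.card_erase_add_one ha
  obtain ⟨b, hb⟩ : (u.erase a).Nonempty := by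
    rw [← Finset.card_pos]
    by_contra h
    have : u.card = 1 := by omega
    rw [this] at hu
    exact absurd hu (by decide)
  have hcb : ((u.erase a).erase b).card + 1 = (u.erase a).card := Finset.card_erase_add_one hb
  set v := (u.erase a).erase b with hv
  have hve : Even v.card := by
    have : u.card = v.card + 2 := by omega
    rw [this] at hu
    simpa [Nat.even_add] using hu
  have hβ : α + Pi.single (evenConj i) 1 ≤ piTop p t := by
    intro l
    by_cases hl : l = evenConj i
    · rw [hl]; simpa using hlt (evenConj i)
    · simpa [hl] using hα l
  have hβ' : α + Pi.single (evenConj i) 1 + Pi.single i 1 ≤ piTop p t := by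
    intro l
    by_cases hl : l = i
    · rw [hl]; simpa [(evenConj_ne i).symm] using hlt i
    · simpa [hl] using hβ l
  have hsum : ∀ (γ : Fin (2 * r) → ℕ) j,
      ∑ l, (γ + Pi.single j 1 : Fin (2 * r) → ℕ) l = (∑ l, γ l) + 1 := fun γ j => by
    simp [Finset.sum_add_distrib]
  have hg : mon F (α + Pi.single (evenConj i) 1) v ∈ fil F p n t k :=
    mon_mem_fil hβ (by rw [hsum]; omega)
  have h1 := H.map_DH_eq_zero (fil_le_bd _ (mixed_cubic_mem_fil i a b))
    (fil_le_bd _ hg) (sgn_mixed_cubic i a b) (sgn_mon_of_even hve _)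
    (hk _ (fil_mono h3 (mixed_cubic_mem_fil i a b)) (sgn_mixed_cubic i a b))
    (hk _ hg (sgn_mon_of_even hve _))
  -- In the bracket of x_i x_a x_b with x^(α + ε_{i'}) x^v, every term other than the desired one
  -- keeps the factor x_i. Its exponent is then 1 modulo p, so the case of an exponent nonzero
  -- modulo p applies.
  have hz : ∀ k l, ψ (var F (.inl i) * (var F (.inr l) *
      pd F (.inr k : Idx r n) (mon F (α + Pi.single (evenConj i) 1) v))) = 0 := by
    intro k l
    rcases v.eq_empty_or_nonempty with hv0 | hv0
    · rw [hv0, pd_inr_mon, if_neg (by simp)]; simp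
    · obtain ⟨c, w, hw, hcw⟩ := exists_var_mul_pd_mon (F := F) k l
        (α + Pi.single (evenConj i) 1) v
      rw [hcw, mul_smul_comm, var_inl_mul_mon, map_smul, map_smul,
        H.map_mon_of_cast_ne_zero hn hk h3 hβ' (i := i)]
      · simp
      · rwa [hw]
      · rw [← Finset.card_pos, hw]; exact hv0.card_pos
      · rw [hsum, hsum]; omega
      · simp [(evenConj_ne i).symm, h0 i]
  rw [DH_mixed_cubic, DH_var_mul_var, mul_sub, map_add, map_sub, hz, hz, sub_zero, zero_add,
    pd_inl_add_single, mul_assoc, var_mul_mon (by simp [hv]), mul_smul_comm, hv,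
    Finset.insert_erase hb, var_mul_mon (by simp), Finset.insert_erase ha, map_smul, map_smul,
    map_smul, smul_eq_zero, smul_eq_zero, smul_eq_zero] at h1
  exact ((h1.resolve_left (tau_inl_ne_zero _)).resolve_left (by simp)).resolve_left (by simp)

end OddDer

end OddDegree

/-! ### Monomials in the even variables: invariance, weights, cubic brackets -/

section Pure

variable {F : Type*} [Field F] {p r n : ℕ} {t : Fin (2 * r) → ℕ+}
  {ψ : Alg F r n →ₗ[F] Module.End F (Alg F r n)}

theorem sgn_mon_empty (α : Fin (2 * r) → ℕ) :
    sgn (mon F α (∅ : Finset (Fin n))) = mon F α ∅ := sgn_mon_of_even (by simp) α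

theorem DH_var_mul_var_mon_empty (k l : Fin n) (α : Fin (2 * r) → ℕ) :
    DH F (var F (.inr k) * var F (.inr l)) (mon F α ∅) = 0 := by
  rw [DH_var_mul_var, pd_inr_mon, pd_inr_mon]; simp

theorem sum_add_single (γ : Fin (2 * r) → ℕ) (j : Fin (2 * r)) :
    ∑ l, (γ + Pi.single j 1 : Fin (2 * r) → ℕ) l = (∑ l, γ l) + 1 := by
  simp [Finset.sum_add_distrib]

theorem le_piTop_of_add_single {γ : Fin (2 * r) → ℕ} {j : Fin (2 * r)}
    (h : γ + Pi.single j 1 ≤ piTop p t) : γ ≤ piTop p t := le_trans (by simp) h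

theorem add_single_le_piTop {γ : Fin (2 * r) → ℕ} {j : Fin (2 * r)} (h : γ ≤ piTop p t)
    (hj : γ j < piTop p t j) : γ + Pi.single j 1 ≤ piTop p t := by
  intro l
  by_cases hl : l = j
  · rw [hl]; simpa using hj
  · simpa [hl] using h l

theorem triple_mem_fil [Fact p.Prime] [CharP F p] (a b c : Idx r n) :
    var F a * (var F b * var F c) ∈ fil F p n t 3 := by
  have h := mul_mem_fil (var_mem_fil (F := F) (p := p) (t := t) a)
    (var_mul_var_mem_fil b c)
  rwa [show 1 + 2 = 3 from rfl] at h

theorem sgn_even_triple (a b c : Fin (2 * r)) :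
    sgn (var F (.inl a) * (var F (.inl b) * var F (.inl c)) : Alg F r n) =
      var F (.inl a) * (var F (.inl b) * var F (.inl c)) :=
  sgn_mul_of_even (sgn_var_inl a) (sgn_mul_of_even (sgn_var_inl b) (sgn_var_inl c))

theorem DH_even_triple [NeZero (2 : F)] (a b c : Fin (2 * r)) (h : Alg F r n) :
    DH F (var F (.inl a) * (var F (.inl b) * var F (.inl c))) h =
      tau F (.inl c : Idx r n) • (var F (.inl a) * (var F (.inl b) *
        pd F (.inl (evenConj c) : Idx r n) h)) +
      tau F (.inl b : Idx r n) • (var F (.inl a) * (var F (.inl c) *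
        pd F (.inl (evenConj b) : Idx r n) h)) +
      tau F (.inl a : Idx r n) • (var F (.inl b) * (var F (.inl c) *
        pd F (.inl (evenConj a) : Idx r n) h)) := by
  rw [DH_mul_of_even (sgn_var_inl a) (sgn_mul_of_even (sgn_var_inl b) (sgn_var_inl c)),
    DH_even_pair, DH_var_inl, mul_add, mul_smul_comm, mul_smul_comm, mul_smul_comm, mul_assoc]

theorem var_inl_mul_comm [NeZero (2 : F)] (a : Fin (2 * r)) (f : Alg F r n) :
    var F (.inl a) * f = f * var F (.inl a) := mul_comm_of_even (sgn_var_inl a) f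

namespace OddDer

variable (H : OddDer p t ψ) [Fact p.Prime]
include H

theorem pd_map_pure {k : ℕ} (hk : Kills p t ψ k) (h2 : 2 ≤ k) {α : Fin (2 * r) → ℕ}
    (hα : α ≤ piTop p t) (hd : ∑ i, α i ≤ k + 1) (i : Fin (2 * r)) (j : Idx r n) :
    pd F (.inl i : Idx r n) (ψ (mon F α ∅) (var F j)) = 0 := by
  refine H.pd_apply_var (hk.mono h2) (mon_mem_bd hα _) (sgn_mon_empty α) ?_ j
  by_cases hi : α i = 0
  · rw [pd_inl_of_eq_zero hi, map_zero]
  · obtain ⟨γ, rfl⟩ := exists_eq_add_single hi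
    rw [sum_add_single] at hd
    rw [pd_inl_add_single]
    exact hk.mon (le_piTop_of_add_single hα) (by simp) (by simpa using hd)

variable [CharP F p] 

/-- The quadratic x_k x_l is killed and Poisson-commutes with x^(α), so their fields' derivation
identity reduces to invariance of the image. -/
theorem so_map_pure (h2 : Kills p t ψ 2) {α : Fin (2 * r) → ℕ} (hα : α ≤ piTop p t)
    (k l : Fin n) (x : Alg F r n) :
    DH F (var F (.inr k) * var F (.inr l)) (ψ (mon F α ∅) x) =
      ψ (mon F α ∅) (DH F (var F (.inr k) * var F (.inr l)) x) := by
  have hq : (var F (.inr k) * var F (.inr l) : Alg F r n) ∈ fil F p n t 2 :=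
    var_mul_var_mem_fil _ _
  have h1 := H.map_DH_apply_of_left (fil_le_bd _ hq) (mon_mem_bd hα ∅) (sgn_var_mul_var k l)
    (sgn_mon_empty α) (h2 _ hq (sgn_var_mul_var k l)) x
  rw [DH_var_mul_var_mon_empty, map_zero, LinearMap.zero_apply, eq_comm, sub_eq_zero] at h1
  exact h1

variable [NeZero (2 : F)]

theorem map_pure_var_inl (hn : Odd n) {k : ℕ} (hk : Kills p t ψ k) (h2 : 2 ≤ k)
    {α : Fin (2 * r) → ℕ} (hα : α ≤ piTop p t) (hd : ∑ i, α i ≤ k + 1) {i : Fin (2 * r)}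
    (h : cf (0, Finset.univ) (ψ (mon F α ∅) (var F (.inl i))) = 0) :
    ψ (mon F α ∅) (var F (.inl i)) = 0 := by
  refine eq_zero_of_so_invariant_odd hn (fun a => H.pd_map_pure hk h2 hα hd a _)
    (H.odd_inl _ _) (fun a b => ?_) h
  rw [H.so_map_pure (hk.mono h2) hα, DH_var_mul_var, pd_var', pd_var']
  simp

theorem map_pure_var_inr (hn : Odd n) {k : ℕ} (hk : Kills p t ψ k) (h2 : 2 ≤ k)
    {α : Fin (2 * r) → ℕ} (hα : α ≤ piTop p t) (hd : ∑ i, α i ≤ k + 1)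
    (h : cf (0, Finset.univ.erase (last hn)) (ψ (mon F α ∅) (var F (.inr (last hn)))) = 0)
    (j : Fin n) : ψ (mon F α ∅) (var F (.inr j)) = 0 := by
  refine eq_zero_of_so_invariant_even hn (e := fun j => ψ (mon F α ∅) (var F j))
    (fun a b => H.pd_map_pure hk h2 hα hd a _) (fun b => H.odd_inr _ _) (fun a b c => ?_) h j
  rw [H.so_map_pure (hk.mono h2) hα, ← H.field]

/-- Weights with respect to the torus of `sp(2r)`. -/
theorem torus_map_pure {k : ℕ} (hk : Kills p t ψ k) (h2 : 2 ≤ k) {α : Fin (2 * r) → ℕ}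
    (hα : α ≤ piTop p t) (hd : ∑ i, α i ≤ k + 1) (i : Fin (2 * r)) (j : Idx r n) :
    ((α (evenConj i) : F) - α i) • ψ (mon F α ∅) (var F j) =
      ((if .inl i = j then 1 else 0) - (if .inl (evenConj i) = j then 1 else 0) : F) •
        ψ (mon F α ∅) (var F j) := by
  have hq : (var F (.inl i) * var F (.inl (evenConj i)) : Alg F r n) ∈ fil F p n t 2 :=
    var_mul_var_mem_fil _ _
  have hsq := sgn_mul_of_even (sgn_var_inl (F := F) (n := n) i) (sgn_var_inl (evenConj i))
  have h1 := H.map_DH_apply_of_left (fil_le_bd _ hq) (mon_mem_bd hα ∅) hsq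
    (sgn_mon_empty α) (hk.mono h2 _ hq hsq) (var F j)
  simp only [DH_even_pair, evenConj_evenConj, tau_evenConj, var_mul_pd_inl,
    H.pd_map_pure hk h2 hα hd, mul_zero, smul_zero, add_zero, zero_sub, map_smul, map_add,
    LinearMap.add_apply, LinearMap.smul_apply, pd_var'] at h1
  refine smul_right_injective _ (tau_inl_ne_zero (F := F) (n := n) i) ?_
  simp only [smul_smul]
  have h3 : ∀ a : Fin (2 * r), ψ (mon F α ∅) (var F (.inl a) * if Sum.inl a = j then 1 else 0) =
      (if Sum.inl a = j then 1 else 0 : F) • ψ (mon F α ∅) (var F j) := by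
    intro a
    split_ifs with h
    · rw [h]; simp
    · simp
  rw [h3, h3] at h1
  simp only [smul_smul] at h1
  rw [mul_sub, mul_sub, sub_smul, sub_smul]
  rw [← add_smul] at h1
  rw [← sub_smul, ← sub_smul]
  have h4 : (tau F (.inl i : Idx r n) * α (evenConj i) - tau F (.inl i : Idx r n) * α i) =
    -tau F (.inl i : Idx r n) * α i + tau F (.inl i : Idx r n) * α (evenConj i) := by ring
  rw [h4, h1, ← add_smul, ← neg_smul]
  congr 1
  ring

theorem map_pure_inl_weight {k : ℕ} (hk : Kills p t ψ k) (h2 : 2 ≤ k) {α : Fin (2 * r) → ℕ}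
    (hα : α ≤ piTop p t) (hd : ∑ i, α i ≤ k + 1) {j : Fin (2 * r)}
    (h : ψ (mon F α ∅) (var F (.inl j)) ≠ 0) :
    (α (evenConj j) : F) = α j + 1 ∧ ∀ i, i ≠ j → i ≠ evenConj j →
      (α (evenConj i) : F) = α i := by
  have hw : ∀ i, (α (evenConj i) : F) - α i =
      (if i = j then 1 else 0) - (if evenConj i = j then 1 else 0) := fun i => by
    have := smul_left_injective F h (H.torus_map_pure hk h2 hα hd i (.inl j))
    simpa using this
  constructor
  · have := hw j
    rw [if_pos rfl, if_neg (evenConj_ne j), sub_zero, sub_eq_iff_eq_add'] at this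
    exact this
  · intro i hi hi'
    have := hw i
    rwa [if_neg hi, if_neg (fun h => hi' (by rw [← h, evenConj_evenConj])), sub_zero,
      sub_eq_zero] at this

theorem map_pure_inr_weight {k : ℕ} (hk : Kills p t ψ k) (h2 : 2 ≤ k) {α : Fin (2 * r) → ℕ}
    (hα : α ≤ piTop p t) (hd : ∑ i, α i ≤ k + 1) {j : Fin n}
    (h : ψ (mon F α ∅) (var F (.inr j)) ≠ 0) (i : Fin (2 * r)) :
    (α (evenConj i) : F) = α i := by
  have := smul_left_injective F h (H.torus_map_pure hk h2 hα hd i (.inr j))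
  simpa [sub_eq_zero] using this

/-- `x^(α)` is killed if its weight is zero and one coefficient of its image vanishes. -/
theorem map_pure_of_weight_zero (hn : Odd n) {k : ℕ} (hk : Kills p t ψ k) (h2 : 2 ≤ k)
    {α : Fin (2 * r) → ℕ} (hα : α ≤ piTop p t) (hd : ∑ i, α i ≤ k + 1)
    (hw : ∀ i, (α (evenConj i) : F) = α i)
    (h : cf (0, Finset.univ.erase (last hn)) (ψ (mon F α ∅) (var F (.inr (last hn)))) = 0) :
    ψ (mon F α ∅) = 0 := by
  refine H.eq_zero_of_var fun j => ?_
  rcases j with j | j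
  -- A nonzero component along an even ∂_j would have nonzero weight under x_j x_{j'}.
  · by_contra hj
    have := (H.map_pure_inl_weight hk h2 hα hd hj).1
    rw [hw j] at this
    simp at this
  · exact H.map_pure_var_inr hn hk h2 hα hd h j

/-- With β = α - ε_i, the bracket of x_i² x_{i'} with x^(β) is τ(i) (β_i + 1)(2 β_{i'} - β_i) x^(α),
and the hypotheses say that the scalar is nonzero. -/
theorem map_pure_of_cast [NeZero (3 : F)] {k : ℕ} (hk : Kills p t ψ k) (h3 : 3 ≤ k)
    {α : Fin (2 * r) → ℕ} (hα : α ≤ piTop p t) (hd : ∑ i, α i ≤ k + 1) {i : Fin (2 * r)}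
    (h0 : (α i : F) ≠ 0) (h1 : 2 * (α (evenConj i) : F) ≠ α i - 1) :
    ψ (mon F α ∅) = 0 := by
  obtain ⟨β, rfl⟩ := exists_eq_add_single (i := i) (β := α) (by rintro h; simp [h] at h0)
  rw [sum_add_single] at hd
  have hβ := le_piTop_of_add_single hα
  have hg : mon F β ∅ ∈ fil F p n t k := mon_mem_fil hβ (by simpa using hd)
  have hf := triple_mem_fil (F := F) (p := p) (t := t) (n := n) (.inl i) (.inl i)
    (.inl (evenConj i))
  have h4 := H.map_DH_eq_zero (fil_le_bd _ hf) (fil_le_bd _ hg) (sgn_even_triple _ _ _)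
    (sgn_mon_empty β) (hk _ (fil_mono h3 hf) (sgn_even_triple _ _ _)) (hk _ hg (sgn_mon_empty β))
  simp only [DH_even_triple, evenConj_evenConj, tau_evenConj, var_mul_pd_inl, mul_smul_comm,
    var_inl_mul_mon, smul_smul, ← add_smul, map_smul, smul_eq_zero] at h4
  refine h4.resolve_left fun h5 => ?_
  have h6 : tau F (.inl i : Idx r n) * ((β i : F) + 1) * (2 * β (evenConj i) - β i) = 0 := by
    linear_combination h5
  simp only [Pi.add_apply, Pi.single_eq_same, Pi.single_eq_of_ne (evenConj_ne i), add_zero,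
    Nat.cast_add, Nat.cast_one, add_sub_cancel_right] at h0 h1
  exact mul_ne_zero (mul_ne_zero (tau_inl_ne_zero _) h0) (sub_ne_zero.2 h1) h6

/-- The bracket of x_i³ with x^(α - 2 ε_i + ε_{i'}) is 3 τ(i) α_i (α_i - 1) x^(α); the strict bound
on α_{i'} keeps the second factor truncated. -/
theorem map_pure_of_lt [NeZero (3 : F)] {k : ℕ} (hk : Kills p t ψ k) (h3 : 3 ≤ k)
    {α : Fin (2 * r) → ℕ} (hα : α ≤ piTop p t) (hd : ∑ i, α i ≤ k + 1) {i : Fin (2 * r)}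
    (h0 : (α i : F) ≠ 0) (h1 : (α i : F) ≠ 1) (hlt : α (evenConj i) < piTop p t (evenConj i)) :
    ψ (mon F α ∅) = 0 := by
  obtain ⟨β, rfl⟩ := exists_eq_add_single (i := i) (β := α) (by rintro h; simp [h] at h0)
  obtain ⟨γ, rfl⟩ := exists_eq_add_single (i := i) (β := β) (by rintro h; simp [h] at h1)
  rw [sum_add_single, sum_add_single] at hd
  have hγ := le_piTop_of_add_single (le_piTop_of_add_single hα)
  simp only [Pi.add_apply, Pi.single_eq_of_ne (evenConj_ne i), add_zero] at hlt
  have hg : mon F (γ + Pi.single (evenConj i) 1) ∅ ∈ fil F p n t k :=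
    mon_mem_fil (add_single_le_piTop hγ hlt) (by rw [sum_add_single]; simp; omega)
  have hf := triple_mem_fil (F := F) (p := p) (t := t) (n := n) (.inl i) (.inl i) (.inl i)
  have h4 := H.map_DH_eq_zero (fil_le_bd _ hf) (fil_le_bd _ hg) (sgn_even_triple _ _ _)
    (sgn_mon_empty _) (hk _ (fil_mono h3 hf) (sgn_even_triple _ _ _)) (hk _ hg (sgn_mon_empty _))
  simp only [DH_even_triple, pd_inl_add_single, mul_smul_comm, Pi.add_apply, Pi.single_eq_same,
    var_inl_mul_mon, smul_smul, ← add_smul, map_smul, smul_eq_zero, Nat.cast_add,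
    Nat.cast_one] at h4 h0 h1
  refine h4.resolve_left fun h5 => ?_
  have h6 : 3 * tau F (.inl i : Idx r n) * ((γ i : F) + 1 + 1) * (γ i + 1) = 0 := by
    linear_combination h5
  refine mul_ne_zero (mul_ne_zero (mul_ne_zero three_ne_zero (tau_inl_ne_zero _)) h0) ?_ h6
  intro h
  exact h1 (by linear_combination h)

/-- The quadratic x_i x_j moves a unit from j' to i and one from i' to j. Applied to x^(α - ε_i +
ε_{j'}), it gives a nonzero multiple of x^(α) and another monomial. The source and the other
monomial have exponent -2 at i modulo p, and `map_pure_of_cast` kills both. -/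
theorem map_pure_of_mixed [NeZero (3 : F)] {k : ℕ} (hk : Kills p t ψ k) (h3 : 3 ≤ k)
    {α : Fin (2 * r) → ℕ} (hα : α ≤ piTop p t) (hd : ∑ i, α i ≤ k + 1) {i j : Fin (2 * r)}
    (hi : (α i : F) = -1) (hi' : (α (evenConj i) : F) = -1) (hji : j ≠ i)
    (hji' : j ≠ evenConj i)
    (hj : α j < piTop p t j) (hj' : α (evenConj j) < piTop p t (evenConj j)) :
    ψ (mon F α ∅) = 0 := by
  have e1 := evenConj_ne i
  have e2 := evenConj_ne j
  have e3 : evenConj j ≠ i := fun h => hji' (by rw [← h, evenConj_evenConj])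
  have e4 : evenConj j ≠ evenConj i := fun h => hji (by
    rw [← evenConj_evenConj j, h, evenConj_evenConj])
  obtain ⟨γ, rfl⟩ := exists_eq_add_single (i := i) (β := α) (by rintro h; simp [h] at hi)
  simp only [Pi.add_apply, Pi.single_eq_same, Pi.single_eq_of_ne e1, Pi.single_eq_of_ne hji,
    Pi.single_eq_of_ne e3, add_zero] at hi hi' hj hj'
  obtain ⟨δ, rfl⟩ := exists_eq_add_single (i := evenConj i) (β := γ)
    (by rintro h; simp [h] at hi')
  simp only [Pi.add_apply, Pi.single_eq_same, Pi.single_eq_of_ne e1.symm,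
    Pi.single_eq_of_ne hji', Pi.single_eq_of_ne e4, add_zero, Nat.cast_add,
    Nat.cast_one] at hi hi' hj hj'
  have hγ := le_piTop_of_add_single hα
  have hδ := le_piTop_of_add_single hγ
  rw [sum_add_single, sum_add_single] at hd
  have hβ : δ + Pi.single (evenConj i) 1 + Pi.single (evenConj j) 1 ≤ piTop p t :=
    add_single_le_piTop hγ (by simpa [e4] using hj')
  have hq : (var F (.inl i) * var F (.inl j) : Alg F r n) ∈ fil F p n t 2 :=
    var_mul_var_mem_fil _ _
  have hsq := sgn_mul_of_even (sgn_var_inl (F := F) (n := n) i) (sgn_var_inl j)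
  have h1 := H.map_DH_eq_zero (fil_le_bd _ hq) (mon_mem_bd hβ ∅) hsq (sgn_mon_empty _)
    (hk.mono (by omega) _ hq hsq) (by
      refine H.map_pure_of_cast hk h3 hβ (by rw [sum_add_single, sum_add_single]; omega)
        (i := i) ?_ ?_
      · simp only [Pi.add_apply, Pi.single_eq_of_ne e1.symm, Pi.single_eq_of_ne e3.symm,
          add_zero]
        intro h
        rw [h] at hi
        exact two_ne_zero (α := F) (by linear_combination hi)
      · simp only [Pi.add_apply, Pi.single_eq_of_ne e1.symm, Pi.single_eq_of_ne e3.symm,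
          Pi.single_eq_of_ne e4.symm, Pi.single_eq_same, add_zero, Nat.cast_add, Nat.cast_one]
        rw [hi']
        intro h
        exact one_ne_zero (α := F) (by linear_combination h + hi))
  have hx : ψ (mon F (δ + Pi.single (evenConj j) 1 + Pi.single j 1) ∅) = 0 := by
    refine H.map_pure_of_cast hk h3 (add_single_le_piTop
      (add_single_le_piTop hδ hj') (by simpa [e2.symm] using hj))
      (by rw [sum_add_single, sum_add_single]; omega) (i := i) ?_ ?_
    · simp only [Pi.add_apply, Pi.single_eq_of_ne hji.symm, Pi.single_eq_of_ne e3.symm,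
        add_zero]
      intro h
      rw [h] at hi
      exact two_ne_zero (α := F) (by linear_combination hi)
    · simp only [Pi.add_apply, Pi.single_eq_of_ne hji.symm, Pi.single_eq_of_ne e3.symm,
        Pi.single_eq_of_ne hji'.symm, Pi.single_eq_of_ne e4.symm, add_zero]
      intro h
      exact one_ne_zero (α := F) (by linear_combination 2 * hi' - h - hi)
  rw [DH_even_pair, pd_inl_add_single, add_right_comm, pd_inl_add_single, var_inl_mul_mon,
    var_inl_mul_mon, map_add, map_smul, map_smul, map_smul, map_smul, hx, smul_zero, smul_zero,
    add_zero, smul_eq_zero, smul_eq_zero] at h1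
  refine (h1.resolve_left (tau_inl_ne_zero _)).resolve_left ?_
  simp only [Pi.add_apply, Pi.single_eq_of_ne e1.symm, add_zero]
  rw [hi]
  simp

end OddDer

end Pure

/-! ### Exponents divisible by p and their splittings -/

section Induction

variable {F : Type*} [Field F] {p r n : ℕ} {t : Fin (2 * r) → ℕ+}
  {ψ : Alg F r n →ₗ[F] Module.End F (Alg F r n)}

/-- From k C(N, k) = N C(N - 1, k - 1). -/
theorem dvd_choose_of_dvd [Fact p.Prime] {N k : ℕ} (hN : p ∣ N) (hk : ¬ p ∣ k) :
    p ∣ N.choose k := by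
  obtain ⟨k, rfl⟩ := Nat.exists_eq_succ_of_ne_zero (n := k) (by rintro rfl; exact hk (dvd_zero p))
  rcases Nat.eq_zero_or_pos N with rfl | h
  · simp
  obtain ⟨N, rfl⟩ := Nat.exists_eq_succ_of_ne_zero h.ne'
  have h1 := Nat.add_one_mul_choose_eq N k
  have h2 : p ∣ (N.succ).choose k.succ * k.succ := by
    rw [← h1]; exact Dvd.dvd.mul_right hN _
  exact ((Fact.out : p.Prime).dvd_mul.1 h2).resolve_right hk

theorem choose_mul_pow_modEq [Fact p.Prime] (q m : ℕ) : (p ^ q * m).choose (p ^ q) ≡ m [MOD p] := by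
  induction q with
  | zero => simp [Nat.ModEq.refl]
  | succ q ih =>
    have h0 := (Fact.out : p.Prime).pos
    have h := Choose.choose_modEq_choose_mod_mul_choose_div_nat (p := p) (n := p * (p ^ q * m))
      (k := p * p ^ q)
    rw [Nat.mul_mod_right, Nat.mul_mod_right, Nat.mul_div_cancel_left _ h0,
      Nat.mul_div_cancel_left _ h0, Nat.choose_self, one_mul] at h
    rw [pow_succ', mul_assoc]
    exact h.trans ih

/-- A tuple of multiples of `p` is a power of `p` in a single position, or splits into two such
tuples with a nonzero multinomial coefficient. -/
theorem exists_split [Fact p.Prime] [CharP F p] {α : Fin (2 * r) → ℕ} (hp : ∀ l, p ∣ α l)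
    (h0 : α ≠ 0) :
    (∃ i q, 1 ≤ q ∧ α = Pi.single i (p ^ q)) ∨
    ∃ ξ η : Fin (2 * r) → ℕ, ξ + η = α ∧ (∀ l, p ∣ ξ l) ∧ (∀ l, p ∣ η l) ∧ ξ ≠ 0 ∧ η ≠ 0 ∧
      ∀ l, ((ξ l + η l).choose (ξ l) : F) ≠ 0 := by
  obtain ⟨i, hi⟩ := Function.ne_iff.1 h0
  have hi : α i ≠ 0 := hi
  by_cases h1 : ∃ j, j ≠ i ∧ α j ≠ 0
  · obtain ⟨j, hji, hj⟩ := h1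
    refine Or.inr ⟨Pi.single i (α i), Function.update α i 0, ?_, ?_, ?_, ?_, ?_, ?_⟩
    · funext l
      by_cases hl : l = i
      · subst hl; simp
      · simp [hl]
    · intro l
      by_cases hl : l = i
      · subst hl; simpa using hp l
      · simp [hl]
    · intro l
      by_cases hl : l = i
      · subst hl; simp
      · simpa [hl] using hp l
    · exact Function.ne_iff.2 ⟨i, by simpa using hi⟩
    · exact Function.ne_iff.2 ⟨j, by simpa [hji] using hj⟩
    · intro l
      by_cases hl : l = i
      · subst hl; simp
      · simp [hl]
  · push Not at h1
    have hα : α = Pi.single i (α i) := by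
      funext l
      by_cases hl : l = i
      · subst hl; simp
      · simp [hl, h1 l hl]
    -- With a single nonzero exponent p^q m, p ∤ m, the part p^q is split off when m > 1; by Lucas
    -- the binomial is m modulo p.
    obtain ⟨q, m, hm, hN⟩ := Nat.exists_eq_pow_mul_and_not_dvd hi p (Fact.out : p.Prime).ne_one
    have hq : 1 ≤ q := by
      by_contra hq
      have : q = 0 := by omega
      subst this
      rw [pow_zero, one_mul] at hN
      exact hm (hN ▸ hp i)
    have hpq : p ∣ p ^ q := dvd_pow_self p (by omega)
    have hpq0 : p ^ q ≠ 0 := pow_ne_zero _ (Fact.out : p.Prime).ne_zero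
    by_cases hm1 : m = 1
    · left
      exact ⟨i, q, hq, by rw [hα, hN, hm1, mul_one]⟩
    · right
      have hm0 : m ≠ 0 := by rintro rfl; exact hm (dvd_zero p)
      obtain ⟨m', rfl⟩ := Nat.exists_eq_succ_of_ne_zero hm0
      refine ⟨Pi.single i (p ^ q), Pi.single i (p ^ q * m'), ?_, ?_, ?_, ?_, ?_, ?_⟩
      · rw [← Pi.single_add, hα, hN, Nat.succ_eq_add_one, mul_add, mul_one, add_comm]
      · intro l
        by_cases hl : l = i
        · subst hl; simpa using hpq
        · simp [hl]
      · intro l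
        by_cases hl : l = i
        · subst hl; simpa using Dvd.dvd.mul_right hpq _
        · simp [hl]
      · exact Function.ne_iff.2 ⟨i, by simpa only [Pi.single_eq_same, Pi.zero_apply] using hpq0⟩
      · refine Function.ne_iff.2 ⟨i, ?_⟩
        simp only [Pi.single_eq_same, Pi.zero_apply]
        exact mul_ne_zero hpq0 (by rintro rfl; exact hm1 rfl)
      · intro l
        by_cases hl : l = i
        · subst hl
          simp only [Pi.single_eq_same]
          rw [show p ^ q + p ^ q * m' = p ^ q * m'.succ by rw [Nat.succ_eq_add_one]; ring, Ne,
            CharP.cast_eq_zero_iff F p]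
          intro h
          exact hm ((Nat.modEq_zero_iff_dvd.1
            ((choose_mul_pow_modEq q _).symm.trans (Nat.modEq_zero_iff_dvd.2 h))))
        · simp [hl]

/-- Both a and π_i + 1 = p^(t_i) are multiples of p, so the strict inequality between them leaves a
gap of p. -/
theorem add_le_of_dvd [Fact p.Prime] {a : ℕ} {i : Fin (2 * r)} (ha : p ∣ a)
    (h : a ≤ piTop p t i) : a + p ≤ piTop p t i + 1 := by
  have h1 := piTop_add_one (p := p) (t := t) i
  have h2 : p ∣ piTop p t i + 1 := by rw [h1]; exact dvd_pow_self p (PNat.ne_zero _)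
  obtain ⟨b, hb⟩ := ha
  obtain ⟨c, hc⟩ := h2
  rw [hc, hb]
  have : b < c := by
    by_contra hcb
    have := Nat.mul_le_mul_left p (not_lt.1 hcb)
    omega
  calc p * b + p = p * (b + 1) := by ring
    _ ≤ p * c := Nat.mul_le_mul_left p this

theorem le_sum_of_dvd [Fact p.Prime] {η : Fin (2 * r) → ℕ} (hη : ∀ l, p ∣ η l) (h0 : η ≠ 0) :
    p ≤ ∑ l, η l := by
  obtain ⟨i, hi⟩ := Function.ne_iff.1 h0
  exact (Nat.le_of_dvd (Nat.pos_of_ne_zero hi) (hη i)).trans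
    (Finset.single_le_sum (f := η) (fun _ _ => Nat.zero_le _) (Finset.mem_univ i))

theorem DH_mon_empty (β γ : Fin (2 * r) → ℕ) :
    DH F (mon F β (∅ : Finset (Fin n))) (mon F γ ∅) =
      ∑ l, tau F (.inl l : Idx r n) • (pd F (.inl l : Idx r n) (mon F β ∅) *
        pd F (.inl (evenConj l) : Idx r n) (mon F γ ∅)) := by
  rw [DH_apply_of_even (sgn_mon_empty β), Fintype.sum_sum_type]
  have : ∀ k : Fin n, pd F (.inr k : Idx r n) (mon F β ∅) = 0 := fun k => by
    rw [pd_inr_mon]; simp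
  simp only [this, zero_mul, smul_zero, Finset.sum_const_zero, add_zero]
  rfl

theorem mon_mul_mon_eq_zero_of_choose {α β : Fin (2 * r) → ℕ} {i : Fin (2 * r)}
    (h : ((α i + β i).choose (α i) : F) = 0) :
    mon F α (∅ : Finset (Fin n)) * mon F β ∅ = 0 := by
  rw [mon_mul_mon _ _ (by simp), Finset.prod_eq_zero (Finset.mem_univ i) h, zero_mul, zero_smul]

theorem mon_mul_mon_empty (α β : Fin (2 * r) → ℕ) :
    mon F α (∅ : Finset (Fin n)) * mon F β ∅ =
      (∏ i, ((α i + β i).choose (α i) : F)) • mon F (α + β) ∅ := by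
  rw [mon_mul_mon _ _ (by simp), invSign_empty_left, mul_one, Finset.empty_union]

theorem cast_ne_zero_of_lt [CharP F p] {a : ℕ} (h0 : 0 < a) (h : a < p) : (a : F) ≠ 0 := by
  rw [Ne, CharP.cast_eq_zero_iff F p]
  exact Nat.not_dvd_of_pos_of_lt h0 h

namespace OddDer

variable (H : OddDer p t ψ) [Fact p.Prime] [CharP F p] [NeZero (2 : F)] [NeZero (3 : F)]
include H

/-- The bracket of x^(ξ + ε_i) with x^(η + γ + ε_{i'}) contains x^(α), for α = ξ + η + γ, in its
i-th term with a nonzero coefficient. The i'-th term vanishes modulo p, and the remaining terms are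
killed by `map_pure_of_cast`. -/
theorem map_pure_of_split (hp : 3 < p) {k : ℕ} (hk : Kills p t ψ k) (h3 : 3 ≤ k)
    {ξ η γ : Fin (2 * r) → ℕ} {i : Fin (2 * r)} (hξ : ∀ l, p ∣ ξ l) (hη : ∀ l, p ∣ η l)
    (hξ0 : ξ ≠ 0) (hη0 : η ≠ 0) (hC : ∀ l, ((ξ l + η l).choose (ξ l) : F) ≠ 0)
    (hγ : γ = 0 ∨ γ = Pi.single i 1) (hα : ξ + (η + γ) ≤ piTop p t)
    (hd : ∑ l, (ξ + (η + γ)) l ≤ k + 1) : ψ (mon F (ξ + (η + γ)) ∅) = 0 := by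
  have hcast : ∀ {a : ℕ}, p ∣ a → (a : F) = 0 := fun h => (CharP.cast_eq_zero_iff F p _).2 h
  have hγi : γ i ≤ 1 ∧ ∀ l, l ≠ i → γ l = 0 := by
    rcases hγ with rfl | rfl
    · simp
    · exact ⟨by simp, fun l hl => by simp [hl]⟩
  have e1 := evenConj_ne i
  have hb : ∀ l, ξ l + η l + p ≤ piTop p t l + 1 := fun l => by
    have h1 : ξ l + (η l + γ l) ≤ piTop p t l := hα l
    exact add_le_of_dvd (dvd_add (hξ l) (hη l)) (by omega)
  have hsξ := le_sum_of_dvd hξ hξ0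
  have hsη := le_sum_of_dvd hη hη0
  simp only [Pi.add_apply, Finset.sum_add_distrib] at hd
  have hf : mon F (ξ + Pi.single i 1) (∅ : Finset (Fin n)) ∈ fil F p n t k := by
    refine mon_mem_fil (add_single_le_piTop (fun l => ?_) ?_) ?_
    · have := hb l
      change ξ l ≤ piTop p t l
      omega
    · have := hb i; omega
    · rw [sum_add_single]; simp; omega
  have hg : mon F (η + γ + Pi.single (evenConj i) 1) (∅ : Finset (Fin n)) ∈ fil F p n t k := by
    refine mon_mem_fil (add_single_le_piTop (fun l => ?_) ?_) ?_
    · have h1 : ξ l + (η l + γ l) ≤ piTop p t l := hα l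
      simp only [Pi.add_apply]; omega
    · have := hb (evenConj i)
      simp only [Pi.add_apply]; rw [hγi.2 _ e1]; omega
    · rw [sum_add_single]; simp [Finset.sum_add_distrib]; omega
  have h1 := H.map_DH_eq_zero (fil_le_bd _ hf) (fil_le_bd _ hg) (sgn_mon_empty _)
    (sgn_mon_empty _) (hk _ hf (sgn_mon_empty _)) (hk _ hg (sgn_mon_empty _))
  rw [DH_mon_empty, map_sum, Finset.sum_eq_single i] at h1
  · rw [pd_inl_add_single, pd_inl_add_single, mon_mul_mon_empty, map_smul, map_smul, smul_eq_zero,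
      smul_eq_zero] at h1
    refine (h1.resolve_left (tau_inl_ne_zero _)).resolve_left ?_
    refine Finset.prod_ne_zero_iff.2 fun l _ => ?_
    by_cases hγl : γ l = 0
    · simp only [Pi.add_apply, hγl, add_zero]; exact hC l
    · have hγl : γ l = 1 := by
        by_cases hl : l = i
        · subst hl; omega
        · exact absurd (hγi.2 l hl) hγl
      simp only [Pi.add_apply, hγl]
      rcases Nat.eq_zero_or_pos (ξ l) with h | h
      · simp [h]
      · obtain ⟨c, hc⟩ := Nat.exists_eq_succ_of_ne_zero h.ne'
        -- Pascal's rule splits C(ξ + η + 1, ξ); the summand C(ξ + η, ξ - 1) vanishes modulo p since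
        -- p divides ξ + η but not ξ - 1.
        have hnd : ¬ p ∣ c := by
          intro hpc
          have h4 : p ∣ c + 1 := by
            have := hξ l
            rwa [hc] at this
          exact (Fact.out : p.Prime).one_lt.ne' (Nat.dvd_one.1 ((Nat.dvd_add_right hpc).1 h4))
        have h4 := hcast (dvd_choose_of_dvd (dvd_add (hξ l) (hη l)) hnd)
        rw [← add_assoc, show (ξ l + η l + 1).choose (ξ l) =
          (ξ l + η l).choose c + (ξ l + η l).choose (ξ l) by
            rw [hc]; exact Nat.choose_succ_succ _ _, Nat.cast_add, h4, zero_add]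
        exact hC l
  · intro l _ hli
    rw [map_smul]
    suffices ψ (pd F (.inl l : Idx r n) (mon F (ξ + Pi.single i 1) ∅) *
        pd F (.inl (evenConj l) : Idx r n) (mon F (η + γ + Pi.single (evenConj i) 1) ∅)) = 0 by
      rw [this, smul_zero]
    by_cases hξl : ξ l = 0
    · rw [pd_inl_of_eq_zero (by simp [hξl, hli]), zero_mul, map_zero]
    obtain ⟨ξ', rfl⟩ := exists_eq_add_single hξl
    rw [add_right_comm, pd_inl_add_single]
    by_cases hli' : l = evenConj i
    · subst hli'
      rw [evenConj_evenConj]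
      by_cases hz : (η + γ) i = 0
      · rw [pd_inl_of_eq_zero (by simpa [e1.symm] using hz), mul_zero, map_zero]
      obtain ⟨κ, hκ⟩ := exists_eq_add_single hz
      -- At i' the product has the binomial C(ξ + η, ξ - 1), which vanishes modulo p for the same
      -- reason.
      rw [hκ, add_right_comm, pd_inl_add_single, mon_mul_mon_eq_zero_of_choose (i := evenConj i),
        map_zero]
      have h5 := congrFun hκ (evenConj i)
      simp only [Pi.add_apply, hγi.2 _ e1, Pi.single_eq_of_ne e1, add_zero] at h5
      simp only [Pi.add_apply, Pi.single_eq_of_ne e1, Pi.single_eq_same, add_zero, ← h5]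
      refine hcast (dvd_choose_of_dvd ?_ ?_)
      · have := dvd_add (hξ (evenConj i)) (hη (evenConj i))
        simp only [Pi.add_apply, Pi.single_eq_same] at this
        rwa [add_assoc, add_comm 1] at this
      · intro hpc
        have := hξ (evenConj i)
        simp only [Pi.add_apply, Pi.single_eq_same] at this
        exact (Fact.out : p.Prime).one_lt.ne' (Nat.dvd_one.1 ((Nat.dvd_add_right hpc).1 this))
    · have e5 : evenConj l ≠ evenConj i := fun h => hli (by
        rw [← evenConj_evenConj l, h, evenConj_evenConj])
      have e6 : evenConj l ≠ i := fun h => hli' (by rw [← h, evenConj_evenConj])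
      by_cases hηl : η (evenConj l) = 0
      · rw [pd_inl_of_eq_zero (i := evenConj l) (by simp [hηl, e5, hγi.2 _ e6]), mul_zero,
          map_zero]
      obtain ⟨η', rfl⟩ := exists_eq_add_single hηl
      rw [add_right_comm η', add_right_comm (η' + γ), pd_inl_add_single, mon_mul_mon_empty,
        map_smul]
      -- Away from i and i' the unit exponents added at both indices survive, so the residues are 1
      -- at i' and 1 + γ_i at i. The criterion at i' requires 2 (1 + γ_i) ≠ 0, which holds because 1
      -- + γ_i ≤ 2 < p.
      suffices hs : ψ (mon F (ξ' + Pi.single i 1 + (η' + γ + Pi.single (evenConj i) 1)) ∅) = 0 by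
        rw [hs, smul_zero]
      have h6 := hξ (evenConj i)
      have h7 := hη (evenConj i)
      have h8 := hξ i
      have h9 := hη i
      simp only [Pi.add_apply, Pi.single_eq_of_ne (Ne.symm hli'), Pi.single_eq_of_ne e5.symm,
        Pi.single_eq_of_ne (Ne.symm hli), Pi.single_eq_of_ne e6.symm, add_zero] at h6 h7 h8 h9
      refine H.map_pure_of_cast hk h3 (i := evenConj i) ?_ ?_ ?_ ?_
      · intro a
        have hba := hb a
        have hαa : (ξ' + Pi.single l 1 + (η' + Pi.single (evenConj l) 1 + γ) : Fin (2 * r) → ℕ) a ≤ piTop p t a :=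
          hα a
        simp only [Pi.add_apply] at hba hαa ⊢
        by_cases hai : a = i
        · subst hai
          simp only [Pi.single_eq_same, Pi.single_eq_of_ne e1.symm]
          omega
        · rw [hγi.2 a hai] at hαa ⊢
          by_cases hai' : a = evenConj i
          · subst hai'
            simp only [Pi.single_eq_same, Pi.single_eq_of_ne e1]
            omega
          · simp only [Pi.single_eq_of_ne hai, Pi.single_eq_of_ne hai']
            omega
      · simp [Finset.sum_add_distrib] at hd ⊢
        omega
      · simp only [Pi.add_apply, Pi.single_eq_same, Pi.single_eq_of_ne e1, hγi.2 _ e1,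
          Nat.cast_add, hcast h6, hcast h7]
        simp
      · rw [evenConj_evenConj]
        simp only [Pi.add_apply, Pi.single_eq_same, Pi.single_eq_of_ne e1,
          Pi.single_eq_of_ne e1.symm, hγi.2 _ e1, Nat.cast_add, hcast h6, hcast h7, hcast h8,
          hcast h9]
        have h10 : (2 * (1 + γ i : ℕ) : F) ≠ 0 :=
          mul_ne_zero two_ne_zero (cast_ne_zero_of_lt (p := p) (by omega) (by omega))
        push_cast at h10 ⊢
        intro h
        apply h10
        linear_combination h
  · simp

end OddDer

end Induction

/-! ### The cubics and the induction on the degree -/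

section Conclusion

variable {F : Type*} [Field F] {p r n : ℕ} {t : Fin (2 * r) → ℕ+}
  {ψ : Alg F r n →ₗ[F] Module.End F (Alg F r n)}

theorem exists_add_single_of_sum {α : Fin (2 * r) → ℕ} {m : ℕ} (h : ∑ l, α l = m + 1) :
    ∃ (γ : Fin (2 * r) → ℕ) (i : Fin (2 * r)), α = γ + Pi.single i 1 ∧ ∑ l, γ l = m := by
  obtain ⟨i, hi⟩ : ∃ i, α i ≠ 0 := by
    by_contra hc
    push Not at hc
    simp [hc] at h
  obtain ⟨γ, rfl⟩ := exists_eq_add_single hi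
  rw [sum_add_single] at h
  exact ⟨γ, i, rfl, by omega⟩

theorem eq_zero_of_sum {α : Fin (2 * r) → ℕ} (h : ∑ l, α l = 0) : α = 0 := by
  funext i
  simpa using Finset.sum_eq_zero_iff.1 h i (Finset.mem_univ i)

theorem exists_var_mul_eq [CharP F p] {γ : Fin (2 * r) → ℕ} {i : Fin (2 * r)}
    (h : (∑ l, γ l) + 1 < p) (u : Finset (Fin n)) :
    ∃ c : F, c ≠ 0 ∧ var F (.inl i) * mon F γ u = c • mon F (γ + Pi.single i 1) u := by
  refine ⟨_, ?_, var_inl_mul_mon i γ u⟩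
  have h1 : γ i ≤ ∑ l, γ l :=
    Finset.single_le_sum (f := γ) (fun _ _ => Nat.zero_le _) (Finset.mem_univ i)
  have := cast_ne_zero_of_lt (F := F) (p := p) (a := γ i + 1) (by omega) (by omega)
  simpa using this

namespace OddDer

variable (H : OddDer p t ψ) [Fact p.Prime] [CharP F p] [NeZero (2 : F)] [NeZero (3 : F)]
include H

-- The residues of the exponents of x_i³ match no possible weight of its image: equality would force
-- one of 2, 3, 4 to vanish in the field.
omit [NeZero (3 : F)] in
theorem map_cube (hp : 3 < p) (h2 : Kills p t ψ 2) (i : Fin (2 * r)) :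
    ψ (var F (.inl i) * (var F (.inl i) * var F (.inl i))) = 0 := by
  have hα : (Pi.single i 3 : Fin (2 * r) → ℕ) ≤ piTop p t := by
    intro l
    by_cases hl : l = i
    · subst hl
      have := one_le_piTop (p := p) (t := t) l
      simp; omega
    · simp [hl]
  have hd : ∑ l, (Pi.single i 3 : Fin (2 * r) → ℕ) l ≤ 2 + 1 := by simp
  have h3 : ((3 : ℕ) : F) ≠ 0 := cast_ne_zero_of_lt (p := p) (by omega) hp
  have e1 := evenConj_ne i
  have h0 : ψ (mon F (Pi.single i 3) ∅) = 0 := by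
    refine H.eq_zero_of_var fun j => ?_
    rcases j with j | j
    · by_contra hj
      obtain ⟨h4, h5⟩ := H.map_pure_inl_weight h2 le_rfl hα hd hj
      by_cases hji : i = j
      · subst hji
        simp only [Pi.single_eq_of_ne e1, Pi.single_eq_same, Nat.cast_zero] at h4
        have : (2 : F) * 2 = 0 := by push_cast at h4; linear_combination -h4
        exact mul_ne_zero two_ne_zero two_ne_zero this
      by_cases hji' : i = evenConj j
      · subst hji'
        simp only [Pi.single_eq_same, Pi.single_eq_of_ne (Ne.symm hji), Nat.cast_zero] at h4
        exact two_ne_zero (α := F) (by push_cast at h4; linear_combination h4)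
      · have := h5 i hji hji'
        simp only [Pi.single_eq_of_ne e1, Pi.single_eq_same, Nat.cast_zero] at this
        exact h3 this.symm
    · by_contra hj
      have := H.map_pure_inr_weight h2 le_rfl hα hd hj i
      simp only [Pi.single_eq_of_ne e1, Pi.single_eq_same, Nat.cast_zero] at this
      exact h3 this.symm
  have h1 : (var F (.inl i) : Alg F r n) = mon F (Pi.single i 1) ∅ := rfl
  conv_lhs => arg 2; rw [h1, single_mul_mon, mul_smul_comm, single_mul_mon, ← Pi.single_add,
    ← Pi.single_add]
  rw [map_smul, map_smul, h0, smul_zero, smul_zero]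

-- Polarization: the quadratic x_c x_{i'} acts on the variable x_i as x_i ↦ κ x_c, which replaces
-- factors x_i of a killed cubic by x_c.
omit [NeZero (3 : F)] in
theorem exists_map_even_triple (h2 : Kills p t ψ 2) (c i : Fin (2 * r)) :
    ∃ κ : F, κ ≠ 0 ∧ DH F (var F (.inl c) * var F (.inl (evenConj i))) (var F (.inl i)) =
        κ • (var F (.inl c) : Alg F r n) ∧
      ∀ b, ψ (var F (.inl b) * (var F (.inl i) * var F (.inl i))) = 0 →
      ψ (DH F (var F (.inl c) * var F (.inl (evenConj i))) (var F (.inl b)) *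
        (var F (.inl i) * var F (.inl i))) +
      (2 * κ) • ψ (var F (.inl b) * (var F (.inl c) * var F (.inl i)) : Alg F r n) = 0 := by
  have hq : (var F (.inl c) * var F (.inl (evenConj i)) : Alg F r n) ∈ fil F p n t 2 :=
    var_mul_var_mem_fil _ _
  have hsq := sgn_mul_of_even (sgn_var_inl (F := F) (n := n) c) (sgn_var_inl (evenConj i))
  obtain ⟨κ, hκ, hD⟩ : ∃ κ : F, κ ≠ 0 ∧
      DH F (var F (.inl c) * var F (.inl (evenConj i))) (var F (.inl i)) =
        κ • (var F (.inl c) : Alg F r n) := by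
    rw [DH_even_pair, evenConj_evenConj, pd_var', if_pos rfl, pd_var', mul_one]
    -- When c = i', both terms of the quadratic field act on x_i and κ is doubled.
    by_cases h : evenConj c = i
    · have h' : evenConj i = c := by rw [← h, evenConj_evenConj]
      refine ⟨tau F (.inl c : Idx r n) + tau F (.inl c : Idx r n), ?_, ?_⟩
      · rw [← two_mul]
        exact mul_ne_zero two_ne_zero (tau_inl_ne_zero _)
      · rw [h', if_pos (by rw [h]), mul_one, add_smul]
    · exact ⟨tau F (.inl (evenConj i) : Idx r n), tau_inl_ne_zero _, by simp [h]⟩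
  refine ⟨κ, hκ, hD, fun b hb => ?_⟩
  have hf := triple_mem_fil (F := F) (p := p) (t := t) (n := n) (.inl b) (.inl i) (.inl i)
  have := H.map_DH_eq_zero (fil_le_bd _ hq) (fil_le_bd _ hf) hsq (sgn_even_triple _ _ _)
    (h2 _ hq hsq) hb
  rw [DH_mul hsq, DH_mul hsq, hD, smul_mul_assoc, mul_smul_comm,
    ← var_inl_mul_comm c (var F (.inl i)), ← two_smul F, smul_smul, mul_smul_comm] at this
  rwa [map_add, map_smul] at this

/-- Polarizing x_i³ once gives 3 κ x_c x_i²; polarizing x_b x_i² again gives the general triple in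
`map_even_triple`. -/
theorem map_even_triple_of_eq (hp : 3 < p) (h2 : Kills p t ψ 2)
    (c i : Fin (2 * r)) : ψ (var F (.inl c) * (var F (.inl i) * var F (.inl i))) = 0 := by
  obtain ⟨κ, hκ, hD, h⟩ := H.exists_map_even_triple h2 c i
  have h1 := h i (H.map_cube hp h2 i)
  rw [hD, smul_mul_assoc, map_smul, ← mul_assoc (var F (.inl i)),
    ← var_inl_mul_comm c (var F (.inl i)), mul_assoc, ← add_smul, smul_eq_zero] at h1
  refine h1.resolve_left fun h3 => mul_ne_zero (three_ne_zero (α := F)) hκ ?_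
  linear_combination h3

theorem map_even_triple (hp : 3 < p) (h2 : Kills p t ψ 2)
    (b c i : Fin (2 * r)) : ψ (var F (.inl b) * (var F (.inl c) * var F (.inl i))) = 0 := by
  by_cases hbi : b = i
  · rw [hbi, ← mul_assoc, ← var_inl_mul_comm c (var F (.inl i)), mul_assoc,
      H.map_even_triple_of_eq hp h2]
  obtain ⟨κ, hκ, -, h⟩ := H.exists_map_even_triple h2 c i
  have h1 := h b (H.map_even_triple_of_eq hp h2 b i)
  have h3 : ψ (DH F (var F (.inl c) * var F (.inl (evenConj i))) (var F (.inl b)) *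
      (var F (.inl i) * var F (.inl i))) = 0 := by
    rw [DH_even_pair, evenConj_evenConj, pd_var', if_neg (by simpa using Ne.symm hbi), pd_var']
    split_ifs
    · rw [mul_zero, smul_zero, zero_add, mul_one, smul_mul_assoc, map_smul,
        H.map_even_triple_of_eq hp h2, smul_zero]
    · simp
  rw [h3, zero_add, smul_eq_zero] at h1
  exact h1.resolve_left (mul_ne_zero two_ne_zero hκ)

/-- As 3 < p, divided power monomials of degree 3 are nonzero multiples of ordinary products of
variables. -/
theorem map_pure_cubic (hp : 3 < p) (h2 : Kills p t ψ 2)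
    {α : Fin (2 * r) → ℕ} (hα : ∑ l, α l = 3) : ψ (mon F α ∅) = 0 := by
  obtain ⟨β, a, rfl, hβ⟩ := exists_add_single_of_sum hα
  obtain ⟨γ, b, rfl, hγ⟩ := exists_add_single_of_sum hβ
  obtain ⟨δ, c, rfl, hδ⟩ := exists_add_single_of_sum hγ
  obtain rfl := eq_zero_of_sum hδ
  have h := H.map_even_triple hp h2 a b c
  obtain ⟨x, hx, h1⟩ := exists_var_mul_eq (F := F) (n := n) (p := p) (γ := 0) (i := c)
    (by simp; omega) ∅
  obtain ⟨y, hy, h3⟩ := exists_var_mul_eq (F := F) (n := n) (p := p) (i := b)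
    (γ := 0 + Pi.single c 1) (by omega) ∅
  obtain ⟨z, hz, h4⟩ := exists_var_mul_eq (F := F) (n := n) (p := p) (i := a)
    (γ := 0 + Pi.single c 1 + Pi.single b 1) (by omega) ∅
  rw [mon_zero_empty, mul_one] at h1
  rw [h1, mul_smul_comm, h3, mul_smul_comm, mul_smul_comm, h4, map_smul, map_smul, map_smul,
    smul_eq_zero, smul_eq_zero, smul_eq_zero] at h
  exact ((h.resolve_left hx).resolve_left hy).resolve_left hz

theorem kills_three (hn : Odd n) (hp : 3 < p) (h2 : Kills p t ψ 2) : Kills p t ψ 3 := by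
  refine kills_of_mon fun α u hα hu hd => ?_
  by_cases hd2 : (∑ i, α i) + u.card ≤ 2
  · exact h2.mon hα hu hd2
  rcases u.eq_empty_or_nonempty with rfl | ⟨a, ha⟩
  · exact H.map_pure_cubic hp h2 (by simp at hd hd2; omega)
  have hca : (u.erase a).card + 1 = u.card := Finset.card_erase_add_one ha
  obtain ⟨b, hb⟩ : (u.erase a).Nonempty := by
    rw [← Finset.card_pos]
    by_contra h
    have : u.card = 1 := by omega
    rw [this] at hu
    exact absurd hu (by decide)
  have hcb : ((u.erase a).erase b).card + 1 = (u.erase a).card := Finset.card_erase_add_one hb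
  have hu2 : u.card ≠ 3 := by
    intro h
    rw [h] at hu
    exact absurd hu (by decide)
  have hempty : (u.erase a).erase b = ∅ := Finset.card_eq_zero.1 (by omega)
  obtain ⟨γ, i, rfl, hγ⟩ := exists_add_single_of_sum (α := α) (m := 0) (by omega)
  obtain rfl := eq_zero_of_sum hγ
  have h := H.map_mixed_cubic h2 hn i a b
  have h1 : (var F (.inr b) : Alg F r n) = mon F 0 ((insert b ((u.erase a).erase b))) := by
    rw [hempty]; rfl
  rw [h1, Finset.insert_erase hb, var_mul_mon (by simp), Finset.insert_erase ha, mul_smul_comm,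
    var_inl_mul_mon, map_smul, map_smul, smul_eq_zero, smul_eq_zero] at h
  exact (h.resolve_left (by simp)).resolve_left (by simp)

/-- The residues of the exponents of a monomial in even variables that is not killed. -/
theorem residues_of_map_pure_ne_zero {k : ℕ} (hk : Kills p t ψ k) (h3 : 3 ≤ k)
    {α : Fin (2 * r) → ℕ} (hα : α ≤ piTop p t) (hd : ∑ i, α i ≤ k + 1)
    (h : ψ (mon F α ∅) ≠ 0) (i : Fin (2 * r)) :
    ((α i : F) = -1 ∧ (α (evenConj i) : F) = -1) ∨
    ((α i : F) = 0 ∧ (α (evenConj i) : F) = 0) ∨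
    ((α i : F) = 1 ∧ (α (evenConj i) : F) = 0) ∨
    ((α i : F) = 0 ∧ (α (evenConj i) : F) = 1) := by
  have h1 : (α i : F) = 0 ∨ 2 * (α (evenConj i) : F) = α i - 1 := by
    by_contra hc
    push Not at hc
    exact h (H.map_pure_of_cast hk h3 hα hd hc.1 hc.2)
  have h2 : (α (evenConj i) : F) = 0 ∨ 2 * (α i : F) = α (evenConj i) - 1 := by
    by_contra hc
    push Not at hc
    exact h (H.map_pure_of_cast hk h3 hα hd hc.1 (by rw [evenConj_evenConj]; exact hc.2))
  rcases h1 with h1 | h1 <;> rcases h2 with h2 | h2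
  · exact Or.inr (Or.inl ⟨h1, h2⟩)
  · refine Or.inr (Or.inr (Or.inr ⟨h1, ?_⟩))
    linear_combination 2 * h1 - h2
  · refine Or.inr (Or.inr (Or.inl ⟨?_, h2⟩))
    linear_combination 2 * h2 - h1
  · left
    -- When neither exponent vanishes modulo p, the two conditions 2 α_{i'} = α_i - 1 and 2 α_i =
    -- α_{i'} - 1 have the unique solution (-1, -1).
    have h4 : (3 : F) * (α i + 1) = 0 := by linear_combination 2 * h2 + h1
    have h5 := (mul_eq_zero.1 h4).resolve_left three_ne_zero
    have h6 : (α i : F) = -1 := by linear_combination h5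
    exact ⟨h6, by linear_combination 2 * h6 - h2⟩

/-- A residue -1 at i forces α_{i'} to be the actual maximum, by `map_pure_of_lt`, and to have
residue -1 as well; `map_pure_of_mixed` spreads this to the other conjugate pairs. -/
theorem eq_piTop_of_map_pure_ne_zero {k : ℕ} (hk : Kills p t ψ k) (h3 : 3 ≤ k)
    {α : Fin (2 * r) → ℕ} (hα : α ≤ piTop p t) (hd : ∑ i, α i ≤ k + 1)
    (h : ψ (mon F α ∅) ≠ 0) {i : Fin (2 * r)} (hi : (α i : F) = -1) : α = piTop p t := by
  have key : ∀ i, (α i : F) = -1 →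
      (α (evenConj i) : F) = -1 ∧ α (evenConj i) = piTop p t (evenConj i) := by
    intro i hi
    have h01 : (-1 : F) ≠ 0 := by simp
    have h02 : (-1 : F) ≠ 1 := fun h => two_ne_zero (α := F) (by linear_combination -h)
    constructor
    · rcases H.residues_of_map_pure_ne_zero hk h3 hα hd h i with h' | h' | h' | h'
      · exact h'.2
      · exact absurd (hi.symm.trans h'.1) h01
      · exact absurd (hi.symm.trans h'.1) h02
      · exact absurd (hi.symm.trans h'.1) h01
    · by_contra hne
      have hlt : α (evenConj i) < piTop p t (evenConj i) := lt_of_le_of_ne (hα _) hne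
      exact h (H.map_pure_of_lt hk h3 hα hd (by rwa [hi]) (by rwa [hi]) hlt)
  have hall : ∀ j, (α j : F) = -1 := by
    have hpi : ∀ j, α j = piTop p t j → (α j : F) = -1 := by
      intro j hj
      have h1 := congrArg (Nat.cast (R := F)) (piTop_add_one (p := p) (t := t) j)
      rw [← hj] at h1
      push_cast at h1
      rw [CharP.cast_eq_zero F p, zero_pow (PNat.ne_zero _)] at h1
      linear_combination h1
    intro j
    by_cases hji : j = i
    · rw [hji, hi]
    by_cases hji' : j = evenConj i
    · rw [hji', (key i hi).1]
    by_cases hj : α j < piTop p t j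
    · by_cases hj' : α (evenConj j) < piTop p t (evenConj j)
      · exact absurd (H.map_pure_of_mixed hk h3 hα hd hi (key i hi).1 hji hji' hj hj') h
      · have h1 : α (evenConj j) ≤ piTop p t (evenConj j) := hα _
        have := (key (evenConj j) (hpi _ (by omega))).1
        rwa [evenConj_evenConj] at this
    · have h1 : α j ≤ piTop p t j := hα _
      exact hpi j (by omega)
  funext j
  have := (key (evenConj j) (hall _)).2
  rwa [evenConj_evenConj] at this

-- For j = i' the weights allow only the component along ∂_i, whose top coefficient is assumed zero.
-- The quadratic x_i x_j then carries ε_{i'} to every other ε_j.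
omit [NeZero (3 : F)] in
theorem map_pure_power_add_single {k : ℕ} (hn : Odd n) (hk : Kills p t ψ k) (h3 : 3 ≤ k)
    {i j : Fin (2 * r)} {N : ℕ} (hN : p ∣ N) (hi : N ≤ piTop p t i) (hd : N ≤ k)
    (h : cf (0, Finset.univ)
      (ψ (mon F (Pi.single i N + Pi.single (evenConj i) 1) ∅) (var F (.inl i))) = 0) :
    ψ (mon F (Pi.single i N + Pi.single j 1) ∅) = 0 := by
  have hcast : (N : F) = 0 := (CharP.cast_eq_zero_iff F p _).2 hN
  have e1 := evenConj_ne i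
  have hp2 := (Fact.out : p.Prime).two_le
  have hs : (Pi.single i N : Fin (2 * r) → ℕ) ≤ piTop p t := by
    intro l
    by_cases hl : l = i
    · subst hl; simpa using hi
    · simp [hl]
  have hα : (Pi.single i N + Pi.single (evenConj i) 1 : Fin (2 * r) → ℕ) ≤ piTop p t := by
    refine add_single_le_piTop hs ?_
    have := one_le_piTop (p := p) (t := t) (evenConj i)
    simp [e1]; omega
  have hdα : ∑ l, (Pi.single i N + Pi.single (evenConj i) 1 : Fin (2 * r) → ℕ) l ≤ k + 1 := by
    rw [sum_add_single]; simpa using hd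
  have hconj : ψ (mon F (Pi.single i N + Pi.single (evenConj i) 1) ∅) = 0 := by
    refine H.eq_zero_of_var fun a => ?_
    rcases a with a | a
    · by_cases hai : a = i
      · subst hai
        exact H.map_pure_var_inl hn hk (by omega) hα hdα h
      by_contra ha
      obtain ⟨h4, h5⟩ := H.map_pure_inl_weight hk (by omega) hα hdα ha
      by_cases hai' : a = evenConj i
      · subst hai'
        simp only [evenConj_evenConj, Pi.add_apply, Pi.single_eq_same, Pi.single_eq_of_ne e1,
          Pi.single_eq_of_ne e1.symm, add_zero, zero_add, hcast] at h4
        exact two_ne_zero (α := F) (by push_cast at h4; linear_combination -h4)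
      · have h6 := h5 i (Ne.symm hai) (fun h => hai' (by rw [h, evenConj_evenConj]))
        simp only [Pi.add_apply, Pi.single_eq_same, Pi.single_eq_of_ne e1,
          Pi.single_eq_of_ne e1.symm, add_zero, zero_add, hcast] at h6
        simp at h6
    · by_contra ha
      have h6 := H.map_pure_inr_weight hk (by omega) hα hdα ha i
      simp only [Pi.add_apply, Pi.single_eq_same, Pi.single_eq_of_ne e1,
        Pi.single_eq_of_ne e1.symm, add_zero, zero_add, hcast] at h6
      simp at h6
  by_cases hj : j = evenConj i
  · rw [hj, hconj]
  have hq : (var F (.inl i) * var F (.inl j) : Alg F r n) ∈ fil F p n t 2 :=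
    var_mul_var_mem_fil _ _
  have hsq := sgn_mul_of_even (sgn_var_inl (F := F) (n := n) i) (sgn_var_inl j)
  have h1 := H.map_DH_eq_zero (fil_le_bd _ hq) (mon_mem_bd hα ∅) hsq (sgn_mon_empty _)
    (hk.mono (by omega) _ hq hsq) hconj
  rw [DH_even_pair, pd_inl_add_single] at h1
  by_cases hji : j = i
  · subst hji
    rw [pd_inl_add_single, ← add_smul, var_inl_mul_mon, map_smul, map_smul, smul_eq_zero,
      smul_eq_zero] at h1
    refine (h1.resolve_left ?_).resolve_left (by simp [hcast])
    rw [← two_mul]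
    exact mul_ne_zero two_ne_zero (tau_inl_ne_zero _)
  · have hz : pd F (.inl (evenConj j) : Idx r n)
        (mon F (Pi.single i N + Pi.single (evenConj i) 1) ∅) = 0 := by
      refine pd_inl_of_eq_zero ?_ _
      have h4 : evenConj j ≠ i := fun h => hj (by rw [← h, evenConj_evenConj])
      have h5 : evenConj j ≠ evenConj i := fun h => hji (by
        rw [← evenConj_evenConj j, h, evenConj_evenConj])
      simp [h4, h5]
    rw [hz, mul_zero, smul_zero, zero_add, var_inl_mul_mon, map_smul, map_smul, smul_eq_zero,
      smul_eq_zero] at h1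
    exact (h1.resolve_left (tau_inl_ne_zero _)).resolve_left (by simp [hji])

/-- The three coefficient hypotheses cover exactly the exponents that the bracket arguments cannot
reach: π, p^q ε_i, and p^q ε_i + ε_{i'}. -/
theorem map_pure [NeZero r] (hn : Odd n) (hp : 3 < p) {k : ℕ} (hk : Kills p t ψ k) (h3 : 3 ≤ k)
    (hpow : ∀ i q, 1 ≤ q → q < (t i : ℕ) → cf (0, Finset.univ.erase (last hn))
      (ψ (mon F (Pi.single i (p ^ q)) ∅) (var F (.inr (last hn)))) = 0)
    (hpow' : ∀ i q, 1 ≤ q → q < (t i : ℕ) → cf (0, Finset.univ)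
      (ψ (mon F (Pi.single i (p ^ q) + Pi.single (evenConj i) 1) ∅) (var F (.inl i))) = 0)
    (htop : cf (0, Finset.univ.erase (last hn))
      (ψ (mon F (piTop p t) ∅) (var F (.inr (last hn)))) = 0)
    {α : Fin (2 * r) → ℕ} (hα : α ≤ piTop p t) (hd : ∑ i, α i ≤ k + 1) :
    ψ (mon F α ∅) = 0 := by
  by_cases hd3 : ∑ i, α i ≤ k
  · exact hk.mon hα (by simp) (by simpa using hd3)
  by_contra h
  have hres := H.residues_of_map_pure_ne_zero hk h3 hα hd h
  have hdvd : ∀ {a : ℕ}, (a : F) = 0 → p ∣ a := fun h => (CharP.cast_eq_zero_iff F p _).1 h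
  have hqlt : ∀ i q, p ^ q ≤ piTop p t i → q < (t i : ℕ) := by
    intro i q hq
    have h1 := piTop_add_one (p := p) (t := t) i
    exact (Nat.pow_lt_pow_iff_right (Fact.out : p.Prime).one_lt).1 (by omega)
  by_cases hm1 : ∃ i, (α i : F) = -1
  · obtain ⟨i, hi⟩ := hm1
    have hαpi := H.eq_piTop_of_map_pure_ne_zero hk h3 hα hd h hi
    refine h (H.map_pure_of_weight_zero hn hk (by omega) hα hd (fun j => ?_) (hαpi ▸ htop))
    have h1 : ∀ j, (α j : F) = -1 := by
      intro j
      have h1 := congrArg (Nat.cast (R := F)) (piTop_add_one (p := p) (t := t) j)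
      rw [← hαpi] at h1
      push_cast at h1
      rw [CharP.cast_eq_zero F p, zero_pow (PNat.ne_zero _)] at h1
      linear_combination h1
    rw [h1, h1]
  push Not at hm1
  let i₀ : Fin (2 * r) := ⟨0, by have := Nat.pos_of_ne_zero (NeZero.ne r); omega⟩
  by_cases h0 : ∀ i, (α i : F) = 0
  · rcases exists_split (F := F) (p := p) (α := α) (fun l => hdvd (h0 l))
      (by rintro rfl; simp at hd3) with ⟨i, q, hq, rfl⟩ | ⟨ξ, η, rfl, hξ, hη, hξ0, hη0, hC⟩
    · refine h (H.map_pure_of_weight_zero hn hk (by omega) hα hd (fun j => by rw [h0, h0])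
        (hpow i q hq (hqlt i q ?_)))
      have := hα i
      simpa using this
    · refine h ?_
      have := H.map_pure_of_split hp hk h3 (γ := 0) (i := i₀) hξ hη hξ0 hη0 hC (Or.inl rfl)
        (by rwa [add_zero]) (by rwa [add_zero])
      rwa [add_zero] at this
  · push Not at h0
    obtain ⟨i, hi⟩ := h0
    obtain ⟨j, hj, hj'⟩ : ∃ j, (α j : F) = 1 ∧ (α (evenConj j) : F) = 0 := by
      rcases hres i with h' | h' | h' | h'
      · exact absurd h'.1 (hm1 i)
      · exact absurd h'.1 hi
      · exact ⟨i, h'⟩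
      · exact absurd h'.1 hi
    -- With residues (1, 0) at (j, j'), a nonzero component can only lie along ∂_{j'}. Its weight
    -- then forces equal residues on every other conjugate pair, and only (0, 0) is left.
    have hother : ∀ l, l ≠ j → (α l : F) = 0 := by
      intro l hlj
      by_cases hlj' : l = evenConj j
      · rw [hlj', hj']
      obtain ⟨a, ha⟩ : ∃ a, ψ (mon F α ∅) (var F a) ≠ 0 := by
        by_contra hc
        push Not at hc
        exact h (H.eq_zero_of_var hc)
      rcases a with a | a
      · obtain ⟨h4, h5⟩ := H.map_pure_inl_weight hk (by omega) hα hd ha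
        have hja : a = evenConj j := by
          by_contra hne
          by_cases hja : j = a
          · subst hja
            rw [hj, hj'] at h4
            exact two_ne_zero (α := F) (by linear_combination -h4)
          · have := h5 j hja (fun h => hne (by rw [h, evenConj_evenConj]))
            rw [hj, hj'] at this
            simp at this
        have h6 := h5 l (by rwa [hja]) (by rwa [hja, evenConj_evenConj])
        rcases hres l with h' | h' | h' | h'
        · exact absurd h'.1 (hm1 l)
        · exact h'.1
        · rw [h'.1, h'.2] at h6; simp at h6
        · exact h'.1
      · have := H.map_pure_inr_weight hk (by omega) hα hd ha j
        rw [hj, hj'] at this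
        simp at this
    obtain ⟨β, rfl⟩ := exists_eq_add_single (i := j) (β := α) (by rintro h; simp [h] at hj)
    have hβ : ∀ l, p ∣ β l := by
      intro l
      refine hdvd ?_
      by_cases hlj : l = j
      · subst hlj
        simpa using hj
      · simpa [hlj] using hother l hlj
    rw [sum_add_single] at hd hd3
    rcases exists_split (F := F) (p := p) (α := β) hβ
      (by rintro rfl; simp at hd3; omega) with
      ⟨a, q, hq, rfl⟩ | ⟨ξ, η, rfl, hξ, hη, hξ0, hη0, hC⟩
    · have hle : p ^ q ≤ piTop p t a := by
        have := le_piTop_of_add_single hα a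
        simpa using this
      exact h (H.map_pure_power_add_single hn hk h3 (dvd_pow_self p (by omega)) hle
        (by simpa using hd) (hpow' a q hq (hqlt a q hle)))
    · refine h ?_
      rw [add_assoc] at hα ⊢
      refine H.map_pure_of_split hp hk h3 (γ := Pi.single j 1) (i := j) hξ hη hξ0 hη0 hC
        (Or.inr rfl) hα ?_
      rw [← add_assoc, sum_add_single]
      exact hd

/-- The induction starts in degree 3 because its steps bracket with cubics that are already killed.
-/
theorem kills [NeZero r] (hn : Odd n) (hp : 3 < p) (h2 : Kills p t ψ 2)
    (hpow : ∀ i q, 1 ≤ q → q < (t i : ℕ) → cf (0, Finset.univ.erase (last hn))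
      (ψ (mon F (Pi.single i (p ^ q)) ∅) (var F (.inr (last hn)))) = 0)
    (hpow' : ∀ i q, 1 ≤ q → q < (t i : ℕ) → cf (0, Finset.univ)
      (ψ (mon F (Pi.single i (p ^ q) + Pi.single (evenConj i) 1) ∅) (var F (.inl i))) = 0)
    (htop : cf (0, Finset.univ.erase (last hn))
      (ψ (mon F (piTop p t) ∅) (var F (.inr (last hn)))) = 0) (k : ℕ) :
    Kills p t ψ (k + 3) := by
  induction k with
  | zero => exact H.kills_three hn hp h2
  | succ k ih =>
    refine kills_of_mon fun α u hα hu hd => ?_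
    rcases u.eq_empty_or_nonempty with rfl | hne
    · exact H.map_pure hn hp ih (by omega) hpow hpow' htop hα (by simp at hd; omega)
    · exact H.map_mon_of_nonempty hn ih (by omega) hα hu hne (by omega)

end OddDer

end Conclusion

/-! ### The space of odd vector fields -/

section OddFields

variable {F : Type*} [Field F] {r n : ℕ}

/-- The odd vector fields `∑_j e_j ∂_j` on `𝒪(m, n)`. -/
def oddVF (F : Type*) [Field F] (r n : ℕ) : Submodule F (Module.End F (Alg F r n)) where
  carrier := {E | E = vf (fun j => E (var F j)) ∧
    ∀ j, sgn (E (var F j)) = -((-1 : F) ^ par j • E (var F j))}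
  zero_mem' := ⟨by simp [vf], fun j => by simp⟩
  add_mem' := by
    rintro D E ⟨hD, hD'⟩ ⟨hE, hE'⟩
    refine ⟨?_, fun j => ?_⟩
    · simp only [LinearMap.add_apply]
      rw [vf_add, ← hD, ← hE]
    · rw [LinearMap.add_apply, map_add, hD', hE', smul_add, neg_add]
  smul_mem' := by
    rintro a E ⟨hE, hE'⟩
    refine ⟨?_, fun j => ?_⟩
    · simp only [LinearMap.smul_apply]
      rw [vf_smul, ← hE]
    · rw [LinearMap.smul_apply, map_smul, hE', smul_neg, smul_comm]

theorem vf_mem_oddVF {e : Idx r n → Alg F r n}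
    (h : ∀ j, sgn (e j) = -((-1 : F) ^ par j • e j)) : vf e ∈ oddVF F r n :=
  ⟨by simp only [vf_var], fun j => by rw [vf_var, h]⟩

theorem Wodd_le_oddVF (p : ℕ) (t : Fin (2 * r) → ℕ+) : Wodd F p n t ≤ oddVF F r n := by
  refine Submodule.span_le.2 ?_
  rintro _ ⟨α, u, j, -, hu, rfl⟩
  have : mulL F (mon F α u) * pd F j = vf fun l => if l = j then mon F α u else 0 := by
    rw [vf, Finset.sum_eq_single j]
    · rw [if_pos rfl]
    · intro l _ hl
      rw [if_neg hl, map_zero, zero_mul]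
    · simp
  rw [this]
  refine vf_mem_oddVF fun l => ?_
  by_cases hl : l = j
  · subst hl
    rw [if_pos rfl, sgn_mon, ← neg_smul]
    congr 1
    rcases l with l | l
    · simpa [par] using hu.neg_one_pow
    · have : Even u.card := by simpa [par, Nat.odd_add_one] using hu
      simpa [par] using this.neg_one_pow
  · simp [hl]

theorem sgn_twist (j : Idx r n) (f : Alg F r n) : sgn (twist j f) = twist j (sgn f) := by
  rcases j with j | j
  · rfl
  · rw [twist_inr, twist_inr]

theorem mulL_mul_DH_mem_oddVF_of_odd {a f : Alg F r n} (ha : sgn a = a) (hf : sgn f = -f) :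
    mulL F a * DH F f ∈ oddVF F r n := by
  rw [DH_eq_vf, mulL_mul_vf]
  refine vf_mem_oddVF fun j => ?_
  rw [sgn_mul, ha, map_smul, sgn_pd, sgn_twist, hf, map_neg, map_neg, par_conj, smul_neg, smul_neg,
    mul_neg, smul_comm, mul_smul_comm]

theorem mulL_mul_DH_mem_oddVF_of_even {a f : Alg F r n} (ha : sgn a = -a) (hf : sgn f = f) :
    mulL F a * DH F f ∈ oddVF F r n := by
  rw [DH_eq_vf, mulL_mul_vf]
  refine vf_mem_oddVF fun j => ?_
  rw [sgn_mul, ha, map_smul, sgn_pd, sgn_twist, hf, par_conj, smul_comm, neg_mul, mul_smul_comm]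

end OddFields

/-! ### The even truncated functions as a parametrization of the even Hamiltonian fields -/

section EvenProjection

variable (F : Type*) [Field F] (p : ℕ) {r : ℕ} (n : ℕ) (t : Fin (2 * r) → ℕ+)

open Classical in
/-- The projection of `𝒪(m, n)` to the even part of the truncated algebra. -/
def ev : Module.End F (Alg F r n) :=
  (monBasis F).constr F fun b =>
    if b.1 ≤ piTop p t ∧ Even b.2.card then mon F b.1 b.2 else 0

variable {F p n t}

theorem ev_mon {α : Fin (2 * r) → ℕ} {u : Finset (Fin n)} (hα : α ≤ piTop p t)
    (hu : Even u.card) : ev F p n t (mon F α u) = mon F α u := by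
  rw [ev]
  conv_lhs => rw [mon, Module.Basis.constr_basis]
  simp [hα, hu]

theorem ev_mon_of_not {α : Fin (2 * r) → ℕ} {u : Finset (Fin n)}
    (h : ¬ (α ≤ piTop p t ∧ Even u.card)) : ev F p n t (mon F α u) = 0 := by
  rw [ev, mon, Module.Basis.constr_basis, if_neg h]

theorem ev_induction {P : Alg F r n → Prop} (hzero : P 0)
    (hmon : ∀ α u, α ≤ piTop p t → Even u.card → P (mon F α u))
    (hadd : ∀ f g, P f → P g → P (f + g)) (hsmul : ∀ (a : F) f, P f → P (a • f))
    (f : Alg F r n) : P (ev F p n t f) := by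
  induction f using mon_induction with
  | hadd f g h1 h2 => rw [map_add]; exact hadd _ _ h1 h2
  | hsmul a f h1 => rw [map_smul]; exact hsmul _ _ h1
  | hmon α u =>
    by_cases h : α ≤ piTop p t ∧ Even u.card
    · rw [ev_mon h.1 h.2]; exact hmon α u h.1 h.2
    · rw [ev_mon_of_not h]; exact hzero

theorem ev_mem_bd (f : Alg F r n) : ev F p n t f ∈ bd F p n t :=
  ev_induction (zero_mem _) (fun _ u hα _ => mon_mem_bd hα u) (fun _ _ => add_mem)
    (fun a _ => Submodule.smul_mem _ a) f

theorem sgn_ev (f : Alg F r n) : sgn (ev F p n t f) = ev F p n t f :=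
  ev_induction (P := fun f => sgn f = f) (map_zero _) (fun α _ _ hu => sgn_mon_of_even hu α)
    (fun _ _ hf hg => by rw [map_add, hf, hg]) (fun _ _ hf => by rw [map_smul, hf]) f

theorem ev_eq_self [NeZero (2 : F)] {f : Alg F r n} (hf : f ∈ bd F p n t) (hs : sgn f = f) :
    ev F p n t f = f := by
  have h1 : ev F p n t (f + sgn f) = f + sgn f := by
    clear hs
    induction hf using Submodule.span_induction with
    | zero => simp
    | add x y _ _ hx hy =>
      have : x + y + sgn (x + y) = (x + sgn x) + (y + sgn y) := by rw [map_add]; abel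
      rw [this, map_add, hx, hy]
    | smul a x _ hx => rw [map_smul, ← smul_add, map_smul, hx]
    | mem x hx =>
      obtain ⟨α, u, hα, rfl⟩ := hx
      rcases Nat.even_or_odd u.card with hu | hu
      · rw [sgn_mon_of_even hu, map_add, ev_mon hα hu]
      · rw [sgn_mon_of_odd hu, add_neg_cancel, map_zero]
  rw [hs, ← two_smul F, map_smul] at h1
  exact smul_right_injective _ (two_ne_zero (α := F)) h1

theorem DH_ev_mem_Heven (hn : Odd n) (f : Alg F r n) : DH F (ev F p n t f) ∈ Heven F p n t := by
  refine ev_induction (P := fun f => DH F f ∈ Heven F p n t) (by simp) (fun α u hα hu => ?_)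
    (fun _ _ hf hg => by rw [map_add]; exact add_mem hf hg)
    (fun a _ hf => by rw [map_smul]; exact Submodule.smul_mem _ a hf) f
  -- The excluded monomial x^(π) x^ω is odd, as n is odd, so it never occurs here.
  refine Submodule.subset_span ⟨α, u, hα, hu, fun h => ?_, rfl⟩
  obtain ⟨-, rfl⟩ := Prod.mk.inj h
  rw [Finset.card_univ, Fintype.card_fin] at hu
  exact (Nat.not_even_iff_odd.2 hn) hu

theorem exists_ev_of_mem_Heven {D : Module.End F (Alg F r n)} (hD : D ∈ Heven F p n t) :
    ∃ f, D = DH F (ev F p n t f) := by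
  induction hD using Submodule.span_induction with
  | zero => exact ⟨0, by simp⟩
  | add x y _ _ hx hy =>
    obtain ⟨f, rfl⟩ := hx
    obtain ⟨g, rfl⟩ := hy
    exact ⟨f + g, by simp⟩
  | smul a x _ hx =>
    obtain ⟨f, rfl⟩ := hx
    exact ⟨a • f, by simp⟩
  | mem x hx =>
    obtain ⟨α, u, hα, hu, -, rfl⟩ := hx
    exact ⟨mon F α u, by rw [ev_mon hα hu]⟩

theorem bd_le_fil : bd F p n t ≤ fil F p n t ((∑ i, piTop p t i) + n) := by
  refine Submodule.span_le.2 ?_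
  rintro _ ⟨α, u, hα, rfl⟩
  refine mon_mem_fil hα (Nat.add_le_add (Finset.sum_le_sum fun i _ => hα i) ?_)
  simpa using Finset.card_le_univ u

end EvenProjection

/-! ### Derivations as a linear subspace of maps on functions -/

section EvenDerivations

variable (F : Type*) [Field F] (p : ℕ) {r : ℕ} (n : ℕ) (t : Fin (2 * r) → ℕ+)

/-- The linear maps `L` on `𝒪(m, n)` for which `D_H(f) ↦ L(f)`, for `f` in the even part of the
truncated algebra, is a derivation with values in the odd vector fields. -/
def evenDer : Submodule F (Alg F r n →ₗ[F] Module.End F (Alg F r n)) where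
  carrier := {L | (∀ f ∈ bd F p n t, sgn f = f → L f ∈ oddVF F r n) ∧
    ∀ f g, f ∈ bd F p n t → g ∈ bd F p n t → sgn f = f → sgn g = g →
      L (DH F f g) = ad (L f) (DH F g) + ad (DH F f) (L g)}
  zero_mem' := ⟨fun f _ _ => zero_mem _, fun f g _ _ _ _ => by simp [ad_apply]⟩
  add_mem' := by
    rintro K L ⟨hK, hK'⟩ ⟨hL, hL'⟩
    refine ⟨fun f hf hs => add_mem (hK f hf hs) (hL f hf hs), fun f g hf hg hsf hsg => ?_⟩
    rw [LinearMap.add_apply, hK' f g hf hg hsf hsg, hL' f g hf hg hsf hsg]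
    simp only [ad_apply, LinearMap.add_apply, add_mul, mul_add]
    abel
  smul_mem' := by
    rintro a L ⟨hL, hL'⟩
    refine ⟨fun f hf hs => Submodule.smul_mem _ a (hL f hf hs), fun f g hf hg hsf hsg => ?_⟩
    rw [LinearMap.smul_apply, hL' f g hf hg hsf hsg]
    simp only [ad_apply, LinearMap.smul_apply, smul_mul_assoc, mul_smul_comm, smul_sub, smul_add]

variable {F p n t}

theorem OddDer.of_mem_evenDer [NeZero (2 : F)] [Fact p.Prime] [CharP F p]
    {L : Alg F r n →ₗ[F] Module.End F (Alg F r n)} (hL : L ∈ evenDer F p n t) :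
    OddDer p t (L ∘ₗ ev F p n t) where
  field f := (hL.1 _ (ev_mem_bd f) (sgn_ev f)).1
  odd f j := (hL.1 _ (ev_mem_bd f) (sgn_ev f)).2 j
  der f g hf hg hsf hsg := by
    simp only [LinearMap.comp_apply]
    rw [ev_eq_self (DH_apply_mem_bd hsf hf hg) (by rw [sgn_DH_apply hsf, hsg]),
      ev_eq_self hf hsf, ev_eq_self hg hsg, hL.2 f g hf hg hsf hsg]

end EvenDerivations

/-! ### Γ, Φ and Θ are derivations -/

section OuterDerivations

variable (F : Type*) [Field F] (p : ℕ) {r : ℕ} (n : ℕ) (t : Fin (2 * r) → ℕ+)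

/-- The map `f ↦ Γ_1(D_H(f))`. -/
def gamL : Alg F r n →ₗ[F] Module.End F (Alg F r n) :=
  (cf (piTop p t, ∅)).smulRight (DH F (mon F 0 Finset.univ))

variable (r) in
/-- The map `f ↦ Φ_i^(q)(D_H(f))`. -/
def phiL (i : Fin (2 * r)) (q : ℕ) : Alg F r n →ₗ[F] Module.End F (Alg F r n) :=
  LinearMap.mulRight F (DH F (mon F 0 Finset.univ)) ∘ₗ mulL F ∘ₗ (pd F (.inl i) ^ p ^ q)

variable (r) in
/-- The map `f ↦ Θ_i^(q)(D_H(f))`. -/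
def thetaL (i : Fin (2 * r)) (q : ℕ) : Alg F r n →ₗ[F] Module.End F (Alg F r n) :=
  LinearMap.mulLeft F (mulL F (mon F 0 Finset.univ)) ∘ₗ DH F ∘ₗ (pd F (.inl i) ^ p ^ q)

variable {F p n t}

theorem gamL_apply (f : Alg F r n) :
    gamL F p n t f = cf (piTop p t, ∅) f • DH F (mon F 0 Finset.univ) := rfl

theorem phiL_apply (i : Fin (2 * r)) (q : ℕ) (f : Alg F r n) :
    phiL F p r n i q f =
      mulL F ((pd F (.inl i : Idx r n) ^ p ^ q) f) * DH F (mon F 0 Finset.univ) := rfl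

theorem thetaL_apply (i : Fin (2 * r)) (q : ℕ) (f : Alg F r n) :
    thetaL F p r n i q f =
      mulL F (mon F 0 Finset.univ) * DH F ((pd F (.inl i : Idx r n) ^ p ^ q) f) := rfl

theorem sgn_pd_pow (i : Fin (2 * r)) (N : ℕ) {f : Alg F r n} (hf : sgn f = f) :
    sgn ((pd F (.inl i : Idx r n) ^ N) f) = (pd F (.inl i : Idx r n) ^ N) f := by
  induction N with
  | zero => exact hf
  | succ N ih =>
    rw [pow_succ', Module.End.mul_apply, sgn_pd, ih]
    simp [par]

/-- Up to a nonzero scalar, ∂_i is the Hamiltonian field of x_{i'}. -/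
theorem ad_pd_DH [NeZero (2 : F)] (i : Fin (2 * r)) (f : Alg F r n) :
    ad (pd F (.inl i)) (DH F f) = DH F (pd F (.inl i : Idx r n) f) := by
  have h := ad_DH_DH (sgn_var_inl (F := F) (n := n) (evenConj i)) f
  have hv : DH F (var F (.inl (evenConj i))) =
      tau F (.inl (evenConj i) : Idx r n) • pd F (.inl i : Idx r n) :=
    LinearMap.ext fun g => by rw [DH_var_inl, evenConj_evenConj]; rfl
  rw [hv, ad_apply, smul_mul_assoc, mul_smul_comm, ← smul_sub, LinearMap.smul_apply, map_smul] at h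
  exact smul_right_injective _ (tau_inl_ne_zero (F := F) (n := n) (evenConj i)) h

theorem ad_pd_pow_DH [NeZero (2 : F)] (i : Fin (2 * r)) (N : ℕ) (f : Alg F r n) :
    (ad (pd F (.inl i)) ^ N : Module.End F (Module.End F (Alg F r n))) (DH F f) =
      DH F ((pd F (.inl i : Idx r n) ^ N) f) := by
  induction N with
  | zero => rfl
  | succ N ih => rw [pow_succ', Module.End.mul_apply, ih, ad_pd_DH, pow_succ', Module.End.mul_apply]

/-- Left and right multiplication by D commute, so the p^q-th power of their difference is the
difference of the powers. In `pd_pow_DH_apply` this makes ∂_i^(p^q) a derivation of the Poisson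
bracket. -/
theorem ad_pow_char_pow [Fact p.Prime] [CharP F p] (D : Module.End F (Alg F r n)) (q : ℕ) :
    (ad D : Module.End F (Module.End F (Alg F r n))) ^ p ^ q = ad (D ^ p ^ q) := by
  have : Nontrivial (Alg F r n) := ⟨mon F 0 ∅, 0, (monBasis F).ne_zero _⟩
  have : CharP (Module.End F (Module.End F (Alg F r n))) p :=
    charP_of_injective_algebraMap (FaithfulSMul.algebraMap_injective F _) p
  unfold ad
  rw [sub_pow_char_pow_of_commute _ _ (LinearMap.commute_mulLeft_right D D),
    LinearMap.pow_mulLeft, LinearMap.pow_mulRight]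

theorem pd_pow_DH_apply [NeZero (2 : F)] [Fact p.Prime] [CharP F p] (i : Fin (2 * r)) (q : ℕ)
    (f g : Alg F r n) :
    (pd F (.inl i : Idx r n) ^ p ^ q) (DH F f g) =
      DH F ((pd F (.inl i : Idx r n) ^ p ^ q) f) g +
        DH F f ((pd F (.inl i : Idx r n) ^ p ^ q) g) := by
  rw [← ad_pd_pow_DH, ad_pow_char_pow, ad_apply, LinearMap.sub_apply, Module.End.mul_apply,
    Module.End.mul_apply, sub_add_cancel]

theorem DH_mul_mulL [NeZero (2 : F)] {f : Alg F r n} (hf : sgn f = f) (g : Alg F r n) :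
    DH F f * mulL F g = mulL F (DH F f g) + mulL F g * DH F f :=
  LinearMap.ext fun h => DH_mul hf g h

theorem DH_mul_mulL_top [NeZero (2 : F)] {f : Alg F r n} (hf : sgn f = f) :
    DH F f * mulL F (mon F 0 Finset.univ) = mulL F (mon F 0 Finset.univ) * DH F f := by
  rw [DH_mul_mulL hf, DH_apply_top hf, map_zero, zero_add]

theorem DH_mul_DH_top [NeZero (2 : F)] {f : Alg F r n} (hf : sgn f = f) :
    DH F f * DH F (mon F 0 Finset.univ) = DH F (mon F 0 Finset.univ) * DH F f :=
  sub_eq_zero.1 (ad_DH_DH_top hf)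

theorem sgn_top (hn : Odd n) :
    sgn (mon F (0 : Fin (2 * r) → ℕ) (Finset.univ : Finset (Fin n))) = -mon F 0 Finset.univ :=
  sgn_mon_of_odd (by simpa using hn) 0

theorem DH_top_mem_oddVF (hn : Odd n) : DH F (mon F 0 Finset.univ) ∈ oddVF F r n := by
  have h := mulL_mul_DH_mem_oddVF_of_odd (a := (1 : Alg F r n))
    (sgn_mon_of_even (by simp) 0) (sgn_top hn)
  have h1 : mulL F (1 : Alg F r n) = 1 := LinearMap.ext fun g => one_mul g
  rwa [h1, one_mul] at h

/-- The derivation ∂_i^(p^q) of the bracket is followed by multiplication with x^ω, which commutes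
with all even Hamiltonian fields. -/
theorem thetaL_mem_evenDer [NeZero (2 : F)] [Fact p.Prime] [CharP F p] (hn : Odd n)
    (i : Fin (2 * r)) (q : ℕ) : thetaL F p r n i q ∈ evenDer F p n t := by
  refine ⟨fun f _ hs => mulL_mul_DH_mem_oddVF_of_even (sgn_top hn) (sgn_pd_pow i _ hs),
    fun f g _ _ hf hg => ?_⟩
  rw [thetaL_apply, thetaL_apply, thetaL_apply, pd_pow_DH_apply, map_add,
    ← ad_DH_DH (sgn_pd_pow i _ hf), ← ad_DH_DH hf, ad_apply, ad_apply, ad_apply, ad_apply,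
    ← mul_assoc (DH F g), DH_mul_mulL_top hg, ← mul_assoc (DH F f), DH_mul_mulL_top hf]
  simp only [mul_assoc, mul_add, mul_sub]

/-- Since D_H(x^ω) commutes with even Hamiltonian fields, bracketing D_H(f) with a D_H(x^ω) only
differentiates the function a. -/
theorem phiL_mem_evenDer [NeZero (2 : F)] [Fact p.Prime] [CharP F p] (hn : Odd n)
    (i : Fin (2 * r)) (q : ℕ) : phiL F p r n i q ∈ evenDer F p n t := by
  refine ⟨fun f _ hs => mulL_mul_DH_mem_oddVF_of_odd (sgn_pd_pow i _ hs) (sgn_top hn),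
    fun f g _ _ hf hg => ?_⟩
  rw [phiL_apply, phiL_apply, phiL_apply, pd_pow_DH_apply, map_add,
    DH_apply_swap (sgn_pd_pow i _ hf) hg, ad_apply, ad_apply,
    ← mul_assoc (DH F g), DH_mul_mulL hg, ← mul_assoc (DH F f), DH_mul_mulL hf, map_neg]
  simp only [mul_assoc, add_mul, neg_mul, DH_mul_DH_top hf, DH_mul_DH_top hg]
  abel

theorem cf_empty_mul_of_odd [NeZero (2 : F)] {f : Alg F r n} (hf : sgn f = -f) (g : Alg F r n)
    (β : Fin (2 * r) → ℕ) : cf (β, ∅) (f * g) = 0 := by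
  have h : ∀ f : Alg F r n, cf (β, ∅) ((f - sgn f) * g) = 0 := by
    intro f
    induction f using mon_induction with
    | hadd f f' h1 h2 =>
      have : f + f' - sgn (f + f') = (f - sgn f) + (f' - sgn f') := by rw [map_add]; abel
      rw [this, add_mul, map_add, h1, h2, add_zero]
    | hsmul a f h1 => rw [map_smul, ← smul_sub, smul_mul_assoc, map_smul, h1, smul_zero]
    | hmon α u =>
      rcases u.eq_empty_or_nonempty with rfl | hu
      · rw [sgn_mon_of_even (by simp), sub_self, zero_mul, map_zero]
      rw [sgn_mon, ← one_smul F (mon F α u), smul_smul, ← sub_smul, smul_mul_assoc, map_smul]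
      convert smul_zero _
      induction g using mon_induction with
      | hadd g g' h1 h2 => rw [mul_add, map_add, h1, h2, add_zero]
      | hsmul a g h1 => rw [mul_smul_comm, map_smul, h1, smul_zero]
      | hmon γ v =>
        by_cases hd : Disjoint u v
        · rw [mon_mul_mon _ _ hd, map_smul, cf_mon, if_neg, smul_zero]
          rintro ⟨-, h⟩
          exact hu.ne_empty (Finset.union_eq_empty.1 h).1
        · rw [mon_mul_mon_of_not_disjoint _ _ hd, map_zero]
  have h1 := h f
  rw [hf, sub_neg_eq_add, ← two_smul F, smul_mul_assoc, map_smul] at h1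
  exact (smul_eq_zero.1 h1).resolve_left two_ne_zero

theorem sum_tau_pd_pd_conj [NeZero (2 : F)] (g : Alg F r n) :
    ∑ i : Fin (2 * r), tau F (.inl i : Idx r n) •
      pd F (.inl i : Idx r n) (pd F (.inl (evenConj i) : Idx r n) g) = 0 := by
  set S := ∑ i : Fin (2 * r), tau F (.inl i : Idx r n) •
      pd F (.inl i : Idx r n) (pd F (.inl (evenConj i) : Idx r n) g) with hS
  have h : S = -S := by
    conv_lhs => rw [hS, ← Equiv.sum_comp
      (Function.Involutive.toPerm (evenConj (r := r)) evenConj_evenConj)]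
    rw [hS, ← Finset.sum_neg_distrib]
    refine Finset.sum_congr rfl fun i _ => ?_
    change tau F (.inl (evenConj i) : Idx r n) • pd F (.inl (evenConj i) : Idx r n)
      (pd F (.inl (evenConj (evenConj i)) : Idx r n) g) = _
    rw [evenConj_evenConj, tau_evenConj, neg_smul, pd_inl_comm]
  rw [eq_neg_iff_add_eq_zero, ← two_smul F] at h
  exact (smul_eq_zero.1 h).resolve_left two_ne_zero

theorem cf_eq_zero_of_mem_bd {f : Alg F r n} (hf : f ∈ bd F p n t) {β : Fin (2 * r) → ℕ}
    (hβ : ¬ β ≤ piTop p t) (v : Finset (Fin n)) : cf (β, v) f = 0 := by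
  induction hf using Submodule.span_induction with
  | zero => simp
  | add x y _ _ hx hy => rw [map_add, hx, hy, add_zero]
  | smul a x _ hx => rw [map_smul, hx, smul_zero]
  | mem x hx =>
    obtain ⟨α, u, hα, rfl⟩ := hx
    rw [cf_mon, if_neg]
    rintro ⟨rfl, -⟩
    exact hβ hα

/-- The coefficient of x^(π) acts as an integral: it vanishes on ∂_i of a truncated function.
Integrating by parts leaves ∑_i τ(i) ∂_i ∂_{i'} g, summed over even i, which is zero by
antisymmetry; odd indices contribute no term free of odd variables. -/
theorem cf_piTop_DH_apply [NeZero (2 : F)] [Fact p.Prime] [CharP F p] {f g : Alg F r n}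
    (hf : f ∈ bd F p n t) (hg : g ∈ bd F p n t) (hs : sgn f = f) :
    cf (piTop p t, ∅) (DH F f g) = 0 := by
  rw [DH_apply_of_even hs, map_sum, Fintype.sum_sum_type]
  have h1 : ∀ k : Fin n, cf (piTop p t, ∅) (tau F (.inr k : Idx r n) •
      (pd F (.inr k : Idx r n) f * pd F (conj (.inr k) : Idx r n) g)) = 0 := by
    intro k
    rw [map_smul, cf_empty_mul_of_odd _, smul_zero]
    rw [sgn_pd, hs]
    simp [par]
  have h2 : ∀ i : Fin (2 * r), cf (piTop p t, ∅) (tau F (.inl i : Idx r n) •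
      (pd F (.inl i : Idx r n) f * pd F (conj (.inl i) : Idx r n) g)) =
      -cf (piTop p t, ∅) (f * (tau F (.inl i : Idx r n) •
        pd F (.inl i : Idx r n) (pd F (.inl (evenConj i) : Idx r n) g))) := by
    intro i
    have h3 := cf_pd_inl i (piTop p t) ∅ (f * pd F (.inl (evenConj i) : Idx r n) g)
    rw [cf_eq_zero_of_mem_bd (mul_mem_bd hf (pd_mem_bd hg _)), pd_inl_mul, map_add] at h3
    · rw [map_smul, mul_smul_comm, map_smul, ← smul_neg, ← eq_neg_of_add_eq_zero_left h3]
      rfl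
    · intro h
      have := h i
      simp at this
  rw [Finset.sum_congr rfl fun i _ => h2 i, Finset.sum_congr rfl fun k _ => h1 k,
    Finset.sum_neg_distrib, ← map_sum, ← Finset.mul_sum, sum_tau_pd_pd_conj]
  simp

theorem gamL_mem_evenDer [NeZero (2 : F)] [Fact p.Prime] [CharP F p] (hn : Odd n) :
    gamL F p n t ∈ evenDer F p n t := by
  refine ⟨fun f _ _ => Submodule.smul_mem _ _ (DH_top_mem_oddVF hn), fun f g hf' hg' hf hg => ?_⟩
  rw [gamL_apply, gamL_apply, gamL_apply, cf_piTop_DH_apply hf' hg' hf, ad_apply, ad_apply,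
    smul_mul_assoc, smul_mul_assoc, mul_smul_comm, mul_smul_comm, DH_mul_DH_top hf,
    DH_mul_DH_top hg]
  simp

end OuterDerivations

/-! ### Test coefficients of the outer derivations -/

section Values

variable {F : Type*} [Field F] {p : ℕ} {r n : ℕ} {t : Fin (2 * r) → ℕ+}

theorem pd_pow_mon (i : Fin (2 * r)) (N : ℕ) (α : Fin (2 * r) → ℕ) (u : Finset (Fin n)) :
    (pd F (.inl i : Idx r n) ^ N) (mon F α u) =
      if N ≤ α i then mon F (α - Pi.single i N) u else 0 := by
  induction N with
  | zero => simp
  | succ N ih =>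
    rw [pow_succ', Module.End.mul_apply, ih]
    by_cases h : N + 1 ≤ α i
    · rw [if_pos (by omega), if_pos h, pd_inl_mon, if_pos (by simp; omega)]
      congr 1
      funext l
      by_cases hl : l = i
      · subst hl; simp; omega
      · simp [hl]
    · rw [if_neg h]
      split_ifs with h1
      · exact pd_inl_of_eq_zero (by simp; omega) u
      · exact map_zero _

theorem sub_single_eq_iff {i : Fin (2 * r)} {N : ℕ} {α β : Fin (2 * r) → ℕ} (h : N ≤ α i) :
    α - Pi.single i N = β ↔ α = β + Pi.single i N := by
  have : Pi.single i N ≤ α := by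
    intro l
    by_cases hl : l = i
    · subst hl; simpa using h
    · simp [hl]
  exact tsub_eq_iff_eq_add_of_le this

/-- The value of `D_H(x^ω)` at the last odd variable is `topSign n • x^(ω ∖ last)`. -/
def topSign (F : Type*) [Field F] {n : ℕ} (hn : Odd n) : F :=
  -(-1) ^ ((Finset.univ : Finset (Fin n)).filter fun l => l < last hn).card

theorem topSign_ne_zero (hn : Odd n) : topSign F hn ≠ 0 := by
  unfold topSign
  exact neg_ne_zero.2 (pow_ne_zero _ (neg_ne_zero.2 one_ne_zero))

theorem DH_top_last (hn : Odd n) :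
    DH F (mon F 0 Finset.univ) (var F (.inr (last hn)) : Alg F r n) =
      topSign F hn • mon F 0 (Finset.univ.erase (last hn)) := by
  rw [DH_eq_vf, vf_var, twist_inr, sgn_top hn]
  simp only [conj, oddConj_last, tau, one_smul]
  rw [map_neg, pd_inr_mon, if_pos (Finset.mem_univ _), topSign, neg_smul]

theorem DH_top_inl (i : Fin (2 * r)) :
    DH F (mon F 0 Finset.univ) (var F (.inl i) : Alg F r n) = 0 := by
  rw [DH_eq_vf, vf_var, twist_inl, conj, pd_inl_of_eq_zero rfl, smul_zero]

theorem gamL_last (hn : Odd n) (f : Alg F r n) :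
    cf (0, Finset.univ.erase (last hn)) (gamL F p n t f (var F (.inr (last hn)))) =
      cf (piTop p t, ∅) f * topSign F hn := by
  rw [gamL_apply, LinearMap.smul_apply, DH_top_last]
  simp [cf_mon]

theorem gamL_inl (i : Fin (2 * r)) (f : Alg F r n) : gamL F p n t f (var F (.inl i)) = 0 := by
  rw [gamL_apply, LinearMap.smul_apply, DH_top_inl, smul_zero]

/-- On monomials in the even variables, Φ and Γ are invisible along the even ∂_i while Θ is
invisible along the last odd one (`thetaL_last`), so their coefficients can be read off separately.
-/
theorem phiL_inl (l : Fin (2 * r)) (q : ℕ) (i : Fin (2 * r)) (f : Alg F r n) :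
    phiL F p r n l q f (var F (.inl i)) = 0 := by
  rw [phiL_apply, Module.End.mul_apply, DH_top_inl, map_zero]

theorem phiL_last (hn : Odd n) (l : Fin (2 * r)) (q : ℕ) (α : Fin (2 * r) → ℕ) :
    cf (0, Finset.univ.erase (last hn))
      (phiL F p r n l q (mon F α ∅) (var F (.inr (last hn)))) =
      if α = Pi.single l (p ^ q) then topSign F hn else 0 := by
  rw [phiL_apply, Module.End.mul_apply, DH_top_last, mulL_apply, pd_pow_mon]
  split_ifs with h1 h2 h2
  · rw [mul_smul_comm, mon_mul_mon _ _ (by simp), (sub_single_eq_iff h1).2 (h2.trans (zero_add _).symm)]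
    simp [invSign_empty_left, cf_mon]
  · rw [mul_smul_comm, mon_mul_mon _ _ (by simp), map_smul, map_smul, cf_mon, if_neg]
    · simp
    · rintro ⟨h, -⟩
      rw [add_zero, sub_single_eq_iff h1, zero_add] at h
      exact h2 h
  · rw [h2] at h1; simp at h1
  · simp

theorem thetaL_last (hn : Odd n) (l : Fin (2 * r)) (q : ℕ) (α : Fin (2 * r) → ℕ) :
    thetaL F p r n l q (mon F α ∅) (var F (.inr (last hn))) = 0 := by
  rw [thetaL_apply, Module.End.mul_apply, pd_pow_mon]
  split_ifs
  · rw [DH_apply_var (sgn_mon_of_even (by simp) _), conj, pd_inr_mon]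
    simp
  · simp

theorem thetaL_inl (l : Fin (2 * r)) (q : ℕ) (i : Fin (2 * r)) (α : Fin (2 * r) → ℕ) :
    cf (0, Finset.univ) (thetaL F p r n l q (mon F α ∅) (var F (.inl i))) =
      if α = Pi.single l (p ^ q) + Pi.single (evenConj i) 1
        then tau F (.inl (evenConj i) : Idx r n) else 0 := by
  rw [thetaL_apply, Module.End.mul_apply, pd_pow_mon]
  split_ifs with h1 h2 h2
  · rw [DH_apply_var (sgn_mon_of_even (by simp) _), conj, mulL_apply,
      (sub_single_eq_iff h1).2 (h2.trans (add_comm _ _))]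
    have h3 : pd F (.inl (evenConj i) : Idx r n) (mon F (Pi.single (evenConj i) 1) ∅) = 1 := by
      have := pd_inl_add_single (F := F) (n := n) (evenConj i) 0 ∅
      rwa [zero_add] at this
    rw [h3, mul_smul_comm, mul_one]
    simp [cf_mon]
  · rw [DH_apply_var (sgn_mon_of_even (by simp) _), conj, mulL_apply, pd_inl_mon]
    split_ifs with h3
    · rw [mul_smul_comm, mon_mul_mon _ _ (by simp), map_smul, map_smul, cf_mon, if_neg]
      · simp
      · rintro ⟨h, -⟩
        apply h2
        rw [add_comm, ← sub_single_eq_iff h1]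
        rw [zero_add] at h
        funext m
        have hm := congrFun h m
        by_cases hmi : m = evenConj i
        · subst hmi
          rw [Function.update_self] at hm
          simp only [Pi.zero_apply] at hm
          rw [Pi.single_eq_same]
          omega
        · rw [Function.update_of_ne hmi] at hm
          rw [hm, Pi.single_eq_of_ne hmi, Pi.zero_apply]
    · simp
  · rw [h2] at h1; simp at h1
  · simp

end Values

/-! ### Subtracting the outer derivations -/

section Correction

variable {F : Type*} [Field F] {p : ℕ} {r n : ℕ} {t : Fin (2 * r) → ℕ+}

theorem mulL_pdMon_mem_Wdeg {α : Fin (2 * r) → ℕ} {u : Finset (Fin n)} (hα : α ≤ piTop p t)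
    (i j : Idx r n) :
    mulL F (pdMon F i (α, u)) * pd F j ∈ Wdeg F p n t (((∑ i, α i) + u.card : ℕ) - 2 : ℤ) := by
  rcases i with i | k
  · simp only [pdMon]
    split_ifs with h
    · refine Submodule.subset_span ⟨_, u, j, ?_, ?_, rfl⟩
      · intro l
        by_cases hl : l = i
        · subst hl
          have h1 : α l ≤ piTop p t l := hα l
          simp only [Function.update_self]; omega
        · simpa [hl] using hα l
      · have h1 : ∑ l, Function.update α i (α i - 1) l + 1 = ∑ l, α l := by
          rw [Finset.sum_update_of_mem (Finset.mem_univ i),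
            ← Finset.add_sum_erase _ _ (Finset.mem_univ i), Finset.sdiff_singleton_eq_erase]
          omega
        rw [← h1]; push_cast; ring
    · rw [map_zero, zero_mul]; exact zero_mem _
  · simp only [pdMon]
    split_ifs with h
    · rw [map_smul, smul_mul_assoc]
      refine Submodule.smul_mem _ _ (Submodule.subset_span ⟨α, _, j, hα, ?_, rfl⟩)
      have h1 := Finset.card_erase_add_one h
      rw [← h1]; push_cast; ring
    · rw [map_zero, zero_mul]; exact zero_mem _

theorem DH_mon_mem_Wdeg {α : Fin (2 * r) → ℕ} (u : Finset (Fin n)) (hα : α ≤ piTop p t) :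
    DH F (mon F α u) ∈ Wdeg F p n t (((∑ i, α i) + u.card : ℕ) - 2 : ℤ) := by
  rw [DH, mon, Module.Basis.constr_basis]
  exact Submodule.sum_mem _ fun i _ => Submodule.smul_mem _ _ (mulL_pdMon_mem_Wdeg hα i _)

/-- The linear map `f ↦ φ(D_H(f))` on the even part of the truncated algebra, extended by `0`. -/
def liftL (hn : Odd n) (φ : Heven F p n t →ₗ[F] Wodd F p n t) :
    Alg F r n →ₗ[F] Module.End F (Alg F r n) :=
  (Wodd F p n t).subtype ∘ₗ φ ∘ₗ
    (DH F ∘ₗ ev F p n t).codRestrict (Heven F p n t) (DH_ev_mem_Heven hn)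

theorem liftL_apply (hn : Odd n) (φ : Heven F p n t →ₗ[F] Wodd F p n t) {f g : Alg F r n}
    (h : ev F p n t f = g) (hg : DH F g ∈ Heven F p n t) :
    liftL hn φ f = φ ⟨DH F g, hg⟩ := by
  subst h; rfl

theorem liftL_mem_evenDer [NeZero (2 : F)] [Fact p.Prime] [CharP F p] (hn : Odd n)
    {φ : Heven F p n t →ₗ[F] Wodd F p n t} (hφ : IsDer F p n t φ) :
    liftL hn φ ∈ evenDer F p n t := by
  refine ⟨fun f _ _ => Wodd_le_oddVF p t (φ _).2, fun f g hf hg hsf hsg => ?_⟩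
  have hh : ev F p n t (DH F f g) = DH F f g :=
    ev_eq_self (DH_apply_mem_bd hsf hf hg) (by rw [sgn_DH_apply hsf, hsg])
  have mem : ∀ {f : Alg F r n}, ev F p n t f = f → DH F f ∈ Heven F p n t := fun {f} h => by
    rw [← h]; exact DH_ev_mem_Heven hn f
  have ef := ev_eq_self hf hsf
  have eg := ev_eq_self hg hsg
  rw [liftL_apply hn φ hh (mem hh), liftL_apply hn φ ef (mem ef), liftL_apply hn φ eg (mem eg)]
  exact hφ ⟨_, mem ef⟩ ⟨_, mem eg⟩ ⟨_, mem hh⟩ (ad_DH_DH hsf g).symm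

theorem liftL_mon_eq_zero (hn : Odd n) {φ : Heven F p n t →ₗ[F] Wodd F p n t}
    (hφ : VanishesOnTop F p n t φ) {α : Fin (2 * r) → ℕ} {u : Finset (Fin n)}
    (hα : α ≤ piTop p t) (hu : Even u.card) (hd : (∑ i, α i) + u.card ≤ 2) :
    liftL hn φ (mon F α u) = 0 := by
  have hev := ev_mon (F := F) hα hu
  have hmem : DH F (mon F α u) ∈ Heven F p n t := by rw [← hev]; exact DH_ev_mem_Heven hn _
  rw [liftL_apply hn φ hev hmem, hφ, ZeroMemClass.coe_zero]
  have h := DH_mon_mem_Wdeg (F := F) u hα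
  -- Functions of degree 1 and 2 give fields of degree -1 and 0; in degree 0 the field D_H(1) is
  -- zero.
  generalize hN : (∑ i, α i) + u.card = N at hd h
  interval_cases N
  · have h1 : α = 0 := by
      funext i
      exact Nat.le_zero.1 ((Finset.single_le_sum (fun i _ => Nat.zero_le (α i))
        (Finset.mem_univ i)).trans (by omega))
    have h2 : u = ∅ := Finset.card_eq_zero.1 (by omega)
    have h3 : DH F (mon F α u) = 0 := by
      rw [h1, h2]; exact LinearMap.ext fun g => DH_one_apply g
    simp only [h3]
    exact zero_mem _
  · exact Submodule.mem_sup_left h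
  · exact Submodule.mem_sup_right h

variable (p t) in
/-- The map `f ↦ (Γ_μ + ∑ (a_i^(q) Φ_i^(q) + b_i^(q) Θ_i^(q)))(D_H(f))`. -/
def outerL (μ : F) (a b : Fin (2 * r) → ℕ → F) :
    Alg F r n →ₗ[F] Module.End F (Alg F r n) :=
  μ • gamL F p n t +
    ∑ i, ∑ s ∈ Finset.Ico 1 (t i : ℕ), (a i s • phiL F p r n i s + b i s • thetaL F p r n i s)

theorem outerL_mem_evenDer [NeZero (2 : F)] [Fact p.Prime] [CharP F p] (hn : Odd n) (μ : F)
    (a b : Fin (2 * r) → ℕ → F) : outerL p t μ a b ∈ evenDer F p n t :=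
  add_mem (Submodule.smul_mem _ _ (gamL_mem_evenDer hn)) <|
    Submodule.sum_mem _ fun i _ => Submodule.sum_mem _ fun s _ =>
      add_mem (Submodule.smul_mem _ _ (phiL_mem_evenDer hn i s))
        (Submodule.smul_mem _ _ (thetaL_mem_evenDer hn i s))

theorem outerL_apply (μ : F) (a b : Fin (2 * r) → ℕ → F) (f : Alg F r n) :
    outerL p t μ a b f = μ • gamL F p n t f + ∑ i, ∑ s ∈ Finset.Ico 1 (t i : ℕ),
      (a i s • phiL F p r n i s f + b i s • thetaL F p r n i s f) := by
  simp [outerL, LinearMap.sum_apply]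

variable [Fact p.Prime]

theorem outerL_eq [NeZero r] (μ : F) (a b : Fin (2 * r) → ℕ → F) {f : Alg F r n}
    [NeZero (2 : F)] (hf : DH F f ∈ Heven F p n t) :
    (Gam F p n t μ + ∑ i, ∑ s ∈ Finset.Ico 1 (t i : ℕ),
      (a i s • Phi F p n t i s + b i s • Theta F p n t i s)) ⟨DH F f, hf⟩ = outerL p t μ a b f := by
  rw [outerL_apply, LinearMap.add_apply, LinearMap.sum_apply]
  congr 1
  · rw [Gam, descend_DH, gamL_apply, smul_smul]; rfl
  · refine Finset.sum_congr rfl fun i _ => ?_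
    rw [LinearMap.sum_apply]
    refine Finset.sum_congr rfl fun s _ => ?_
    rw [LinearMap.add_apply, LinearMap.smul_apply, LinearMap.smul_apply, Phi, descend_DH]
    congr 2
    rw [thetaL_apply, ← ad_pd_pow_DH]
    rfl

/-- Exponents are at most 2 in this range, whereas π_i ≥ p - 1 > 2 and p^s > 2 for s ≥ 1. -/
theorem outerL_mon_eq_zero [NeZero r] (hp : 3 < p) (μ : F) (a b : Fin (2 * r) → ℕ → F)
    {α : Fin (2 * r) → ℕ} {u : Finset (Fin n)} (hd : (∑ i, α i) + u.card ≤ 2) :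
    outerL p t μ a b (mon F α u) = 0 := by
  have hle : ∀ i, α i ≤ 2 := fun i =>
    (Finset.single_le_sum (fun i _ => Nat.zero_le (α i)) (Finset.mem_univ i)).trans (by omega)
  have h1 : cf (piTop p t, ∅) (mon F α u) = 0 := by
    rw [cf_mon, if_neg]
    rintro ⟨h, -⟩
    have hr : 0 < r := Nat.pos_of_ne_zero (NeZero.ne r)
    have h2 := hle ⟨0, by omega⟩
    rw [h] at h2
    have h3 := one_le_piTop (p := p) (t := t) ⟨0, by omega⟩
    omega
  have h2 : ∀ i s, s ∈ Finset.Ico 1 (t i : ℕ) →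
      (pd F (.inl i : Idx r n) ^ p ^ s) (mon F α u) = 0 := by
    intro i s hs
    rw [pd_pow_mon, if_neg]
    have h3 : p ≤ p ^ s := Nat.le_self_pow (by have := (Finset.mem_Ico.1 hs).1; omega) p
    have := hle i
    omega
  rw [outerL_apply, gamL_apply, h1, zero_smul, smul_zero, zero_add]
  refine Finset.sum_eq_zero fun i _ => Finset.sum_eq_zero fun s hs => ?_
  rw [phiL_apply, thetaL_apply, h2 i s hs]
  simp

theorem single_pow_inj {i l : Fin (2 * r)} {q s : ℕ} :
    (Pi.single i (p ^ q) : Fin (2 * r) → ℕ) = Pi.single l (p ^ s) ↔ l = i ∧ s = q := by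
  have hp := (Fact.out : p.Prime)
  constructor
  · intro h
    by_cases hl : l = i
    · subst hl
      exact ⟨rfl, (Nat.pow_right_injective hp.two_le (by simpa using congrFun h l)).symm⟩
    · have := congrFun h l
      rw [Pi.single_eq_of_ne hl, Pi.single_eq_same] at this
      exact absurd this.symm (pow_ne_zero _ hp.ne_zero)
  · rintro ⟨rfl, rfl⟩; rfl

theorem single_ne_piTop (i : Fin (2 * r)) (N : ℕ) : Pi.single i N ≠ piTop p t := by
  intro h
  have h1 := congrFun h (evenConj i)
  have h2 := one_le_piTop (p := p) (t := t) (evenConj i)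
  have h3 := (Fact.out : p.Prime).two_le
  rw [Pi.single_eq_of_ne (evenConj_ne i)] at h1
  omega

theorem sum_Ico_ite {t : Fin (2 * r) → ℕ+} (a : Fin (2 * r) → ℕ → F) {i : Fin (2 * r)} {q : ℕ}
    (h1 : 1 ≤ q) (h2 : q < (t i : ℕ)) (c : F) :
    ∑ l, ∑ s ∈ Finset.Ico 1 (t l : ℕ), a l s * (if l = i ∧ s = q then c else 0) = a i q * c := by
  rw [Finset.sum_eq_single i, Finset.sum_eq_single q]
  · simp
  · intro s _ hs; simp [hs]
  · intro h; exact absurd (Finset.mem_Ico.2 ⟨h1, h2⟩) h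
  · intro l _ hl; simp [hl]
  · simp

theorem outerL_single_last (hn : Odd n) (μ : F) (a b : Fin (2 * r) → ℕ → F) {i : Fin (2 * r)}
    {q : ℕ} (h1 : 1 ≤ q) (h2 : q < (t i : ℕ)) :
    cf (0, Finset.univ.erase (last hn))
      (outerL p t μ a b (mon F (Pi.single i (p ^ q)) ∅) (var F (.inr (last hn)))) =
      a i q * topSign F hn := by
  simp only [outerL_apply, LinearMap.add_apply, LinearMap.smul_apply, LinearMap.sum_apply, map_add,
    map_smul, map_sum, gamL_last, phiL_last, thetaL_last, smul_zero, add_zero, cf_mon,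
    single_ne_piTop, false_and, if_false, zero_mul, mul_zero, zero_add, smul_eq_mul,
    single_pow_inj]
  exact sum_Ico_ite a h1 h2 _

theorem outerL_piTop_last (hn : Odd n) (μ : F) (a b : Fin (2 * r) → ℕ → F) :
    cf (0, Finset.univ.erase (last hn))
      (outerL p t μ a b (mon F (piTop p t) ∅) (var F (.inr (last hn)))) = μ * topSign F hn := by
  simp [outerL_apply, gamL_last, phiL_last, thetaL_last, cf_mon, (single_ne_piTop _ _).symm]

theorem outerL_pair_inl (μ : F) (a b : Fin (2 * r) → ℕ → F) {i : Fin (2 * r)}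
    {q : ℕ} (h1 : 1 ≤ q) (h2 : q < (t i : ℕ)) :
    cf (0, Finset.univ) (outerL p t μ a b (n := n)
      (mon F (Pi.single i (p ^ q) + Pi.single (evenConj i) 1) ∅) (var F (.inl i))) =
      b i q * tau F (.inl (evenConj i) : Idx r n) := by
  simp only [outerL_apply, LinearMap.add_apply, LinearMap.smul_apply, LinearMap.sum_apply,
    map_smul, map_sum, gamL_inl, phiL_inl, thetaL_inl, smul_zero, zero_add,
    smul_eq_mul, add_left_inj, single_pow_inj]
  exact sum_Ico_ite b h1 h2 _

theorem single_pow_le_piTop {i : Fin (2 * r)} {q : ℕ} (h : q < (t i : ℕ)) :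
    Pi.single i (p ^ q) ≤ piTop p t := by
  intro l
  by_cases hl : l = i
  · subst hl
    have := Nat.pow_lt_pow_right (Fact.out : p.Prime).one_lt h
    have := piTop_add_one (p := p) (t := t) l
    simp only [Pi.single_eq_same]; omega
  · simp [hl]

theorem single_pow_add_single_le_piTop {i : Fin (2 * r)} {q : ℕ} (h : q < (t i : ℕ)) :
    Pi.single i (p ^ q) + Pi.single (evenConj i) 1 ≤ piTop p t := by
  intro l
  by_cases hl : l = evenConj i
  · subst hl
    have h2 := one_le_piTop (p := p) (t := t) (evenConj i)
    have h3 := (Fact.out : p.Prime).two_le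
    simp only [Pi.add_apply, Pi.single_eq_of_ne (evenConj_ne i), Pi.single_eq_same]
    omega
  · rw [Pi.add_apply, Pi.single_eq_of_ne hl, add_zero]
    exact single_pow_le_piTop h l

/-- The scalars are the test coefficients of φ divided by those of the matching Γ, Φ or Θ. The
difference then satisfies the hypotheses of `OddDer.kills`, and all truncated functions have bounded
degree. -/
theorem exists_eq_outer [CharP F p] [NeZero (2 : F)] [NeZero (3 : F)] [NeZero r] (hp : 3 < p)
    (hn : Odd n) {φ : Heven F p n t →ₗ[F] Wodd F p n t} (hder : IsDer F p n t φ)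
    (htop : VanishesOnTop F p n t φ) :
    ∃ (μ : F) (a b : Fin (2 * r) → ℕ → F),
      (Wodd F p n t).subtype ∘ₗ φ = Gam F p n t μ + ∑ i, ∑ s ∈ Finset.Ico 1 (t i : ℕ),
        (a i s • Phi F p n t i s + b i s • Theta F p n t i s) := by
  set L := liftL hn φ with hL
  set ν : Module.End F (Alg F r n) → F := fun E =>
    cf (0, Finset.univ.erase (last hn)) (E (var F (.inr (last hn)))) with hν
  set μ : F := ν (L (mon F (piTop p t) ∅)) / topSign F hn with hμ
  set a : Fin (2 * r) → ℕ → F := fun i q =>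
    ν (L (mon F (Pi.single i (p ^ q)) ∅)) / topSign F hn with ha
  set b : Fin (2 * r) → ℕ → F := fun i q =>
    cf (0, Finset.univ) (L (mon F (Pi.single i (p ^ q) + Pi.single (evenConj i) 1) ∅)
      (var F (.inl i))) / tau F (.inl (evenConj i) : Idx r n) with hb
  refine ⟨μ, a, b, ?_⟩
  have hev : ∀ {α : Fin (2 * r) → ℕ}, α ≤ piTop p t → ev F p n t (mon F α ∅) = mon F α ∅ :=
    fun hα => ev_mon hα (by simp)
  have H : OddDer p t ((L - outerL p t μ a b) ∘ₗ ev F p n t) :=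
    OddDer.of_mem_evenDer (sub_mem (liftL_mem_evenDer hn hder) (outerL_mem_evenDer hn μ a b))
  have hkill := H.kills hn hp
    (kills_of_mon fun α u hα hu hd => by
      rw [LinearMap.comp_apply, ev_mon hα hu, LinearMap.sub_apply,
        liftL_mon_eq_zero hn htop hα hu hd, outerL_mon_eq_zero hp μ a b hd, sub_zero])
    (fun i q h1 h2 => by
      rw [LinearMap.comp_apply, hev (single_pow_le_piTop h2), LinearMap.sub_apply,
        LinearMap.sub_apply, map_sub, outerL_single_last hn μ a b h1 h2, ha,
        div_mul_cancel₀ _ (topSign_ne_zero hn), sub_self])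
    (fun i q h1 h2 => by
      rw [LinearMap.comp_apply, hev (single_pow_add_single_le_piTop h2), LinearMap.sub_apply,
        LinearMap.sub_apply, map_sub, outerL_pair_inl μ a b h1 h2, hb,
        div_mul_cancel₀ _ (tau_inl_ne_zero _), sub_self])
    (by
      rw [LinearMap.comp_apply, hev le_rfl, LinearMap.sub_apply,
        LinearMap.sub_apply, map_sub, outerL_piTop_last hn μ a b, hμ,
        div_mul_cancel₀ _ (topSign_ne_zero hn), sub_self])
  refine LinearMap.ext fun ⟨D, hD⟩ => ?_
  obtain ⟨f, rfl⟩ := exists_ev_of_mem_Heven hD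
  set g := ev F p n t f with hg
  have hgg : ev F p n t g = g := ev_eq_self (ev_mem_bd f) (sgn_ev f)
  have h := hkill _ g (fil_mono (Nat.le_add_right _ 3) (bd_le_fil (ev_mem_bd f))) (sgn_ev f)
  rw [LinearMap.comp_apply, hgg, LinearMap.sub_apply, sub_eq_zero] at h
  rw [outerL_eq μ a b hD, ← h, hL, liftL_apply hn φ hgg hD]
  rfl

end Correction

end OddHam

end

theorem theorem4p8 {F : Type*} [Field F] [IsAlgClosed F] (p : ℕ) [Fact p.Prime] [CharP F p]
    (hp : 3 < p) (r n : ℕ) [NeZero r] (hn : Odd n) (t : Fin (2 * r) → ℕ+)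
    (φ : OddHam.Heven F p n t →ₗ[F] OddHam.Wodd F p n t)
    (hder : OddHam.IsDer F p n t φ) (hhom : OddHam.IsHomog F p n t φ)
    (htop : OddHam.VanishesOnTop F p n t φ) :
    ∃ (μ l : F) (a b : Fin (2 * r) → ℕ → F),
      (OddHam.Wodd F p n t).subtype ∘ₗ φ =
        OddHam.Gam F p n t μ + l • OddHam.adCalD F p n t hn.pos +
          ∑ i, ∑ s ∈ Finset.Ico 1 (t i : ℕ),
            (a i s • OddHam.Phi F p n t i s + b i s • OddHam.Theta F p n t i s) := by
  have h2 : NeZero (2 : F) :=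
    ⟨by exact_mod_cast OddHam.cast_ne_zero_of_lt (F := F) (p := p) two_pos (by omega)⟩
  have h3 : NeZero (3 : F) :=
    ⟨by exact_mod_cast OddHam.cast_ne_zero_of_lt (F := F) (p := p) three_pos hp⟩
  obtain ⟨μ, a, b, h⟩ := OddHam.exists_eq_outer hp hn hder htop
  -- No multiple of ad 𝔇 is needed, so its coefficient is taken to be 0.
  exact ⟨μ, 0, a, b, by rw [h, zero_smul, add_zero]⟩
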